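/- Let $m,d\ge 1$ be integers, $p\ge 2$, $\nu>0$ and $K\ge 0$ real numbers. For multi-indices $\alpha,\beta\in\{0,1,2,\dots\}^d$ with $|\alpha|=|\beta|=m$ let $a^{\alpha\beta}:(0,\infty)\to\mathbb{C}$ be measurable functions with $|a^{\alpha\beta}(t)|\le K$ and $$\nu|\xi|^{2m}\le\sum_{|\alpha|=|\beta|=m}\xi^\alpha\xi^\beta\,\mathrm{Re}\,[a^{\alpha\beta}(t)]\le\nu^{-1}|\xi|^{2m}\qquad\text{for all }\xi\in\mathbb{R}^d$$ for almost every $t>0$. Let $\mathcal{F}f(\xi)=\int_{\mathbb{R}^d}e^{-ix\cdot\xi}f(x)\,dx$ and $\mathcal{F}^{-1}f(x)=(2\pi)^{-d}\int_{\mathbb{R}^d}e^{i\xi\cdot x}f(\xi)\,d\xi$, and let $$p_1(t,s,x)=I_{0\le s<t}\,\mathcal{F}^{-1}\Big(\exp\Big\{-\int_s^t\sum_{|\alpha|=|\beta|=m}a^{\alpha\beta}(r)\,\xi^\alpha\xi^\beta\,dr\Big\}\Big)(x)$$ be the kernel of the operator $A_1(t)u=(-1)^{m-1}\sum_{|\alpha|=|\beta|=m}a^{\alpha\beta}(t)D^{\alpha+\beta}u$.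 Let $\Delta^{m/2}$ denote the operator with symbol $|\xi|^m$, i.e. $\Delta^{m/2}u=\mathcal{F}^{-1}(|\xi|^m\mathcal{F}u)$, acting in the variable $x$. Then there is a constant $N$ depending only on $p,\nu,m,d$ and $K$ such that for every complex Hilbert space $H$ and every $f\in C_0^\infty(\mathbb{R}^{d+1},H)$ (smooth with compact support), $$\left\|\Big(\int_0^t\big|\Delta^{m/2}p_1(t,s,\cdot)*f(s,\cdot)(x)\big|_H^2\,ds\Big)^{1/2}\right\|_{L_p(\mathbb{R}^{d+1})}\le N\,\big\||f|_H\big\|_{L_p(\mathbb{R}^{d+1})},$$ where the inner integral is read as $0$ for $t\le 0$ (there $p_1$ vanishes). -/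

import Mathlib

open MeasureTheory Set
open scoped Convolution ContDiff NNReal ENNReal

universe u

noncomputable section

namespace HigherOrderLP

/-- The space `ℝ^d` with its Euclidean norm. -/
abbrev Space (d : ℕ) : Type := EuclideanSpace ℝ (Fin d)

/-- The multi-indices `α = (α₁, …, α_d)` of non-negative integers with `α₁ + ⋯ + α_d = m`. -/
def multiIndices (d m : ℕ) : Finset (Fin d → ℕ) :=
  Finset.piAntidiag Finset.univ m

/-- The monomial `ξ^α = ξ₁^{α₁} ⋯ ξ_d^{α_d}`. -/
def monomial {d : ℕ} (α : Fin d → ℕ) (ξ : Space d) : ℝ :=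
  ∏ i, ξ i ^ α i

/-- The Fourier transform `𝓕 f (ξ) = ∫ e^{-i x · ξ} f(x) dx`. -/
def fourierT {d : ℕ} (f : Space d → ℂ) (ξ : Space d) : ℂ :=
  ∫ x, Complex.exp (-(Complex.I * (inner ℝ x ξ : ℝ))) * f x

/-- The inverse Fourier transform `𝓕⁻¹ f (x) = (2π)^{-d} ∫ e^{i ξ · x} f(ξ) dξ`. -/
def fourierTInv {d : ℕ} (f : Space d → ℂ) (x : Space d) : ℂ :=
  ((2 * Real.pi : ℝ) : ℂ)⁻¹ ^ d * ∫ ξ, Complex.exp (Complex.I * (inner ℝ ξ x : ℝ)) * f ξ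

/-- The fractional power `(-Δ)^σ` of the Laplacian: the operator with symbol `|ξ|^{2σ}`. -/
def fracLaplacian {d : ℕ} (σ : ℝ) (u : Space d → ℂ) : Space d → ℂ :=
  fourierTInv fun ξ => ((‖ξ‖ ^ (2 * σ) : ℝ) : ℂ) * fourierT u ξ

/-- The symbol `ψ(t, ξ) = -∑_{|α| = |β| = m} a^{αβ}(t) ξ^α ξ^β` of the operator
`A₁(t) u = (-1)^{m-1} ∑_{|α| = |β| = m} a^{αβ}(t) D^{α+β} u`. -/
def symbolA1 {d : ℕ} (m : ℕ) (a : (Fin d → ℕ) → (Fin d → ℕ) → ℝ → ℂ)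
    (t : ℝ) (ξ : Space d) : ℂ :=
  -∑ α ∈ multiIndices d m, ∑ β ∈ multiIndices d m,
    a α β t * ((monomial α ξ * monomial β ξ : ℝ) : ℂ)

open Classical in
/-- The kernel `p₁(t, s, x) = 1_{0 ≤ s < t} 𝓕⁻¹ (exp ∫_s^t ψ(r, ·) dr) (x)` of `A₁`. -/
def kernelP1 {d : ℕ} (m : ℕ) (a : (Fin d → ℕ) → (Fin d → ℕ) → ℝ → ℂ)
    (t s : ℝ) : Space d → ℂ :=
  if 0 ≤ s ∧ s < t then
    fourierTInv fun ξ => Complex.exp (∫ r in s..t, symbolA1 m a r ξ)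
  else 0

/-- `a^{αβ}`, `|α| = |β| = m`, are measurable functions of time, bounded by `K` and elliptic
with constant `ν`: for (almost) every `t > 0`,
`ν |ξ|^{2m} ≤ ∑_{|α| = |β| = m} ξ^α ξ^β Re a^{αβ}(t) ≤ ν⁻¹ |ξ|^{2m}` for all `ξ`. -/
structure IsEllipticCoeff {d : ℕ} (m : ℕ) (ν K : ℝ)
    (a : (Fin d → ℕ) → (Fin d → ℕ) → ℝ → ℂ) : Prop where
  measurable : ∀ α ∈ multiIndices d m, ∀ β ∈ multiIndices d m, Measurable (a α β)
  bounded : ∀ᵐ t : ℝ, 0 < t →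
    ∀ α ∈ multiIndices d m, ∀ β ∈ multiIndices d m, ‖a α β t‖ ≤ K
  elliptic_lower : ∀ᵐ t : ℝ, 0 < t → ∀ ξ : Space d,
    ν * ‖ξ‖ ^ (2 * m) ≤ ∑ α ∈ multiIndices d m, ∑ β ∈ multiIndices d m,
      monomial α ξ * monomial β ξ * (a α β t).re
  elliptic_upper : ∀ᵐ t : ℝ, 0 < t → ∀ ξ : Space d,
    ∑ α ∈ multiIndices d m, ∑ β ∈ multiIndices d m,
      monomial α ξ * monomial β ξ * (a α β t).re ≤ ν⁻¹ * ‖ξ‖ ^ (2 * m)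

/-- The square function
`(∫_0^t |(k(t, s, ·) ∗ f(s, ·))(x)|_H² ds)^{1/2} ∈ [0, ∞]` of a kernel `k`, at `z = (t, x)`. -/
def squareFunction {d : ℕ} {H : Type u} [NormedAddCommGroup H] [InnerProductSpace ℂ H]
    (k : ℝ → ℝ → Space d → ℂ) (f : ℝ × Space d → H) (z : ℝ × Space d) : ℝ≥0∞ :=
  (∫⁻ s in Ioo 0 z.1,
    ‖(k z.1 s ⋆[ContinuousLinearMap.lsmul ℝ ℂ, volume] fun y => f (s, y)) z.2‖ₑ ^ 2)
    ^ (1 / 2 : ℝ)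

end HigherOrderLP

end

/-!
The proof rests on two observations. In the square function the source times `s` do not interact:
after squaring, the contribution of each slice `f(s, ·)` is a separate non-negative quantity, and
it suffices to study the evolution of a single function `g` issued at time `s`. Moreover `p ≥ 2`, so
the `L^p` bound follows by duality from a weighted `L²` inequality
`∫ |G f|² h ≤ C ∫ |f|² M h` for all weights `h ≥ 0`, where `G f` is the square function and `M` is
the maximal function in time of the maximal function in space (`iteratedMaximal`): `M` is bounded on
the conjugate Lebesgue space of `p / 2` by the Hardy-Littlewood theorem, and one tests the
inequality with a power of `|G f|²` (`lintegral_rpow_le_of_weighted`).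

For a single source `g` the weighted inequality is `exists_lintegral_opKernel_weighted_le`. Choose a
smooth compactly supported wavelet `q` whose Fourier transform vanishes at the origin and not on the
annulus `1/2 ≤ |ξ| ≤ 2` (`IsWavelet`), and let `w_l` be the convolution of `g` with its dilate of
width `2^l`. Since the symbol `|ξ|^m exp (-P(ξ))` of the kernel can be cut into dyadic pieces and
divided by the Fourier transform of the dilates of `q`, the kernel at time `s + τ`, applied to `g`,
is a sum over `l` of kernels applied to `w_l`. The piece at frequency `|ξ| ∼ 2^{-l}` is bounded by
`2^{-lm} (1 + τ 2^{-2lm})⁻¹` times an `L¹`-normalised bump of width `2^l`; only coefficients bounded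
by `K` and ellipticity enter, through bounds for the derivatives of the symbol in frequency, so no
regularity in time is needed. For `τ ∼ 2^{2mi}` this is at most `2^{-im} 2^{-|l-i|}` times the bump.
By the Cauchy-Schwarz inequality and integration against `h`, the factor `2^{-2im}` compensates the
length of the time interval, and `w_l` is weighted by averages of `h` over times of size `2^{2mi}`
and space scales `2^l`, all bounded by `M h` at any point at distance at most `2^l`.

It remains to bound `∑ ∫ |w_l|² V_l` by `∫ |g|² W` if `V_l(y) ≤ W(y')` whenever `|y - y'| ≤ 2^l`.
This is `IsWavelet.exists_tsum_lintegral_weighted_sq_le`. For `W = 1` it is Plancherel's theorem.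
In general write `V_l` as an integral of indicators of its level sets: since `w_l(y)` depends only
on the values of `g` within distance `2^l` of `y`, on `{V_l > λ}` the function `g` may be replaced by
its restriction to `{W > λ}`, and the unweighted inequality applies for each `λ`.
-/

namespace HigherOrderLP

open FourierTransform Module Filter Topology Metric

/-! ### The Hardy–Littlewood maximal function -/

section Bump

variable {E : Type*} [NormedAddCommGroup E] [NormedSpace ℝ E]

/-- The `L¹`-normalised bump `2^{-ld} (1 + |z| / 2^l)^{-d-1}` of width `2^l`, `d = dim E`. -/
noncomputable def bump (l : ℤ) (z : E) : ℝ :=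
  (((2 : ℝ) ^ l)⁻¹) ^ finrank ℝ E * ((1 + ‖z‖ / 2 ^ l)⁻¹) ^ (finrank ℝ E + 1)

theorem bump_nonneg (l : ℤ) (z : E) : 0 ≤ bump l z := by
  unfold bump; positivity

theorem continuous_bump (l : ℤ) : Continuous (bump l : E → ℝ) := by
  unfold bump
  refine continuous_const.mul (Continuous.pow (Continuous.inv₀ (by fun_prop) fun z => ?_) _)
  positivity

/-- A shift by at most `R` times the width costs only a constant factor. -/
theorem bump_sub_le (l : ℤ) {R : ℝ} (hR : 0 ≤ R) {x y y' : E} (h : ‖y - y'‖ ≤ R * 2 ^ l) :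
    bump l (x - y) ≤ (1 + R) ^ (finrank ℝ E + 1) * bump l (x - y') := by
  unfold bump
  have h2 : (0 : ℝ) < 2 ^ l := by positivity
  have key : (1 + ‖x - y‖ / 2 ^ l)⁻¹ ≤ (1 + R) * (1 + ‖x - y'‖ / 2 ^ l)⁻¹ := by
    rw [← div_eq_mul_inv, inv_eq_one_div, div_le_div_iff₀ (by positivity) (by positivity)]
    have h3 : ‖x - y'‖ / 2 ^ l ≤ ‖x - y‖ / 2 ^ l + R := by
      rw [div_add' _ _ _ h2.ne']
      gcongr
      calc ‖x - y'‖ = ‖(x - y) + (y - y')‖ := by congr 1; abel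
        _ ≤ _ := (norm_add_le _ _).trans (by gcongr)
    have h4 : 0 ≤ ‖x - y‖ / 2 ^ l := by positivity
    nlinarith [mul_nonneg hR h4]
  calc _ ≤ (((2 : ℝ) ^ l)⁻¹) ^ finrank ℝ E *
        ((1 + R) * (1 + ‖x - y'‖ / 2 ^ l)⁻¹) ^ (finrank ℝ E + 1) := by gcongr
    _ = _ := by rw [mul_pow]; ring

end Bump

section Maximal

variable {E : Type*} [NormedAddCommGroup E] [MeasureSpace E]

/-- The Hardy–Littlewood maximal function over closed balls centred at the point, of radii `2 ^ n`
with `n ∈ ℤ`. Restricting to countably many radii makes measurability immediate and changes the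
function only by a constant factor. -/
noncomputable def maximalFunction (h : E → ℝ≥0∞) (x : E) : ℝ≥0∞ :=
  ⨆ n : ℤ, ⨍⁻ y in closedBall x ((2 : ℝ) ^ n), h y ∂volume

theorem maximalFunction_const_le (c : ℝ≥0∞) (x : E) : maximalFunction (fun _ => c) x ≤ c := by
  refine iSup_le fun n => ?_
  rw [setLAverage_eq, setLIntegral_const]
  exact ENNReal.div_le_of_le_mul le_rfl

variable [NormedSpace ℝ E] [FiniteDimensional ℝ E] [(volume : Measure E).IsAddHaarMeasure]

theorem lintegral_closedBall_le_maximalFunction (h : E → ℝ≥0∞) (x : E) (n : ℤ) :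
    ∫⁻ y in closedBall x ((2 : ℝ) ^ n), h y ≤
      volume (closedBall x ((2 : ℝ) ^ n)) * maximalFunction h x := by
  have hpos : (0 : ℝ) < 2 ^ n := by positivity
  have h1 : ⨍⁻ y in closedBall x ((2 : ℝ) ^ n), h y ∂volume ≤ maximalFunction h x :=
    le_iSup (fun n : ℤ => ⨍⁻ y in closedBall x ((2 : ℝ) ^ n), h y ∂volume) n
  rw [setLAverage_eq] at h1
  rwa [mul_comm, ← ENNReal.div_le_iff (measure_closedBall_pos volume x hpos).ne'
    measure_closedBall_lt_top.ne]

variable [BorelSpace E]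

theorem measurable_maximalFunction {X : Type*} [MeasurableSpace X] {h : X → E → ℝ≥0∞}
    (hh : Measurable (Function.uncurry h)) :
    Measurable fun z : X × E => maximalFunction (h z.1) z.2 := by
  have : ProperSpace E := FiniteDimensional.proper_real E
  refine Measurable.iSup fun n => ?_
  simp_rw [setLAverage_eq, Measure.addHaar_closedBall_center volume _ ((2 : ℝ) ^ n)]
  refine Measurable.div_const ?_ _
  have : ∀ z : X × E, ∫⁻ y in closedBall z.2 ((2 : ℝ) ^ n), h z.1 y =
      ∫⁻ y, {w : (X × E) × E | dist w.2 w.1.2 ≤ (2 : ℝ) ^ n}.indicator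
        (fun w => h w.1.1 w.2) (z, y) := by
    intro z
    rw [← lintegral_indicator measurableSet_closedBall]
    rfl
  simp_rw [this]
  refine Measurable.lintegral_prod_right ?_
  refine Measurable.indicator ?_ ?_
  · exact hh.comp (by fun_prop : Measurable fun w : (X × E) × E => (w.1.1, w.2))
  · exact measurableSet_le (by fun_prop) (by fun_prop)

theorem measurable_maximalFunction_apply {h : E → ℝ≥0∞} (hh : Measurable h) :
    Measurable (maximalFunction h) := by
  have h0 : Measurable (Function.uncurry fun _ : E => h) := hh.comp measurable_snd
  have h1 := (measurable_maximalFunction h0).comp (measurable_id.prodMk measurable_id)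
  simp only [Function.comp_def, id] at h1
  exact h1

/-- The weak type `(1, 1)` inequality, by the Vitali covering lemma. -/
theorem mul_volume_maximalFunction_le [Nontrivial E] (h : E → ℝ≥0∞) (c : ℝ≥0∞) :
    c * volume {x | c < maximalFunction h x} ≤
      ENNReal.ofReal (5 ^ finrank ℝ E) * ∫⁻ y, h y := by
  rcases eq_or_ne c 0 with rfl | hc0
  · simp
  rcases eq_or_ne (∫⁻ y, h y) ⊤ with hI | hI
  · rw [hI, ENNReal.mul_top (by positivity)]; exact le_top
  have hfin : 0 < finrank ℝ E := finrank_pos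
  have key : ∀ x : E, ∃ n : ℤ, c < maximalFunction h x →
      c < ⨍⁻ y in closedBall x ((2 : ℝ) ^ n), h y ∂volume := by
    intro x
    by_cases hx : c < maximalFunction h x
    · obtain ⟨n, hn⟩ := lt_iSup_iff.1 hx
      exact ⟨n, fun _ => hn⟩
    · exact ⟨0, fun h => absurd h hx⟩
  choose n hn using key
  have hball : ∀ x, c < maximalFunction h x → c * volume (closedBall x ((2 : ℝ) ^ n x)) ≤
      ∫⁻ y in closedBall x ((2 : ℝ) ^ n x), h y := by
    intro x hx
    have h1 := (hn x hx).le
    rw [setLAverage_eq] at h1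
    rwa [← ENNReal.le_div_iff_mul_le (Or.inl (measure_closedBall_pos volume x (by positivity)).ne')
      (Or.inl measure_closedBall_lt_top.ne)]
  set v := volume (closedBall (0 : E) 1) with hv
  have hv0 : v ≠ 0 := (measure_closedBall_pos volume 0 one_pos).ne'
  -- Vitali's lemma needs bounded radii; a ball of large average has volume at most `c⁻¹ ∫ h`
  set R : ℝ := max 1 ((∫⁻ y, h y) / (c * v)).toReal with hR
  have hrad : ∀ x ∈ {x | c < maximalFunction h x}, (2 : ℝ) ^ n x ≤ R := by
    intro x hx
    by_cases h1 : (2 : ℝ) ^ n x ≤ 1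
    · exact h1.trans (le_max_left _ _)
    push Not at h1
    refine le_trans ?_ (le_max_right _ _)
    have h2 := (hball x hx).trans (setLIntegral_le_lintegral _ _)
    rw [Measure.addHaar_closedBall' volume x (by positivity)] at h2
    have h3 : ENNReal.ofReal ((2 : ℝ) ^ n x) * (c * v) ≤ ∫⁻ y, h y := by
      refine le_trans ?_ h2
      calc ENNReal.ofReal ((2 : ℝ) ^ n x) * (c * v)
          ≤ ENNReal.ofReal (((2 : ℝ) ^ n x) ^ finrank ℝ E) * (c * v) := by
            gcongr
            exact le_self_pow₀ h1.le hfin.ne'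
        _ = _ := by ring
    have hcv : c * v ≠ 0 := mul_ne_zero hc0 hv0
    have h4 : ENNReal.ofReal ((2 : ℝ) ^ n x) ≤ (∫⁻ y, h y) / (c * v) := by
      refine (ENNReal.le_div_iff_mul_le (Or.inl hcv) (Or.inr hI)).2 h3
    refine (ENNReal.ofReal_le_iff_le_toReal ?_).1 h4
    exact ENNReal.div_ne_top hI hcv
  obtain ⟨u, hut, hdisj, hcov⟩ := Vitali.exists_disjoint_subfamily_covering_enlargement_closedBall
    {x | c < maximalFunction h x} id (fun x => (2 : ℝ) ^ n x) R hrad 5 (by norm_num)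
  have hdisj' : u.PairwiseDisjoint fun a => closedBall a ((2 : ℝ) ^ n a) := hdisj
  have hcount : u.Countable := by
    refine hdisj.countable_of_nonempty_interior fun x _ => ?_
    exact ⟨x, ball_subset_interior_closedBall (mem_ball_self (by positivity))⟩
  have := hcount.to_subtype
  have hsub : {x | c < maximalFunction h x} ⊆ ⋃ x ∈ u, closedBall x (5 * (2 : ℝ) ^ n x) := by
    intro x hx
    obtain ⟨b, hb, hb'⟩ := hcov x hx
    exact mem_iUnion₂.2 ⟨b, hb, hb' (mem_closedBall_self (by positivity))⟩
  calc c * volume {x | c < maximalFunction h x}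
      ≤ c * ∑' x : u, volume (closedBall (x : E) (5 * (2 : ℝ) ^ n x)) := by
        gcongr
        exact (measure_mono hsub).trans (measure_biUnion_le _ hcount _)
    _ = ENNReal.ofReal (5 ^ finrank ℝ E) *
          ∑' x : u, c * volume (closedBall (x : E) ((2 : ℝ) ^ n x)) := by
        rw [← ENNReal.tsum_mul_left, ← ENNReal.tsum_mul_left]
        congr 1 with x
        rw [Measure.addHaar_closedBall_mul_of_pos volume _ (by norm_num),
          Measure.addHaar_closedBall_center volume (x : E)]
        ring
    _ ≤ ENNReal.ofReal (5 ^ finrank ℝ E) *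
          ∑' x : u, ∫⁻ y in closedBall (x : E) ((2 : ℝ) ^ n x), h y := by
        gcongr with x
        exact hball x (hut x.2)
    _ = ENNReal.ofReal (5 ^ finrank ℝ E) *
          ∫⁻ y in ⋃ x ∈ u, closedBall (x : E) ((2 : ℝ) ^ n x), h y := by
        rw [lintegral_biUnion hcount (fun _ _ => measurableSet_closedBall) hdisj']
    _ ≤ _ := by
        exact mul_le_mul_right (setLIntegral_le_lintegral _ _) _

/-- `F ^ q = ∫_0^F q c ^ (q - 1) dc`, including the case `F = ∞`. -/
theorem rpow_eq_lintegral_indicator {q : ℝ} (hq : 0 < q) (F : ℝ≥0∞) :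
    F ^ q = ∫⁻ c in Ioi (0 : ℝ), {c : ℝ | ENNReal.ofReal c < F}.indicator
      (fun c => ENNReal.ofReal (q * c ^ (q - 1))) c := by
  have hmeas : ∀ F : ℝ≥0∞, MeasurableSet {c : ℝ | ENNReal.ofReal c < F} := fun F =>
    measurableSet_lt ENNReal.measurable_ofReal measurable_const
  have hreal : ∀ r : ℝ, 0 ≤ r → ENNReal.ofReal r ^ q =
      ∫⁻ c in Ioi (0 : ℝ), {c : ℝ | ENNReal.ofReal c < ENNReal.ofReal r}.indicator
        (fun c => ENNReal.ofReal (q * c ^ (q - 1))) c := by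
    intro r hr
    rw [← lintegral_indicator measurableSet_Ioi]
    have : ((Ioi (0 : ℝ)).indicator fun c => {c : ℝ | ENNReal.ofReal c < ENNReal.ofReal r}.indicator
        (fun c => ENNReal.ofReal (q * c ^ (q - 1))) c) =
        (Ioo 0 r).indicator fun c => ENNReal.ofReal (q * c ^ (q - 1)) := by
      funext c
      by_cases h1 : 0 < c
      · simp [indicator, h1, ENNReal.ofReal_lt_ofReal_iff_of_nonneg h1.le]
      · simp [indicator, h1]
    rw [this, lintegral_indicator measurableSet_Ioo, setLIntegral_congr Ioo_ae_eq_Ioc,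
      ← ofReal_integral_eq_lintegral_ofReal, ← intervalIntegral.integral_of_le hr,
      intervalIntegral.integral_const_mul, integral_rpow (Or.inl (by linarith))]
    · rw [ENNReal.ofReal_rpow_of_nonneg hr hq.le]
      congr 1
      simp [Real.zero_rpow hq.ne']
      field_simp
    · have := (intervalIntegral.intervalIntegrable_rpow' (a := 0) (b := r) (r := q - 1)
        (by linarith)).const_mul q
      rwa [intervalIntegrable_iff_integrableOn_Ioc_of_le hr] at this
    · filter_upwards [ae_restrict_mem measurableSet_Ioc] with c hc
      have := hc.1.le
      positivity
  rcases eq_or_ne F ⊤ with rfl | hF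
  · rw [ENNReal.top_rpow_of_pos hq, eq_comm]
    refine ENNReal.eq_top_of_forall_nnreal_le fun r => ?_
    have h1 := hreal ((r : ℝ) ^ q⁻¹) (by positivity)
    rw [ENNReal.ofReal_rpow_of_nonneg (by positivity) hq.le, ← Real.rpow_mul r.coe_nonneg,
      inv_mul_cancel₀ hq.ne', Real.rpow_one, ENNReal.ofReal_coe_nnreal] at h1
    rw [h1]
    refine lintegral_mono fun c => indicator_le_indicator_of_subset ?_ (fun _ => zero_le) c
    intro c hc
    exact ENNReal.ofReal_lt_top
  · have := hreal F.toReal ENNReal.toReal_nonneg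
    rwa [ENNReal.ofReal_toReal hF] at this

/-- The layer cake formula. -/
theorem lintegral_rpow_eq_layercake {α : Type*} [MeasurableSpace α] {μ : Measure α} [SFinite μ]
    {q : ℝ} (hq : 0 < q) {F : α → ℝ≥0∞} (hF : Measurable F) :
    ∫⁻ x, F x ^ q ∂μ = ∫⁻ c in Ioi (0 : ℝ),
      ENNReal.ofReal (q * c ^ (q - 1)) * μ {x | ENNReal.ofReal c < F x} := by
  have hS : MeasurableSet {z : α × ℝ | ENNReal.ofReal z.2 < F z.1} :=
    measurableSet_lt (by fun_prop) (by fun_prop)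
  simp_rw [rpow_eq_lintegral_indicator hq]
  rw [lintegral_lintegral_swap]
  · refine lintegral_congr fun c => ?_
    rw [← lintegral_indicator_const (measurableSet_lt measurable_const hF)]
    rfl
  · refine Measurable.aemeasurable ?_
    exact Measurable.indicator (f := fun z : α × ℝ => ENNReal.ofReal (q * z.2 ^ (q - 1)))
      (by fun_prop) hS

/-- The weak type inequality applied to the part of `h` above the level `c`; the rest contributes at
most `c` to the maximal function. -/
theorem mul_volume_maximalFunction_le_setLIntegral [Nontrivial E] {h : E → ℝ≥0∞}
    (hh : Measurable h) (c : ℝ≥0∞) :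
    c * volume {x | 2 * c < maximalFunction h x} ≤
      ENNReal.ofReal (5 ^ finrank ℝ E) * ∫⁻ y in {y | c < h y}, h y := by
  have hS : MeasurableSet {y | c < h y} := measurableSet_lt measurable_const hh
  rw [← lintegral_indicator hS]
  refine le_trans ?_ (mul_volume_maximalFunction_le _ c)
  refine mul_le_mul_right (measure_mono fun x hx => ?_) _
  simp only [mem_ofPred_eq, maximalFunction, lt_iSup_iff] at hx ⊢
  obtain ⟨n, hn⟩ := hx
  refine ⟨n, ?_⟩
  by_contra! hcon
  refine hn.not_ge ?_
  rw [setLAverage_eq] at hcon ⊢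
  have hv0 := (measure_closedBall_pos volume x (by positivity : (0 : ℝ) < 2 ^ n)).ne'
  have hv1 : volume (closedBall x ((2 : ℝ) ^ n)) ≠ ⊤ := measure_closedBall_lt_top.ne
  rw [ENNReal.div_le_iff hv0 hv1] at hcon ⊢
  calc ∫⁻ y in closedBall x ((2 : ℝ) ^ n), h y
      ≤ ∫⁻ y in closedBall x ((2 : ℝ) ^ n), ({y | c < h y}.indicator h y + c) := by
        refine lintegral_mono fun y => ?_
        by_cases hy : c < h y
        · simp [indicator, hy]
        · simp only [indicator, mem_ofPred_eq, hy, if_false, zero_add]; exact not_lt.1 hy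
    _ ≤ c * volume (closedBall x ((2 : ℝ) ^ n)) + c * volume (closedBall x ((2 : ℝ) ^ n)) := by
        rw [lintegral_add_right _ measurable_const, setLIntegral_const]
        gcongr
    _ = _ := by ring

/-- The maximal theorem on `L^q`, `1 < q < ∞`. -/
theorem exists_lintegral_maximalFunction_rpow_le (E : Type*) [NormedAddCommGroup E]
    [MeasureSpace E] [NormedSpace ℝ E] [FiniteDimensional ℝ E] [BorelSpace E]
    [(volume : Measure E).IsAddHaarMeasure] [Nontrivial E] {q : ℝ} (hq : 1 < q) :
    ∃ C : ℝ≥0, ∀ h : E → ℝ≥0∞, Measurable h →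
      ∫⁻ x, maximalFunction h x ^ q ≤ C * ∫⁻ x, h x ^ q := by
  have hq0 : 0 < q := by linarith
  have hq1 : 0 < q - 1 := by linarith
  refine ⟨(2 * 5 ^ finrank ℝ E * q / (q - 1) * 2 ^ (q - 1)).toNNReal, fun h hh => ?_⟩
  have hA : (0 : ℝ) ≤ 2 * 5 ^ finrank ℝ E := by positivity
  rw [lintegral_rpow_eq_layercake hq0 (measurable_maximalFunction_apply hh)]
  have hS : MeasurableSet {z : ℝ × E | ENNReal.ofReal (z.1 / 2) < h z.2} :=
    measurableSet_lt (by fun_prop) (by fun_prop)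
  have hstep : ∀ c ∈ Ioi (0 : ℝ), ENNReal.ofReal (q * c ^ (q - 1)) *
      volume {x | ENNReal.ofReal c < maximalFunction h x} ≤
      ∫⁻ y, {z : ℝ × E | ENNReal.ofReal (z.1 / 2) < h z.2}.indicator (fun z =>
        ENNReal.ofReal (2 * 5 ^ finrank ℝ E * q / (q - 1)) *
          (ENNReal.ofReal ((q - 1) * z.1 ^ (q - 1 - 1)) * h z.2)) (c, y) := by
    intro c hc
    have hc : 0 < c := hc
    have h1 := mul_volume_maximalFunction_le_setLIntegral hh (ENNReal.ofReal (c / 2))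
    have h2 : 2 * ENNReal.ofReal (c / 2) = ENNReal.ofReal c := by
      rw [show (2 : ℝ≥0∞) = ENNReal.ofReal 2 by simp, ← ENNReal.ofReal_mul (by norm_num)]
      congr 1; ring
    rw [h2, ← lintegral_indicator (measurableSet_lt measurable_const hh)] at h1
    have h3 : ∀ y, {z : ℝ × E | ENNReal.ofReal (z.1 / 2) < h z.2}.indicator (fun z =>
        ENNReal.ofReal (2 * 5 ^ finrank ℝ E * q / (q - 1)) *
          (ENNReal.ofReal ((q - 1) * z.1 ^ (q - 1 - 1)) * h z.2)) (c, y) =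
        ENNReal.ofReal (2 * q * c ^ (q - 2)) * (ENNReal.ofReal (5 ^ finrank ℝ E) *
          {y | ENNReal.ofReal (c / 2) < h y}.indicator h y) := by
      intro y
      by_cases hy : ENNReal.ofReal (c / 2) < h y
      · simp only [indicator, mem_ofPred_eq, hy, if_true]
        rw [← mul_assoc, ← mul_assoc, ← ENNReal.ofReal_mul (by positivity),
          ← ENNReal.ofReal_mul (by positivity)]
        congr 2
        rw [show q - 1 - 1 = q - 2 by ring]
        field_simp
      · simp [indicator, hy]
    simp_rw [h3]
    rw [lintegral_const_mul _ ((hh.indicator (measurableSet_lt measurable_const hh)).const_mul _),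
      lintegral_const_mul _ (hh.indicator (measurableSet_lt measurable_const hh))]
    refine le_trans ?_ (mul_le_mul_right h1 _)
    rw [← mul_assoc, ← ENNReal.ofReal_mul (by positivity)]
    refine mul_le_mul_left (le_of_eq ?_) _
    rw [show q - 1 = (q - 2) + 1 by ring, Real.rpow_add_one hc.ne']
    congr 1; ring
  refine (setLIntegral_mono' measurableSet_Ioi hstep).trans ?_
  rw [lintegral_lintegral_swap]
  · rw [← lintegral_const_mul _ (hh.pow_const q)]
    refine lintegral_mono fun y => ?_
    have h4 : ∀ c : ℝ, {z : ℝ × E | ENNReal.ofReal (z.1 / 2) < h z.2}.indicator (fun z =>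
        ENNReal.ofReal (2 * 5 ^ finrank ℝ E * q / (q - 1)) *
          (ENNReal.ofReal ((q - 1) * z.1 ^ (q - 1 - 1)) * h z.2)) (c, y) =
        (ENNReal.ofReal (2 * 5 ^ finrank ℝ E * q / (q - 1)) * h y) *
        {c : ℝ | ENNReal.ofReal c < 2 * h y}.indicator
          (fun c => ENNReal.ofReal ((q - 1) * c ^ (q - 1 - 1))) c := by
      intro c
      have : ENNReal.ofReal (c / 2) < h y ↔ ENNReal.ofReal c < 2 * h y := by
        rw [show (2 : ℝ≥0∞) = ENNReal.ofReal 2 by simp, ENNReal.ofReal_div_of_pos two_pos,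
          ENNReal.div_lt_iff (by simp) (by simp), mul_comm]
      by_cases hy : ENNReal.ofReal (c / 2) < h y
      · simp only [indicator, mem_ofPred_eq, hy, if_true, this.1 hy]; ring
      · simp only [indicator, mem_ofPred_eq, hy, this.not.1 hy, if_false, mul_zero]
    simp_rw [h4]
    rw [lintegral_const_mul, ← rpow_eq_lintegral_indicator hq1]
    · rw [ENNReal.mul_rpow_of_nonneg _ _ hq1.le]
      rw [← ENNReal.ofReal, ENNReal.ofReal_mul (by positivity), mul_assoc, mul_assoc]
      rw [show ENNReal.ofReal ((2 : ℝ) ^ (q - 1)) = 2 ^ (q - 1) by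
        rw [← ENNReal.ofReal_rpow_of_nonneg (by norm_num) hq1.le]; simp]
      rw [mul_left_comm (h y), mul_assoc (ENNReal.ofReal _)]
      refine mul_le_mul_right (mul_le_mul_right ?_ _) (ENNReal.ofReal _)
      rcases eq_or_ne (h y) ⊤ with ht | ht
      · rw [ht, ENNReal.top_rpow_of_pos hq0]; exact le_top
      rcases eq_or_ne (h y) 0 with h0 | h0
      · rw [h0]; simp
      · apply le_of_eq
        conv_lhs => rw [← ENNReal.rpow_one (h y)]
        rw [← ENNReal.rpow_mul, one_mul, ← ENNReal.rpow_add _ _ h0 ht]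
        congr 1; ring
    · exact Measurable.indicator (by fun_prop)
        (measurableSet_lt ENNReal.measurable_ofReal measurable_const)
  · refine Measurable.aemeasurable ?_
    exact Measurable.indicator (by fun_prop) hS

/-- Averages against a bump are controlled by the maximal function. -/
theorem lintegral_bump_mul_le {h : E → ℝ≥0∞} (hh : Measurable h) (l : ℤ) (y : E) :
    ∫⁻ x, ENNReal.ofReal (bump l (x - y)) * h x ≤
      ENNReal.ofReal (2 ^ (finrank ℝ E + 2)) * volume (closedBall (0 : E) 1) *
        maximalFunction h y := by
  set D := finrank ℝ E with hD
  have h2 : (0 : ℝ) < 2 ^ l := by positivity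
  have hpow : ∀ j : ℕ, ((2 : ℝ) ^ (l + j)) = 2 ^ l * 2 ^ j := fun j => by
    rw [zpow_add₀ two_ne_zero, zpow_natCast]
  -- decomposition of the bump into characteristic functions of dyadic balls
  have hdec : ∀ x, ENNReal.ofReal (bump l (x - y)) * h x ≤
      ∑' j : ℕ, ENNReal.ofReal (2 ^ (D + 1) * ((2 ^ l)⁻¹ ^ D * ((2 ^ j)⁻¹) ^ (D + 1))) *
        (closedBall y ((2 : ℝ) ^ (l + j))).indicator h x := by
    intro x
    have hex : ∃ j : ℕ, ‖x - y‖ ≤ 2 ^ l * 2 ^ j := by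
      obtain ⟨j, hj⟩ := pow_unbounded_of_one_lt (‖x - y‖ / 2 ^ l) one_lt_two
      exact ⟨j, by rw [div_lt_iff₀ h2] at hj; linarith⟩
    classical
    let j := Nat.find hex
    have hj : ‖x - y‖ ≤ 2 ^ l * 2 ^ j := Nat.find_spec hex
    refine le_trans ?_ (ENNReal.le_tsum j)
    rw [indicator_of_mem (by rw [mem_closedBall, dist_eq_norm, hpow]; exact hj)]
    gcongr
    rw [bump, mul_left_comm, ← mul_pow]
    gcongr
    rcases Nat.eq_zero_or_pos j with h0 | h0
    · rw [h0, pow_zero, inv_one, mul_one]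
      refine le_trans (inv_le_one_of_one_le₀ ?_) one_le_two
      have : 0 ≤ ‖x - y‖ / 2 ^ l := by positivity
      linarith
    · have hlt : 2 ^ l * 2 ^ (j - 1) < ‖x - y‖ := not_le.1 (Nat.find_min hex (Nat.sub_lt h0 one_pos))
      rw [← div_eq_mul_inv, inv_eq_one_div, div_le_div_iff₀ (by positivity) (by positivity), one_mul]
      have h5 : (2 : ℝ) ^ j = 2 * 2 ^ (j - 1) := by
        rw [← pow_succ', Nat.sub_add_cancel h0]
      rw [h5]
      have : (2 : ℝ) ^ (j - 1) < ‖x - y‖ / 2 ^ l := by rw [lt_div_iff₀ h2]; linarith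
      linarith
  calc ∫⁻ x, ENNReal.ofReal (bump l (x - y)) * h x
      ≤ ∑' j : ℕ, ENNReal.ofReal (2 ^ (D + 1) * ((2 ^ l)⁻¹ ^ D * ((2 ^ j)⁻¹) ^ (D + 1))) *
          ∫⁻ x in closedBall y ((2 : ℝ) ^ (l + j)), h x := by
        refine (lintegral_mono hdec).trans ?_
        rw [lintegral_tsum fun j =>
          ((hh.indicator measurableSet_closedBall).const_mul _).aemeasurable]
        refine ENNReal.tsum_le_tsum fun j => ?_
        rw [lintegral_const_mul _ (hh.indicator measurableSet_closedBall),
          lintegral_indicator measurableSet_closedBall]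
    _ ≤ ∑' j : ℕ, ENNReal.ofReal (2 ^ (D + 1)) * volume (closedBall (0 : E) 1) *
          maximalFunction h y * 2⁻¹ ^ j := by
        refine ENNReal.tsum_le_tsum fun j => ?_
        refine (mul_le_mul_right (lintegral_closedBall_le_maximalFunction h y (l + j))
          (ENNReal.ofReal _)).trans ?_
        rw [Measure.addHaar_closedBall' volume y (by positivity), ← mul_assoc, ← mul_assoc,
          ← ENNReal.ofReal_mul (by positivity), ← hD]
        have : (2 : ℝ) ^ (D + 1) * ((2 ^ l)⁻¹ ^ D * ((2 ^ j)⁻¹) ^ (D + 1)) * (2 ^ (l + j)) ^ D =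
            2 ^ (D + 1) * 2⁻¹ ^ j := by
          rw [hpow, mul_pow, inv_pow, inv_pow, inv_pow, pow_succ ((2 : ℝ) ^ j)]
          field_simp
        rw [this, ENNReal.ofReal_mul (by positivity), ENNReal.ofReal_pow (p := 2⁻¹) (by positivity),
          ENNReal.ofReal_inv_of_pos two_pos, ENNReal.ofReal_ofNat]
        exact le_of_eq (by ring)
    _ = _ := by
        rw [ENNReal.tsum_mul_left, ENNReal.tsum_geometric, ENNReal.one_sub_inv_two, inv_inv,
          pow_succ _ (D + 1), ENNReal.ofReal_mul (by positivity), ENNReal.ofReal_ofNat]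
        ring

/-- The integral of a bump is bounded uniformly in its width. -/
theorem lintegral_bump_le (l : ℤ) (y : E) :
    ∫⁻ x, ENNReal.ofReal (bump l (x - y)) ≤
      ENNReal.ofReal (2 ^ (finrank ℝ E + 2)) * volume (closedBall (0 : E) 1) := by
  have h1 := lintegral_bump_mul_le (h := fun _ : E => 1) measurable_const l y
  simp only [mul_one] at h1
  refine h1.trans ?_
  conv_rhs => rw [← mul_one (ENNReal.ofReal _ * _)]
  exact mul_le_mul_right (maximalFunction_const_le 1 y) _

end Maximal

/-! ### Decay of inverse Fourier transforms of symbols -/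

theorem norm_iteratedFDeriv_cexp_le (n : ℕ) (z : ℂ) :
    ‖iteratedFDeriv ℝ n Complex.exp z‖ ≤ Real.exp z.re := by
  have h1 : ContDiffAt ℂ n Complex.exp z := Complex.contDiff_exp.contDiffAt
  have h2 := h1.restrictScalars_iteratedFDeriv (𝕜 := ℝ)
  rw [← h2]
  have h3 : iteratedDeriv n Complex.exp = Complex.exp := by
    have := iteratedDeriv_cexp_const_mul n 1
    simpa using this
  calc _ = ‖iteratedFDeriv ℂ n Complex.exp z‖ := by
        exact ContinuousMultilinearMap.norm_restrictScalars _
    _ = Real.exp z.re := by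
        rw [norm_iteratedFDeriv_eq_norm_iteratedDeriv, h3, Complex.norm_exp]
    _ ≤ _ := le_rfl

/-- Derivatives of `exp ∘ P` at a point where the derivatives of `P` are at most `D ≥ 1`, by the
Faà di Bruno formula. -/
theorem norm_iteratedFDeriv_cexp_comp_le {E : Type*} [NormedAddCommGroup E] [NormedSpace ℝ E]
    {P : E → ℂ} (hP : ContDiff ℝ ∞ P) (n : ℕ) (ξ : E) {D : ℝ} (hD : 1 ≤ D)
    (h : ∀ i ≤ n, ‖iteratedFDeriv ℝ i P ξ‖ ≤ D) :
    ‖iteratedFDeriv ℝ n (fun ξ => Complex.exp (P ξ)) ξ‖ ≤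
      n.factorial * Real.exp (P ξ).re * D ^ n := by
  refine norm_iteratedFDeriv_comp_le (g := Complex.exp) (N := ∞) Complex.contDiff_exp hP
    (by exact_mod_cast le_top) ξ (fun i _ => norm_iteratedFDeriv_cexp_le i _) fun i h1 h2 => ?_
  exact (h i h2).trans (le_self_pow₀ hD (by omega))

/-- A function whose derivatives up to order `n` are dominated by `A g` with `g` integrable has an
inverse Fourier transform of size `A (1 + |z|)^{-n}`. -/
theorem exists_norm_fourierInv_le (n : ℕ) : ∃ C : ℝ, 0 ≤ C ∧ ∀ (d : ℕ) (f : Space d → ℂ)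
    (g : Space d → ℝ) (A : ℝ), ContDiff ℝ ∞ f → Integrable g → 0 ≤ A →
    (∀ j ≤ n, ∀ ξ, ‖iteratedFDeriv ℝ j f ξ‖ ≤ A * g ξ) →
    ∀ z, ‖𝓕⁻ f z‖ ≤ C * (A * ∫ ξ, g ξ) * ((1 + ‖z‖)⁻¹) ^ n := by
  refine ⟨2 ^ n * (1 + 2 ^ n * (n + 1)), by positivity, fun d f g A hf hg hA h z => ?_⟩
  have hint : ∀ j ≤ n, Integrable (iteratedFDeriv ℝ j f) := fun j hj =>
    (hg.const_mul A).mono' (hf.continuous_iteratedFDeriv (by exact_mod_cast le_top)).aestronglyMeasurable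
      (Filter.Eventually.of_forall (h j hj))
  have hI : ∀ j ≤ n, ∫ ξ, ‖iteratedFDeriv ℝ j f ξ‖ ≤ A * ∫ ξ, g ξ := fun j hj => by
    rw [← integral_const_mul]
    exact integral_mono (hint j hj).norm (hg.const_mul A) (h j hj)
  have hI0 : 0 ≤ A * ∫ ξ, g ξ := (integral_nonneg fun _ => norm_nonneg _).trans (hI 0 (Nat.zero_le _))
  rw [Real.fourierInv_eq_fourier_neg]
  have key : ∀ k ≤ n, ‖z‖ ^ k * ‖𝓕 f (-z)‖ ≤ 2 ^ k * ((k + 1) * (A * ∫ ξ, g ξ)) := by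
    intro k hk
    have h1 := Real.pow_mul_norm_iteratedFDeriv_fourier_le (K := 0) (N := k) (f := f)
      (hf.of_le (by exact_mod_cast le_top))
      (fun a b ha hb => by
        have ha : a = 0 := by simpa using ha
        subst ha
        simpa using (hint b ((Nat.cast_le.1 hb).trans hk)).norm) (k := 0) (n := k) le_rfl le_rfl (-z)
    simp only [norm_iteratedFDeriv_zero, norm_neg, pow_zero, one_mul, Nat.cast_zero, mul_zero,
      zero_add, Finset.range_one, Finset.singleton_product, Finset.sum_map,
      Function.Embedding.coeFn_mk] at h1
    refine h1.trans ?_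
    gcongr
    calc _ ≤ ∑ i ∈ Finset.range (k + 1), A * ∫ ξ, g ξ :=
          Finset.sum_le_sum fun i hi => hI i (by have := Finset.mem_range.1 hi; omega)
      _ = _ := by simp
  have h0 := key 0 (Nat.zero_le _)
  have hn := key n le_rfl
  simp only [pow_zero, one_mul, Nat.cast_zero, zero_add] at h0
  have h2 : (1 + ‖z‖) ^ n ≤ 2 ^ n * (1 + ‖z‖ ^ n) := by
    calc (1 + ‖z‖) ^ n ≤ (2 * max 1 ‖z‖) ^ n := by
          gcongr
          have := le_max_left 1 ‖z‖; have := le_max_right 1 ‖z‖; linarith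
      _ = 2 ^ n * (max 1 ‖z‖) ^ n := mul_pow _ _ _
      _ ≤ _ := by
          gcongr
          have := pow_nonneg (norm_nonneg z) n
          rcases max_choice 1 ‖z‖ with h | h <;> rw [h] <;> simp [this]
  rw [inv_pow, ← div_eq_mul_inv, le_div_iff₀ (by positivity)]
  calc ‖𝓕 f (-z)‖ * (1 + ‖z‖) ^ n ≤ ‖𝓕 f (-z)‖ * (2 ^ n * (1 + ‖z‖ ^ n)) := by gcongr
    _ = 2 ^ n * (‖𝓕 f (-z)‖ + ‖z‖ ^ n * ‖𝓕 f (-z)‖) := by ring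
    _ ≤ 2 ^ n * ((A * ∫ ξ, g ξ) + 2 ^ n * ((n + 1) * (A * ∫ ξ, g ξ))) := by gcongr
    _ = _ := by ring

/-- The form `∑ c_{αβ} ξ^α ξ^β` over `|α| = |β| = m`. -/
noncomputable def polyForm {d : ℕ} (m : ℕ) (c : (Fin d → ℕ) → (Fin d → ℕ) → ℂ) (ξ : Space d) : ℂ :=
  ∑ α ∈ multiIndices d m, ∑ β ∈ multiIndices d m,
    c α β * ((monomial α ξ * monomial β ξ : ℝ) : ℂ)

/-- The form `polyForm m c` has coefficients bounded by `K ρ` and is elliptic with constant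
`ν ρ`. For the coefficients of the operator integrated over a time interval, `ρ` is its length. -/
structure IsEllipticForm {d : ℕ} (m : ℕ) (ν K ρ : ℝ)
    (c : (Fin d → ℕ) → (Fin d → ℕ) → ℂ) : Prop where
  bounded : ∀ α ∈ multiIndices d m, ∀ β ∈ multiIndices d m, ‖c α β‖ ≤ K * ρ
  elliptic : ∀ ξ : Space d, ν * ρ * ‖ξ‖ ^ (2 * m) ≤ (polyForm m c ξ).re

theorem monomial_smul {d m : ℕ} {α : Fin d → ℕ} (hα : α ∈ multiIndices d m) (r : ℝ) (ξ : Space d) :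
    monomial α (r • ξ) = r ^ m * monomial α ξ := by
  have : ∑ i, α i = m := by simpa [multiIndices] using hα
  simp [monomial, mul_pow, Finset.prod_mul_distrib, Finset.prod_pow_eq_pow_sum, this]

theorem polyForm_smul {d : ℕ} (m : ℕ) (c : (Fin d → ℕ) → (Fin d → ℕ) → ℂ) (r : ℝ) (ξ : Space d) :
    polyForm m c (r • ξ) = polyForm m (fun α β => ((r ^ (2 * m) : ℝ) : ℂ) * c α β) ξ := by
  unfold polyForm
  refine Finset.sum_congr rfl fun α hα => Finset.sum_congr rfl fun β hβ => ?_
  rw [monomial_smul hα, monomial_smul hβ]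
  push_cast
  ring

theorem IsEllipticForm.smul {d m : ℕ} {ν K ρ : ℝ} {c : (Fin d → ℕ) → (Fin d → ℕ) → ℂ}
    (h : IsEllipticForm m ν K ρ c) {s : ℝ} (hs : 0 ≤ s) :
    IsEllipticForm m ν K (s * ρ) fun α β => (s : ℂ) * c α β where
  bounded α hα β hβ := by
    rw [norm_mul, Complex.norm_real, Real.norm_of_nonneg hs]
    have := mul_le_mul_of_nonneg_left (h.bounded α hα β hβ) hs
    linarith
  elliptic ξ := by
    have h1 : polyForm m (fun α β => (s : ℂ) * c α β) ξ = s * polyForm m c ξ := by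
      simp [polyForm, Finset.mul_sum, mul_assoc]
    rw [h1, Complex.re_ofReal_mul]
    have := mul_le_mul_of_nonneg_left (h.elliptic ξ) hs
    linarith

theorem hasTemperateGrowth_monomial {d : ℕ} (α : Fin d → ℕ) :
    (monomial α : Space d → ℝ).HasTemperateGrowth := by
  unfold monomial
  have h : ∀ s : Finset (Fin d), (fun ξ : Space d => ∏ i ∈ s, ξ i ^ α i).HasTemperateGrowth := by
    intro s
    induction s using Finset.induction_on with
    | empty => simp
    | insert i s hi ih =>
      simp_rw [Finset.prod_insert hi]
      exact ((EuclideanSpace.proj (𝕜 := ℝ) i).hasTemperateGrowth.pow (α i)).mul ih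
  exact h _

theorem contDiff_polyForm {d : ℕ} (m : ℕ) (c : (Fin d → ℕ) → (Fin d → ℕ) → ℂ) :
    ContDiff ℝ ∞ (polyForm m c : Space d → ℂ) := by
  unfold polyForm
  refine ContDiff.sum fun α _ => ContDiff.sum fun β _ => contDiff_const.mul ?_
  exact Complex.ofRealCLM.contDiff.comp
    ((hasTemperateGrowth_monomial α).1.mul (hasTemperateGrowth_monomial β).1)

theorem exists_norm_iteratedFDeriv_polyForm_le (d m n : ℕ) : ∃ (k : ℕ) (C : ℝ), 0 ≤ C ∧
    ∀ (c : (Fin d → ℕ) → (Fin d → ℕ) → ℂ) (B : ℝ),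
    (∀ α ∈ multiIndices d m, ∀ β ∈ multiIndices d m, ‖c α β‖ ≤ B) → 0 ≤ B →
    ∀ j ≤ n, ∀ ξ : Space d, ‖iteratedFDeriv ℝ j (polyForm m c) ξ‖ ≤ B * C * (1 + ‖ξ‖) ^ k := by
  have hg : ∀ α β : Fin d → ℕ, (fun ξ : Space d =>
      ((monomial α ξ * monomial β ξ : ℝ) : ℂ)).HasTemperateGrowth := fun α β =>
    Function.Complex.hasTemperateGrowth_ofReal.comp
      ((hasTemperateGrowth_monomial α).mul (hasTemperateGrowth_monomial β))
  choose k C hC0 hC using fun α β => (hg α β).norm_iteratedFDeriv_le_uniform n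
  set S := multiIndices d m
  refine ⟨∑ α ∈ S, ∑ β ∈ S, k α β, ∑ α ∈ S, ∑ β ∈ S, C α β,
    Finset.sum_nonneg fun α _ => Finset.sum_nonneg fun β _ => hC0 α β, fun c B hc hB j hj ξ => ?_⟩
  have hsm : ∀ α β, ContDiff ℝ j fun ξ : Space d =>
      c α β * ((monomial α ξ * monomial β ξ : ℝ) : ℂ) := fun α β =>
    contDiff_const.mul ((hg α β).1.of_le (by exact_mod_cast le_top))
  have h1 : iteratedFDeriv ℝ j (polyForm m c) ξ = ∑ α ∈ S, ∑ β ∈ S,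
      c α β • iteratedFDeriv ℝ j (fun ξ : Space d =>
        ((monomial α ξ * monomial β ξ : ℝ) : ℂ)) ξ := by
    unfold polyForm
    rw [iteratedFDeriv_fun_sum_apply fun α _ =>
      (ContDiff.sum fun β _ => hsm α β).contDiffAt]
    refine Finset.sum_congr rfl fun α _ => ?_
    rw [iteratedFDeriv_fun_sum_apply fun β _ => (hsm α β).contDiffAt]
    refine Finset.sum_congr rfl fun β _ => ?_
    exact iteratedFDeriv_const_smul_apply' (a := c α β)
      ((hg α β).1.of_le (by exact_mod_cast le_top)).contDiffAt
  rw [h1, Finset.mul_sum, Finset.sum_mul]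
  refine norm_sum_le_of_le _ fun α hα => ?_
  rw [Finset.mul_sum, Finset.sum_mul]
  refine norm_sum_le_of_le _ fun β hβ => ?_
  rw [norm_smul, mul_assoc]
  refine mul_le_mul (hc α hα β hβ) ((hC α β j hj ξ).trans ?_) (norm_nonneg _) hB
  refine mul_le_mul_of_nonneg_left (pow_le_pow_right₀ (by simp) ?_) (hC0 α β)
  exact (Finset.single_le_sum (f := fun β => k α β) (fun _ _ => Nat.zero_le _) hβ).trans
    (Finset.single_le_sum (f := fun α => ∑ β ∈ S, k α β) (fun _ _ => Nat.zero_le _) hα)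

theorem exists_norm_iteratedFDeriv_cexp_polyForm_le (d m n : ℕ) (K : ℝ) (hK : 0 ≤ K) :
    ∃ (k : ℕ) (C : ℝ), 0 ≤ C ∧ ∀ (ν ρ : ℝ) (c : (Fin d → ℕ) → (Fin d → ℕ) → ℂ), 0 ≤ ρ →
      IsEllipticForm m ν K ρ c → ∀ j ≤ n, ∀ ξ : Space d,
      ‖iteratedFDeriv ℝ j (fun ξ => Complex.exp (-polyForm m c ξ)) ξ‖ ≤
        C * Real.exp (-(ν * ρ * ‖ξ‖ ^ (2 * m))) * ((1 + ρ) ^ n * (1 + ‖ξ‖) ^ k) := by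
  obtain ⟨k, C, hC, h⟩ := exists_norm_iteratedFDeriv_polyForm_le d m n
  refine ⟨k * n, n.factorial * (1 + K * C) ^ n, by positivity, fun ν ρ c hρ hc j hj ξ => ?_⟩
  have hx : (1 : ℝ) ≤ (1 + ‖ξ‖) ^ k := one_le_pow₀ (by simp)
  have hKC : 0 ≤ K * C := by positivity
  have hD : 1 ≤ (1 + K * C) * (1 + ρ) * (1 + ‖ξ‖) ^ k := by
    refine one_le_mul_of_one_le_of_one_le (one_le_mul_of_one_le_of_one_le ?_ ?_) hx <;> linarith
  refine (norm_iteratedFDeriv_cexp_comp_le (contDiff_polyForm m c).neg j ξ hD fun i hi => ?_).trans ?_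
  · have : iteratedFDeriv ℝ i (fun ξ => -polyForm m c ξ) ξ = -iteratedFDeriv ℝ i (polyForm m c) ξ :=
      iteratedFDeriv_neg_apply
    rw [this, norm_neg]
    refine (h c (K * ρ) hc.bounded (by positivity) i (hi.trans hj) ξ).trans ?_
    refine mul_le_mul_of_nonneg_right ?_ (by positivity)
    nlinarith [mul_nonneg hKC hρ]
  · have h1 : (j.factorial : ℝ) ≤ n.factorial := by exact_mod_cast Nat.factorial_le hj
    have h2 : Real.exp (-polyForm m c ξ).re ≤ Real.exp (-(ν * ρ * ‖ξ‖ ^ (2 * m))) := by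
      rw [Complex.neg_re]; gcongr; exact hc.elliptic ξ
    calc _ ≤ n.factorial * Real.exp (-(ν * ρ * ‖ξ‖ ^ (2 * m))) *
          ((1 + K * C) * (1 + ρ) * (1 + ‖ξ‖) ^ k) ^ n := by
          gcongr
      _ = _ := by rw [mul_pow, mul_pow, ← pow_mul]; ring

/-- Polynomial growth is absorbed by exponential decay. -/
theorem one_add_pow_mul_exp_neg_le {a x : ℝ} (ha : 0 < a) (hx : 0 ≤ x) (N : ℕ) :
    (1 + x) ^ N * Real.exp (-(a * x)) ≤ N.factorial / a ^ N * Real.exp a := by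
  have h1 := Real.pow_div_factorial_le_exp (x := a * (1 + x)) (by positivity) N
  rw [div_le_iff₀ (by positivity), mul_pow] at h1
  have h2 : Real.exp (a * (1 + x)) = Real.exp a * Real.exp (a * x) := by
    rw [← Real.exp_add]; congr 1; ring
  rw [h2] at h1
  rw [Real.exp_neg, ← div_eq_mul_inv, div_le_iff₀ (Real.exp_pos _), div_mul_eq_mul_div,
    div_mul_eq_mul_div, le_div_iff₀ (by positivity)]
  linarith

/-- A symbol `θ exp (-P)`, with a cutoff `θ` supported away from the origin and an elliptic form
`P` of size `ρ`, has an inverse Fourier transform of size `(1 + ρ)⁻¹ (1 + |z|)^{-d-1}`. -/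
theorem exists_norm_fourierInv_cutoff_le {d : ℕ} (m : ℕ) {ν K : ℝ} (hν : 0 < ν) (hK : 0 ≤ K)
    {θ : Space d → ℂ} (hθ : ContDiff ℝ ∞ θ) (hsupp : HasCompactSupport θ) {ε : ℝ} (hε : 0 < ε)
    (hθε : ∀ ξ ∈ tsupport θ, ε ≤ ‖ξ‖) :
    ∃ C : ℝ, 0 ≤ C ∧ ∀ (ρ : ℝ) (c : (Fin d → ℕ) → (Fin d → ℕ) → ℂ), 0 ≤ ρ →
      IsEllipticForm m ν K ρ c → ∀ z,
      ‖𝓕⁻ (fun ξ => θ ξ * Complex.exp (-polyForm m c ξ)) z‖ ≤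
        C * (1 + ρ)⁻¹ * ((1 + ‖z‖)⁻¹) ^ (d + 1) := by
  obtain ⟨C₁, hC₁, h₁⟩ := exists_norm_fourierInv_le (d + 1)
  obtain ⟨k, C₂, hC₂, h₂⟩ := exists_norm_iteratedFDeriv_cexp_polyForm_le d m (d + 1) K hK
  obtain ⟨R, hR⟩ := hsupp.isCompact.isBounded.exists_norm_le
  have hθd : ∀ j : ℕ, ∃ B : ℝ, ∀ ξ, ‖iteratedFDeriv ℝ j θ ξ‖ ≤ B := fun j => by
    obtain ⟨B, hB⟩ := (hθ.continuous_iteratedFDeriv (m := j)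
      (by exact_mod_cast le_top)).bounded_above_of_compact_support (hsupp.iteratedFDeriv j)
    exact ⟨B, hB⟩
  choose B hB using hθd
  have hB0 : ∀ j, 0 ≤ B j := fun j => (norm_nonneg _).trans (hB j 0)
  set a := ν * ε ^ (2 * m) with ha
  have ha0 : 0 < a := by positivity
  set C₃ := ((d + 2).factorial / a ^ (d + 2) * Real.exp a) with hC₃
  set A₀ : ℝ := ∑ j ∈ Finset.range (d + 2), ∑ i ∈ Finset.range (j + 1),
    (j.choose i : ℝ) * B i * (C₂ * (1 + |R|) ^ k * C₃) with hA₀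
  have hC₃0 : 0 ≤ C₃ := by positivity
  have hterm : ∀ j i : ℕ, 0 ≤ (j.choose i : ℝ) * B i * (C₂ * (1 + |R|) ^ k * C₃) := fun j i =>
    mul_nonneg (mul_nonneg (Nat.cast_nonneg _) (hB0 i)) (by positivity)
  have hA₀0 : 0 ≤ A₀ := Finset.sum_nonneg fun j _ => Finset.sum_nonneg fun i _ => hterm j i
  -- the derivatives of the symbol are bounded and supported in `tsupport θ`
  set g : Space d → ℝ := (tsupport θ).indicator fun _ => 1 with hg
  have hgint : Integrable g := by
    refine (integrable_indicator_iff hsupp.isCompact.measurableSet).2 ?_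
    exact integrableOn_const hsupp.isCompact.measure_lt_top.ne
  have hg0 : 0 ≤ ∫ ξ, g ξ := integral_nonneg fun ξ => indicator_nonneg (fun _ _ => zero_le_one) ξ
  refine ⟨C₁ * (A₀ * ∫ ξ, g ξ), by positivity, fun ρ c hρ hc z => ?_⟩
  have hexp : ContDiff ℝ ∞ fun ξ : Space d => Complex.exp (-polyForm m c ξ) :=
    Complex.contDiff_exp.comp (contDiff_polyForm m c).neg
  refine (h₁ d _ g (A₀ * (1 + ρ)⁻¹) (hθ.mul hexp) hgint (by positivity) ?_ z).trans_eq (by ring)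
  intro j hj ξ
  by_cases hξ : ξ ∈ tsupport θ
  · rw [hg, indicator_of_mem hξ, mul_one]
    refine (norm_iteratedFDeriv_mul_le (N := ∞) hθ hexp ξ (by exact_mod_cast le_top)).trans ?_
    have hexp2 : ∀ i ≤ j, ‖iteratedFDeriv ℝ i (fun ξ => Complex.exp (-polyForm m c ξ)) ξ‖ ≤
        C₂ * (1 + |R|) ^ k * C₃ * (1 + ρ)⁻¹ := by
      intro i hi
      refine (h₂ ν ρ c hρ hc i (hi.trans hj) ξ).trans ?_
      have e1 : Real.exp (-(ν * ρ * ‖ξ‖ ^ (2 * m))) ≤ Real.exp (-(a * ρ)) := by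
        have := pow_le_pow_left₀ hε.le (hθε ξ hξ) (2 * m)
        rw [ha, Real.exp_le_exp]
        have := mul_le_mul_of_nonneg_left this (mul_nonneg hν.le hρ)
        linarith
      have e2 : (1 + ‖ξ‖) ^ k ≤ (1 + |R|) ^ k := by
        gcongr; exact (hR ξ hξ).trans (le_abs_self R)
      -- one power more than the growth `(1 + ρ) ^ (d + 1)`, to leave the factor `(1 + ρ)⁻¹`
      have e3 := one_add_pow_mul_exp_neg_le ha0 hρ (d + 2)
      rw [← hC₃] at e3
      rw [← div_eq_mul_inv, le_div_iff₀ (by positivity)]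
      calc _ ≤ C₂ * Real.exp (-(a * ρ)) * ((1 + ρ) ^ (d + 1) * (1 + |R|) ^ k) * (1 + ρ) := by gcongr
        _ = C₂ * (1 + |R|) ^ k * ((1 + ρ) ^ (d + 2) * Real.exp (-(a * ρ))) := by ring
        _ ≤ _ := by gcongr
    calc _ ≤ ∑ i ∈ Finset.range (j + 1), (j.choose i : ℝ) * B i *
          (C₂ * (1 + |R|) ^ k * C₃ * (1 + ρ)⁻¹) := by
          refine Finset.sum_le_sum fun i _ => ?_
          refine mul_le_mul (mul_le_mul_of_nonneg_left (hB i ξ) (Nat.cast_nonneg _))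
            (hexp2 _ (Nat.sub_le _ _)) (norm_nonneg _)
            (mul_nonneg (Nat.cast_nonneg _) (hB0 i))
      _ = (∑ i ∈ Finset.range (j + 1), (j.choose i : ℝ) * B i * (C₂ * (1 + |R|) ^ k * C₃)) *
          (1 + ρ)⁻¹ := by
          rw [Finset.sum_mul]
          exact Finset.sum_congr rfl fun i _ => by ring
      _ ≤ _ := by
          gcongr
          exact Finset.single_le_sum (f := fun j => ∑ i ∈ Finset.range (j + 1),
            (j.choose i : ℝ) * B i * (C₂ * (1 + |R|) ^ k * C₃))
            (fun j _ => Finset.sum_nonneg fun i _ => hterm j i) (Finset.mem_range.2 (by omega))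
  · rw [hg, indicator_of_notMem hξ, mul_zero]
    have : ξ ∉ tsupport (iteratedFDeriv ℝ j fun ξ => θ ξ * Complex.exp (-polyForm m c ξ)) := by
      intro h
      exact hξ (closure_mono (Function.support_mul_subset_left _ _) (tsupport_iteratedFDeriv_subset j h))
    rw [image_eq_zero_of_notMem_tsupport this, norm_zero]

theorem norm_pow_two_mul_ge {d m : ℕ} (hm : 1 ≤ m) (ξ : Space d) : ‖ξ‖ - 1 ≤ ‖ξ‖ ^ (2 * m) := by
  rcases le_total ‖ξ‖ 1 with h | h
  · have := pow_nonneg (norm_nonneg ξ) (2 * m); linarith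
  · have := le_self_pow₀ h (show 2 * m ≠ 0 by omega); linarith

theorem integrable_inv_one_add_norm_pow (d : ℕ) :
    Integrable fun z : Space d => ((1 + ‖z‖)⁻¹) ^ (d + 1) := by
  have := integrable_one_add_norm (E := Space d) (μ := volume) (r := d + 1) (by simp)
  refine this.congr (Filter.Eventually.of_forall fun z => ?_)
  simp only
  rw [Real.rpow_neg (by positivity), inv_pow]
  norm_cast

/-- The exponential of an elliptic form decays faster than any power. -/
theorem exists_exp_mul_pow_le {d m : ℕ} (hm : 1 ≤ m) {b : ℝ} (hb : 0 < b) (N : ℕ) :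
    ∃ C : ℝ, 0 ≤ C ∧ ∀ ξ : Space d, Real.exp (-(b * ‖ξ‖ ^ (2 * m))) * (1 + ‖ξ‖) ^ N ≤
      C * ((1 + ‖ξ‖)⁻¹) ^ (d + 1) := by
  refine ⟨Real.exp b * ((N + (d + 1)).factorial / b ^ (N + (d + 1)) * Real.exp b), by positivity,
    fun ξ => ?_⟩
  have h1 := one_add_pow_mul_exp_neg_le hb (norm_nonneg ξ) (N + (d + 1))
  have h2 : Real.exp (-(b * ‖ξ‖ ^ (2 * m))) ≤ Real.exp b * Real.exp (-(b * ‖ξ‖)) := by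
    rw [← Real.exp_add]
    gcongr
    have := mul_le_mul_of_nonneg_left (norm_pow_two_mul_ge hm ξ) hb.le
    linarith
  rw [inv_pow, ← div_eq_mul_inv, le_div_iff₀ (by positivity), mul_assoc, ← pow_add]
  calc _ ≤ Real.exp b * Real.exp (-(b * ‖ξ‖)) * (1 + ‖ξ‖) ^ (N + (d + 1)) := by gcongr
    _ = Real.exp b * ((1 + ‖ξ‖) ^ (N + (d + 1)) * Real.exp (-(b * ‖ξ‖))) := by ring
    _ ≤ _ := by gcongr

section Global

variable {d m : ℕ} {ν K ρ : ℝ} {c : (Fin d → ℕ) → (Fin d → ℕ) → ℂ}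

theorem IsEllipticForm.integrable_fourierInv (hm : 1 ≤ m) (hν : 0 < ν) (hK : 0 ≤ K) (hρ : 0 < ρ)
    (hc : IsEllipticForm m ν K ρ c) :
    Integrable (𝓕⁻ fun ξ : Space d => Complex.exp (-polyForm m c ξ)) := by
  obtain ⟨C₁, hC₁, h₁⟩ := exists_norm_fourierInv_le (d + 1)
  obtain ⟨k, C₂, hC₂, h₂⟩ := exists_norm_iteratedFDeriv_cexp_polyForm_le d m (d + 1) K hK
  obtain ⟨C₃, hC₃, h₃⟩ := exists_exp_mul_pow_le (d := d) hm (mul_pos hν hρ) k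
  have hexp : ContDiff ℝ ∞ fun ξ : Space d => Complex.exp (-polyForm m c ξ) :=
    Complex.contDiff_exp.comp (contDiff_polyForm m c).neg
  have hb : ∀ j ≤ d + 1, ∀ ξ,
      ‖iteratedFDeriv ℝ j (fun ξ : Space d => Complex.exp (-polyForm m c ξ)) ξ‖ ≤
      (C₂ * (1 + ρ) ^ (d + 1) * C₃) * ((1 + ‖ξ‖)⁻¹) ^ (d + 1) := by
    intro j hj ξ
    refine (h₂ ν ρ c hρ.le hc j hj ξ).trans ?_
    calc _ = C₂ * (1 + ρ) ^ (d + 1) *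
          (Real.exp (-(ν * ρ * ‖ξ‖ ^ (2 * m))) * (1 + ‖ξ‖) ^ k) := by ring
      _ ≤ C₂ * (1 + ρ) ^ (d + 1) * (C₃ * ((1 + ‖ξ‖)⁻¹) ^ (d + 1)) := by
          exact mul_le_mul_of_nonneg_left (h₃ ξ) (by positivity)
      _ = _ := by ring
  have h4 := h₁ d _ _ _ hexp (integrable_inv_one_add_norm_pow d) (by positivity) hb
  refine ((integrable_inv_one_add_norm_pow d).const_mul _).mono' ?_ (Filter.Eventually.of_forall h4)
  have hi : Integrable fun ξ : Space d => Complex.exp (-polyForm m c ξ) := by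
    refine ((integrable_inv_one_add_norm_pow d).const_mul (C₂ * (1 + ρ) ^ (d + 1) * C₃)).mono'
      hexp.continuous.aestronglyMeasurable (Filter.Eventually.of_forall fun ξ => ?_)
    simpa using hb 0 (Nat.zero_le _) ξ
  rw [Real.fourierInv_eq_fourier_comp_neg]
  exact (VectorFourier.fourierIntegral_continuous Real.continuous_fourierChar
    (innerSL ℝ).continuous₂ hi.comp_neg).aestronglyMeasurable

theorem IsEllipticForm.integrable_pow_mul_cexp (hm : 1 ≤ m) (hν : 0 < ν) (hρ : 0 < ρ)
    (hc : IsEllipticForm m ν K ρ c) (k : ℕ) :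
    Integrable fun ξ : Space d => ((‖ξ‖ ^ k : ℝ) : ℂ) * Complex.exp (-polyForm m c ξ) := by
  obtain ⟨C₃, hC₃, h₃⟩ := exists_exp_mul_pow_le (d := d) hm (mul_pos hν hρ) k
  have hexp : Continuous fun ξ : Space d => Complex.exp (-polyForm m c ξ) :=
    Complex.continuous_exp.comp (contDiff_polyForm m c).continuous.neg
  refine ((integrable_inv_one_add_norm_pow d).const_mul C₃).mono'
    (Continuous.mul (by fun_prop) hexp).aestronglyMeasurable
    (Filter.Eventually.of_forall fun ξ => ?_)
  rw [norm_mul, Complex.norm_real, norm_pow, norm_norm, Complex.norm_exp, Complex.neg_re]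
  refine le_trans ?_ (h₃ ξ)
  rw [mul_comm]
  gcongr
  · exact hc.elliptic ξ
  · simp

theorem IsEllipticForm.fourier_fourierInv (hm : 1 ≤ m) (hν : 0 < ν) (hK : 0 ≤ K) (hρ : 0 < ρ)
    (hc : IsEllipticForm m ν K ρ c) :
    𝓕 (𝓕⁻ fun ξ : Space d => Complex.exp (-polyForm m c ξ)) =
      fun ξ => Complex.exp (-polyForm m c ξ) := by
  have hexp : Continuous fun ξ : Space d => Complex.exp (-polyForm m c ξ) :=
    Complex.continuous_exp.comp (contDiff_polyForm m c).continuous.neg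
  have hi := hc.integrable_pow_mul_cexp hm hν hρ 0
  simp only [pow_zero, Complex.ofReal_one, one_mul] at hi
  refine hexp.fourier_fourierInv_eq hi ?_
  have := (hc.integrable_fourierInv hm hν hK hρ).comp_neg
  refine this.congr (Filter.Eventually.of_forall fun z => ?_)
  simp [Real.fourierInv_eq_fourier_neg]

end Global

/-! ### Dyadic sums and dilations -/

/-- The Cauchy–Schwarz inequality for a weight `k`. -/
theorem sq_lintegral_mul_le {α : Type*} [MeasurableSpace α] {μ : Measure α} {k u : α → ℝ≥0∞}
    (hk : AEMeasurable k μ) (hu : AEMeasurable u μ) :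
    (∫⁻ x, k x * u x ∂μ) ^ 2 ≤ (∫⁻ x, k x ∂μ) * ∫⁻ x, k x * u x ^ 2 ∂μ := by
  have h := ENNReal.lintegral_mul_le_Lp_mul_Lq μ Real.HolderConjugate.two_two
    (hk.pow_const (1 / 2 : ℝ)) ((hk.pow_const (1 / 2 : ℝ)).mul hu)
  have h1 : ∀ x, (k x ^ (1 / 2 : ℝ)) * (k x ^ (1 / 2 : ℝ) * u x) = k x * u x := fun x => by
    rw [← mul_assoc, ← ENNReal.rpow_add_of_nonneg _ _ (by norm_num) (by norm_num)]
    norm_num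
  have h2 : ∀ x, (k x ^ (1 / 2 : ℝ)) ^ (2 : ℝ) = k x := fun x => by
    rw [← ENNReal.rpow_mul]; norm_num
  have h3 : ∀ x, (k x ^ (1 / 2 : ℝ) * u x) ^ (2 : ℝ) = k x * u x ^ 2 := fun x => by
    rw [ENNReal.mul_rpow_of_nonneg _ _ (by norm_num), h2]; norm_num
  simp only [Pi.mul_apply, h1, h2, h3] at h
  have h4 : ∀ a : ℝ≥0∞, (a ^ (1 / 2 : ℝ)) ^ 2 = a := fun a => by
    rw [← ENNReal.rpow_natCast, ← ENNReal.rpow_mul]; norm_num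
  calc _ ≤ _ := pow_le_pow_left' h 2
    _ = _ := by rw [mul_pow, h4, h4]

theorem sq_tsum_mul_le (k u : ℤ → ℝ≥0∞) :
    (∑' l, k l * u l) ^ 2 ≤ (∑' l, k l) * ∑' l, k l * u l ^ 2 := by
  have := sq_lintegral_mul_le (μ := Measure.count) (k := k) (u := u)
    (measurable_of_countable k).aemeasurable (measurable_of_countable u).aemeasurable
  simpa only [lintegral_count] using this

/-- The weight `2^{-|j|}` on `ℤ`. -/
noncomputable def geom (j : ℤ) : ℝ≥0∞ := 2⁻¹ ^ j.natAbs

theorem tsum_geom_le : ∑' j, geom j ≤ 4 := by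
  have hg : ∑' n : ℕ, (2⁻¹ : ℝ≥0∞) ^ n = 2 := by
    rw [ENNReal.tsum_geometric, ENNReal.one_sub_inv_two, inv_inv]
  have h1 : HasSum (fun n : ℕ => geom n) 2 := by
    have := (ENNReal.summable (f := fun n : ℕ => (2⁻¹ : ℝ≥0∞) ^ n)).hasSum
    rw [hg] at this
    exact this
  have h2 : HasSum (fun n : ℕ => geom (-(n + 1 : ℤ))) (∑' n : ℕ, geom (-(n + 1 : ℤ))) :=
    ENNReal.summable.hasSum
  have h3 : ∑' n : ℕ, geom (-(n + 1 : ℤ)) ≤ 2 := by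
    rw [← hg]
    refine ENNReal.tsum_le_tsum fun n => ?_
    have : (-(n + 1 : ℤ)).natAbs = n + 1 := by omega
    rw [geom, this, pow_succ]
    exact mul_le_of_le_one_right' (by simp)
  rw [(HasSum.of_nat_of_neg_add_one h1 h2).tsum_eq]
  calc (2 : ℝ≥0∞) + _ ≤ 2 + 2 := by gcongr
    _ = 4 := by norm_num

theorem tsum_geom_sub_le (i : ℤ) : ∑' l, geom (l - i) ≤ 4 := by
  exact ((Equiv.subRight i).tsum_eq geom).trans_le tsum_geom_le

theorem geom_eq_ofReal (j : ℤ) : geom j = ENNReal.ofReal (2⁻¹ ^ j.natAbs) := by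
  rw [geom, ENNReal.ofReal_pow (by norm_num), ENNReal.ofReal_inv_of_pos two_pos, ENNReal.ofReal_ofNat]

theorem min_zpow_le_geom (j : ℤ) : min ((2 : ℝ) ^ j) (2 ^ j)⁻¹ ≤ 2⁻¹ ^ j.natAbs := by
  rcases le_total 0 j with h | h
  · obtain ⟨n, rfl⟩ := Int.eq_ofNat_of_zero_le h
    refine (min_le_right _ _).trans ?_
    simp
  · obtain ⟨n, hn⟩ := Int.eq_ofNat_of_zero_le (neg_nonneg.2 h)
    have : j = -n := by omega
    subst this
    refine (min_le_left _ _).trans ?_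
    simp

section Dilation

variable {d : ℕ} {F : Type*} [NormedAddCommGroup F] [NormedSpace ℝ F]

/-- The `L¹`-normalised dilation `2^{-ld} u(x / 2^l)`. -/
noncomputable def dilate (l : ℤ) (u : Space d → F) (x : Space d) : F :=
  (((2 : ℝ) ^ l)⁻¹ ^ d) • u (((2 : ℝ) ^ l)⁻¹ • x)

theorem integral_dilate_comp (l : ℤ) (u : Space d → F) :
    ∫ x, dilate l u x = ∫ x, u x := by
  have h2 : (0 : ℝ) < 2 ^ l := by positivity
  unfold dilate
  rw [integral_smul, Measure.integral_comp_smul]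
  simp only [finrank_euclideanSpace, Fintype.card_fin]
  rw [abs_of_nonneg (by positivity), smul_smul]
  field_simp
  simp

theorem contDiff_dilate (l : ℤ) {u : Space d → F} (hu : ContDiff ℝ ∞ u) :
    ContDiff ℝ ∞ (dilate l u) :=
  contDiff_const.smul (hu.comp (contDiff_const_smul _))

theorem dilate_eq_zero {u : Space d → F} {R : ℝ} (hu : ∀ x, R < ‖x‖ → u x = 0) (l : ℤ) {x : Space d}
    (hx : R * 2 ^ l < ‖x‖) : dilate l u x = 0 := by
  have h2 : (0 : ℝ) < 2 ^ l := by positivity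
  rw [dilate, hu, smul_zero]
  rw [norm_smul, norm_inv, Real.norm_of_nonneg h2.le, ← div_eq_inv_mul, lt_div_iff₀ h2]
  exact hx

theorem hasCompactSupport_dilate {u : Space d → F} (hu : HasCompactSupport u) (l : ℤ) :
    HasCompactSupport (dilate l u) := by
  obtain ⟨R, hR⟩ := hu.isCompact.isBounded.exists_norm_le
  refine HasCompactSupport.of_support_subset_isCompact (isCompact_closedBall 0 (R * 2 ^ l)) fun x hx => ?_
  rw [mem_closedBall_zero_iff]
  by_contra! h
  refine hx (dilate_eq_zero (R := R) (fun x hx => ?_) l h)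
  by_contra h'
  exact absurd (hR x (subset_tsupport _ h')) (not_le.2 hx)

end Dilation

section Dilation

variable {d : ℕ} {F : Type*} [NormedAddCommGroup F] [NormedSpace ℂ F]

theorem fourier_dilate (l : ℤ) (u : Space d → F) (ξ : Space d) :
    𝓕 (dilate l u) ξ = 𝓕 u ((2 : ℝ) ^ l • ξ) := by
  have h2 : (0 : ℝ) < 2 ^ l := by positivity
  rw [Real.fourier_eq, Real.fourier_eq]
  conv_rhs => rw [← integral_dilate_comp l]
  congr 1 with x
  unfold dilate
  beta_reduce
  rw [smul_comm, real_inner_smul_left, real_inner_smul_right, inv_mul_cancel_left₀ h2.ne']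

theorem fourierInv_dilate (l : ℤ) (u : Space d → F) (ξ : Space d) :
    𝓕⁻ (dilate l u) ξ = 𝓕⁻ u ((2 : ℝ) ^ l • ξ) := by
  rw [Real.fourierInv_eq_fourier_neg, Real.fourierInv_eq_fourier_neg, fourier_dilate, smul_neg]

end Dilation

/-! ### Convolutions and Plancherel's theorem -/

section SquareFunction

variable {d : ℕ} {H : Type*} [NormedAddCommGroup H] [InnerProductSpace ℂ H]

/-- Young's inequality `‖k ∗ G‖₂ ≤ ‖k‖₁ ‖G‖₂`. -/
theorem lintegral_enorm_convolution_sq_le {k : Space d → ℂ} {G : Space d → H}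
    (hk : AEStronglyMeasurable k) (hG : AEStronglyMeasurable G) :
    ∫⁻ x, ‖(k ⋆[ContinuousLinearMap.lsmul ℝ ℂ, volume] G) x‖ₑ ^ 2 ≤
      (∫⁻ y, ‖k y‖ₑ) ^ 2 * ∫⁻ x, ‖G x‖ₑ ^ 2 := by
  have hm : AEMeasurable (fun z : Space d × Space d => ‖k z.2‖ₑ * ‖G (z.1 - z.2)‖ₑ ^ 2)
      (volume.prod volume) := by
    refine AEMeasurable.mul hk.enorm.comp_snd (AEMeasurable.pow_const ?_ _)
    exact (hG.comp_quasiMeasurePreserving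
      (quasiMeasurePreserving_sub volume volume)).enorm
  have hGx : ∀ x, AEMeasurable fun y => ‖G (x - y)‖ₑ := fun x =>
    (hG.comp_quasiMeasurePreserving (quasiMeasurePreserving_sub_left volume x)).enorm
  calc ∫⁻ x, ‖(k ⋆[ContinuousLinearMap.lsmul ℝ ℂ, volume] G) x‖ₑ ^ 2
      ≤ ∫⁻ x, (∫⁻ y, ‖k y‖ₑ) * ∫⁻ y, ‖k y‖ₑ * ‖G (x - y)‖ₑ ^ 2 := by
        refine lintegral_mono fun x => ?_
        refine le_trans (pow_le_pow_left' (enorm_integral_le_lintegral_enorm _) 2) ?_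
        simp only [ContinuousLinearMap.lsmul_apply, enorm_smul]
        exact sq_lintegral_mul_le hk.enorm (hGx x)
    _ = (∫⁻ y, ‖k y‖ₑ) * ∫⁻ x, ∫⁻ y, ‖k y‖ₑ * ‖G (x - y)‖ₑ ^ 2 := by
        rw [lintegral_const_mul'' _ hm.lintegral_prod_right']
    _ = (∫⁻ y, ‖k y‖ₑ) * ∫⁻ y, ‖k y‖ₑ * ∫⁻ x, ‖G x‖ₑ ^ 2 := by
        rw [lintegral_lintegral_swap hm]
        congr 1
        refine lintegral_congr fun y => ?_
        have hGy : AEMeasurable fun x => ‖G (x - y)‖ₑ ^ 2 :=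
          (hG.comp_measurePreserving (measurePreserving_sub_right volume y)).enorm.pow_const 2
        rw [lintegral_const_mul'' _ hGy, lintegral_sub_right_eq_self (fun x => ‖G x‖ₑ ^ 2)]
    _ = _ := by
        rw [lintegral_mul_const'' _ hk.enorm, pow_two, mul_assoc]

theorem lintegral_enorm_fourier_schwartz_sq [CompleteSpace H] (u : SchwartzMap (Space d) H) :
    ∫⁻ ξ, ‖𝓕 (u : Space d → H) ξ‖ₑ ^ 2 = ∫⁻ x, ‖u x‖ₑ ^ 2 := by
  have key : ∀ v : SchwartzMap (Space d) H, ∫⁻ x, ‖v x‖ₑ ^ 2 = ENNReal.ofReal (∫ x, ‖v x‖ ^ 2) := by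
    intro v
    rw [ofReal_integral_eq_lintegral_ofReal]
    · refine lintegral_congr fun x => ?_
      rw [ENNReal.ofReal_pow (norm_nonneg _), ofReal_norm]
    · have := (v.memLp 2 volume).integrable_norm_pow (by norm_num)
      simpa using this
    · exact Eventually.of_forall fun x => by positivity
  rw [key, ← SchwartzMap.integral_norm_sq_fourier, ← key]
  rfl

theorem fourier_lsmul_convolution [CompleteSpace H] {k : Space d → ℂ} {G : Space d → H}
    (hk : Integrable k) (hG : Integrable G) (ξ : Space d) :
    𝓕 (k ⋆[ContinuousLinearMap.lsmul ℝ ℂ, volume] G) ξ = 𝓕 k ξ • 𝓕 G ξ :=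
  Real.fourier_smul_convolution_eq hk hG ξ

/-- Plancherel's theorem for a mollified function, which is a Schwartz function. -/
theorem lintegral_enorm_fourier_convolution_sq [CompleteSpace H] {k : Space d → ℂ} {G : Space d → H}
    (hk : ContDiff ℝ ∞ k) (hks : HasCompactSupport k) (hG : Integrable G)
    (hGs : HasCompactSupport G) :
    ∫⁻ ξ, ‖𝓕 k ξ‖ₑ ^ 2 * ‖𝓕 G ξ‖ₑ ^ 2 =
      ∫⁻ x, ‖(k ⋆[ContinuousLinearMap.lsmul ℝ ℂ, volume] G) x‖ₑ ^ 2 := by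
  have hsm : ContDiff ℝ ∞ (k ⋆[ContinuousLinearMap.lsmul ℝ ℂ, volume] G) :=
    hks.contDiff_convolution_left _ hk hG.locallyIntegrable
  have hcs : HasCompactSupport (k ⋆[ContinuousLinearMap.lsmul ℝ ℂ, volume] G) :=
    hks.convolution _ hGs
  have := lintegral_enorm_fourier_schwartz_sq (hcs.toSchwartzMap hsm)
  rw [show ⇑(hcs.toSchwartzMap hsm) = k ⋆[ContinuousLinearMap.lsmul ℝ ℂ, volume] G from rfl] at this
  rw [← this]
  refine lintegral_congr fun ξ => ?_
  rw [fourier_lsmul_convolution (hk.continuous.integrable_of_hasCompactSupport hks) hG, enorm_smul,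
    mul_pow]

/-- Bessel's inequality for the Fourier transform of an integrable compactly supported function,
by mollification. -/
theorem lintegral_enorm_fourier_sq_le [CompleteSpace H] {G : Space d → H} (hG : Integrable G)
    (hGs : HasCompactSupport G) : ∫⁻ ξ, ‖𝓕 G ξ‖ₑ ^ 2 ≤ ∫⁻ x, ‖G x‖ₑ ^ 2 := by
  let b : ContDiffBump (0 : Space d) := ⟨1, 2, one_pos, one_lt_two⟩
  set η : Space d → ℂ := fun x => (b.normed volume x : ℂ) with hη
  have hηc : ContDiff ℝ ∞ η := Complex.ofRealCLM.contDiff.comp b.contDiff_normed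
  have hηs : HasCompactSupport η := b.hasCompactSupport_normed.comp_left Complex.ofReal_zero
  have hηi : Integrable η := hηc.continuous.integrable_of_hasCompactSupport hηs
  have hη1 : 𝓕 η 0 = 1 := by
    rw [Real.fourier_eq]
    simp only [inner_zero_right, neg_zero, AddChar.map_zero_eq_one, one_smul, hη]
    rw [integral_complex_ofReal, b.integral_normed, Complex.ofReal_one]
  have hcont : Continuous (𝓕 η) :=
    VectorFourier.fourierIntegral_continuous Real.continuous_fourierChar
      (innerSL ℝ).continuous₂ hηi
  have hnorm : ∀ l : ℤ, ∫⁻ x, ‖dilate l η x‖ₑ = 1 := by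
    intro l
    have e1 : ∀ x, ‖dilate l η x‖ₑ = ENNReal.ofReal (dilate l (b.normed volume) x) := by
      intro x
      have hnn : 0 ≤ dilate l (b.normed volume) x := by
        unfold dilate
        exact smul_nonneg (by positivity) (b.nonneg_normed _)
      rw [← Real.enorm_of_nonneg hnn]
      unfold dilate
      rw [enorm_smul, enorm_smul, hη]
      congr 1
      simp [← ofReal_norm]
    simp_rw [e1]
    rw [← ofReal_integral_eq_lintegral_ofReal, integral_dilate_comp, b.integral_normed,
      ENNReal.ofReal_one]
    · exact (contDiff_dilate l b.contDiff_normed).continuous.integrable_of_hasCompactSupport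
        (hasCompactSupport_dilate b.hasCompactSupport_normed l)
    · refine Eventually.of_forall fun x => ?_
      unfold dilate
      exact smul_nonneg (by positivity) (b.nonneg_normed _)
  have hstep : ∀ n : ℕ, ∫⁻ ξ, ‖𝓕 (dilate (-n) η) ξ‖ₑ ^ 2 * ‖𝓕 G ξ‖ₑ ^ 2 ≤ ∫⁻ x, ‖G x‖ₑ ^ 2 := by
    intro n
    have hd := contDiff_dilate (-n) hηc
    rw [lintegral_enorm_fourier_convolution_sq hd (hasCompactSupport_dilate hηs _) hG hGs]
    refine (lintegral_enorm_convolution_sq_le hd.continuous.aestronglyMeasurable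
      hG.aestronglyMeasurable).trans ?_
    rw [hnorm, one_pow, one_mul]
  have hGc : Continuous (𝓕 G) :=
    VectorFourier.fourierIntegral_continuous Real.continuous_fourierChar
      (innerSL ℝ).continuous₂ hG
  have hlim : ∀ ξ, Tendsto (fun n : ℕ => ‖𝓕 (dilate (-n) η) ξ‖ₑ ^ 2 * ‖𝓕 G ξ‖ₑ ^ 2) atTop
      (𝓝 (‖𝓕 G ξ‖ₑ ^ 2)) := by
    intro ξ
    have h1 : Tendsto (fun n : ℕ => ((2 : ℝ) ^ (-n : ℤ)) • ξ) atTop (𝓝 0) := by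
      have : Tendsto (fun n : ℕ => ((2 : ℝ) ^ (-n : ℤ))) atTop (𝓝 0) := by
        have := tendsto_pow_atTop_nhds_zero_of_lt_one (r := (2⁻¹ : ℝ)) (by norm_num) (by norm_num)
        simpa using this
      simpa using this.smul_const ξ
    have h2 : Tendsto (fun n : ℕ => 𝓕 (dilate (-n) η) ξ) atTop (𝓝 1) := by
      simp_rw [fourier_dilate]
      rw [← hη1]
      exact (hcont.tendsto 0).comp h1
    have h3 := ((ENNReal.continuous_pow 2).tendsto _).comp h2.enorm
    have h4 := ENNReal.Tendsto.mul_const (b := ‖𝓕 G ξ‖ₑ ^ 2) h3 (Or.inl (by simp))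
    simpa using h4
  calc ∫⁻ ξ, ‖𝓕 G ξ‖ₑ ^ 2
      = ∫⁻ ξ, liminf (fun n : ℕ => ‖𝓕 (dilate (-n) η) ξ‖ₑ ^ 2 * ‖𝓕 G ξ‖ₑ ^ 2) atTop :=
        lintegral_congr fun ξ => (hlim ξ).liminf_eq.symm
    _ ≤ liminf (fun n : ℕ => ∫⁻ ξ, ‖𝓕 (dilate (-n) η) ξ‖ₑ ^ 2 * ‖𝓕 G ξ‖ₑ ^ 2) atTop := by
        refine lintegral_liminf_le' fun n => ?_
        simp_rw [fourier_dilate]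
        have : Continuous fun ξ => 𝓕 η ((2 : ℝ) ^ (-n : ℤ) • ξ) := hcont.comp (continuous_const_smul _)
        exact (this.enorm.measurable.pow_const 2).aemeasurable.mul
          (hGc.enorm.measurable.pow_const 2).aemeasurable
    _ ≤ _ := by
        refine liminf_le_of_le (by isBoundedDefault) fun c hc => ?_
        obtain ⟨n, hn⟩ := hc.exists
        exact hn.trans (hstep n)

end SquareFunction

/-! ### Wavelets and their weighted square function -/

/-- A smooth function supported in the unit ball whose Fourier transform vanishes to first order at
`0` and at `∞`, and nowhere else in the ball of radius `2`. Compact support in space is what makes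
the weighted square function estimate work, and replaces the usual compact support in frequency. -/
structure IsWavelet {d : ℕ} (q : Space d → ℂ) : Prop where
  contDiff : ContDiff ℝ ∞ q
  eq_zero : ∀ x, 1 < ‖x‖ → q x = 0
  fourier_ne_zero : ∀ ξ, 0 < ‖ξ‖ → ‖ξ‖ ≤ 2 → 𝓕 q ξ ≠ 0
  fourier_le : ∃ C : ℝ, 0 ≤ C ∧ ∀ ξ, ‖𝓕 q ξ‖ ≤ C * min ‖ξ‖ ‖ξ‖⁻¹

theorem IsWavelet.hasCompactSupport {d : ℕ} {q : Space d → ℂ} (hq : IsWavelet q) :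
    HasCompactSupport q :=
  HasCompactSupport.of_support_subset_isCompact (isCompact_closedBall 0 1) fun x hx => by
    rw [mem_closedBall_zero_iff]
    by_contra! h
    exact hx (hq.eq_zero x h)

theorem IsWavelet.contDiff_fourier {d : ℕ} {q : Space d → ℂ} (hq : IsWavelet q) :
    ContDiff ℝ ∞ (𝓕 q) := by
  refine Real.contDiff_fourier fun n _ => ?_
  refine Continuous.integrable_of_hasCompactSupport ?_ hq.hasCompactSupport.norm.mul_left
  exact (continuous_norm.pow n).mul hq.contDiff.continuous.norm

/-- The difference of a bump `η` and its dilate is a wavelet. With `θ = 2π ⟨x, ξ⟩`, the real part of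
its Fourier transform is the integral of `(cos θ - cos 2θ) η = (1 - cos θ) (1 + 2 cos θ) η`, which
is positive for `0 < |ξ| ≤ 2` since `η` lives where `cos θ ≥ 0`. -/
theorem exists_isWavelet (d : ℕ) : ∃ q : Space d → ℂ, IsWavelet q := by
  let b : ContDiffBump (0 : Space d) := ⟨1 / 16, 1 / 8, by norm_num, by norm_num⟩
  have hout : b.rOut = 1 / 8 := rfl
  have hin : b.rIn = 1 / 16 := rfl
  set η : Space d → ℂ := fun x => (b x : ℂ) with hη
  have hηc : ContDiff ℝ ∞ η := Complex.ofRealCLM.contDiff.comp b.contDiff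
  have hηs : HasCompactSupport η := b.hasCompactSupport.comp_left Complex.ofReal_zero
  have hηi : Integrable η := hηc.continuous.integrable_of_hasCompactSupport hηs
  have hη0 : ∀ x, 1 / 8 < ‖x‖ → η x = 0 := fun x hx => by
    rw [hη]
    simp only [Complex.ofReal_eq_zero]
    exact b.zero_of_le_dist (by rw [dist_zero_right, hout]; exact hx.le)
  have hdc := contDiff_dilate 1 hηc
  have hds := hasCompactSupport_dilate hηs 1
  have hdi : Integrable (dilate 1 η) := hdc.continuous.integrable_of_hasCompactSupport hds
  set q : Space d → ℂ := fun x => η x - dilate 1 η x with hq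
  have hqc : ContDiff ℝ ∞ q := hηc.sub hdc
  have hq0 : ∀ x, 1 < ‖x‖ → q x = 0 := fun x hx => by
    have h1 := hη0 x (by linarith)
    have h2 := dilate_eq_zero hη0 1 (x := x) (by norm_num; linarith)
    rw [hq]; simp [h1, h2]
  -- the angle `2π ⟨x, ξ⟩`
  set ang : Space d → Space d → ℝ := fun ξ x => 2 * Real.pi * inner ℝ x ξ with hang
  have hform : ∀ ξ, 𝓕 q ξ = ∫ x, (Complex.exp (Complex.I * (-ang ξ x : ℝ)) -
      Complex.exp (Complex.I * (-(2 * ang ξ x) : ℝ))) * η x := by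
    intro ξ
    have h1 : 𝓕 q ξ = 𝓕 η ξ - 𝓕 η ((2 : ℝ) • ξ) := by
      have h2 := fourier_dilate 1 η ξ
      rw [zpow_one] at h2
      rw [← h2, Real.fourier_eq, Real.fourier_eq, Real.fourier_eq, ← integral_sub]
      · simp only [hq, smul_sub]
      · exact (Real.fourierIntegral_convergent_iff ξ).2 hηi
      · exact (Real.fourierIntegral_convergent_iff ξ).2 hdi
    rw [h1, Real.fourier_eq', Real.fourier_eq', ← integral_sub]
    · congr 1 with x
      rw [smul_eq_mul, smul_eq_mul, ← sub_mul, real_inner_smul_right, hang]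
      congr 3
      · push_cast; ring
      · push_cast; ring
    · have := (Real.fourierIntegral_convergent_iff (f := η) ξ).2 hηi
      simpa only [Circle.smul_def, Real.fourierChar_apply, mul_neg, neg_mul] using this
    · have := (Real.fourierIntegral_convergent_iff (f := η) ((2 : ℝ) • ξ)).2 hηi
      simpa only [Circle.smul_def, Real.fourierChar_apply, mul_neg, neg_mul] using this
  have hangc : ∀ ξ, Continuous (ang ξ) := fun ξ => by rw [hang]; fun_prop
  have hint : ∀ ξ, Integrable fun x => (Complex.exp (Complex.I * (-ang ξ x : ℝ)) -
      Complex.exp (Complex.I * (-(2 * ang ξ x) : ℝ))) * η x := fun ξ => by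
    have := hangc ξ
    have := hηc.continuous
    exact Continuous.integrable_of_hasCompactSupport (by fun_prop) hηs.mul_left
  have hanglt : ∀ ξ x, ‖x‖ ≤ 1 / 8 → |ang ξ x| ≤ Real.pi / 4 * ‖ξ‖ := fun ξ x hx => by
    rw [hang]
    simp only [abs_mul, abs_two, abs_of_pos Real.pi_pos]
    have := abs_real_inner_le_norm x ξ
    have h3 : ‖x‖ * ‖ξ‖ ≤ 1 / 8 * ‖ξ‖ := by gcongr
    have := Real.pi_pos
    nlinarith
  refine ⟨q, hqc, hq0, fun ξ hξ hξ2 => ?_, ?_⟩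
  · have hre : (𝓕 q ξ).re = ∫ x, (Real.cos (ang ξ x) - Real.cos (2 * ang ξ x)) * b x := by
      rw [hform, ← Complex.reCLM_apply, ← Complex.reCLM.integral_comp_comm (hint ξ)]
      congr 1 with x
      rw [Complex.reCLM_apply, hη, Complex.re_mul_ofReal, Complex.sub_re, mul_comm Complex.I,
        mul_comm Complex.I, Complex.exp_ofReal_mul_I_re, Complex.exp_ofReal_mul_I_re, Real.cos_neg,
        Real.cos_neg]
    have hfac : ∀ x, Real.cos (ang ξ x) - Real.cos (2 * ang ξ x) =
        (1 - Real.cos (ang ξ x)) * (1 + 2 * Real.cos (ang ξ x)) := fun x => by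
      rw [Real.cos_two_mul]; ring
    have hcos : ∀ x, ‖x‖ ≤ 1 / 8 → 0 ≤ Real.cos (ang ξ x) := fun x hx => by
      have h1 := abs_le.1 (hanglt ξ x hx)
      have h2 : Real.pi / 4 * ‖ξ‖ ≤ Real.pi / 2 := by nlinarith [Real.pi_pos]
      exact Real.cos_nonneg_of_neg_pi_div_two_le_of_le (by linarith) (by linarith)
    have hpos : 0 < ∫ x, (Real.cos (ang ξ x) - Real.cos (2 * ang ξ x)) * b x := by
      have hc : Continuous fun x => (Real.cos (ang ξ x) - Real.cos (2 * ang ξ x)) * b x := by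
        have := hangc ξ
        have := b.continuous
        fun_prop
      refine hc.integral_pos_of_hasCompactSupport_nonneg_nonzero
        b.hasCompactSupport.mul_left (fun x => ?_) (x := (1 / 32 : ℝ) • ξ) ?_
      · rcases le_or_gt ‖x‖ (1 / 8) with h | h
        · rw [hfac]
          have h1 := Real.cos_le_one (ang ξ x)
          have h2 := hcos x h
          exact mul_nonneg (mul_nonneg (by linarith) (by linarith)) b.nonneg
        · have : b x = 0 := b.zero_of_le_dist (by rw [dist_zero_right, hout]; exact h.le)
          simp [this]
      · have hx : ‖(1 / 32 : ℝ) • ξ‖ ≤ 1 / 16 := by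
          rw [norm_smul, Real.norm_of_nonneg (by norm_num)]; linarith
        have h1 : b ((1 / 32 : ℝ) • ξ) = 1 :=
          b.one_of_mem_closedBall (by rw [mem_closedBall_zero_iff, hin]; exact hx)
        rw [h1, mul_one, hfac]
        have h2 := hcos ((1 / 32 : ℝ) • ξ) (by linarith)
        have h3 : ang ξ ((1 / 32 : ℝ) • ξ) ≠ 0 := by
          rw [hang]
          simp only [real_inner_smul_left, real_inner_self_eq_norm_sq]
          have := Real.pi_pos
          positivity
        have h4 : |ang ξ ((1 / 32 : ℝ) • ξ)| < 2 * Real.pi := by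
          have := hanglt ξ ((1 / 32 : ℝ) • ξ) (by linarith)
          nlinarith [Real.pi_pos]
        have h5 : Real.cos (ang ξ ((1 / 32 : ℝ) • ξ)) < 1 := by
          refine lt_of_le_of_ne (Real.cos_le_one _) fun h => h3 ?_
          rw [abs_lt] at h4
          exact (Real.cos_eq_one_iff_of_lt_of_lt h4.1 h4.2).1 h
        exact (mul_pos (by linarith) (by linarith)).ne'
    intro h
    rw [← hre, h] at hpos
    simp at hpos
  · obtain ⟨C₁, hC₁, h₁⟩ := exists_norm_fourierInv_le 1
    have hqs : HasCompactSupport q := hηs.sub hds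
    have hB : ∀ j : ℕ, ∃ B : ℝ, ∀ ξ, ‖iteratedFDeriv ℝ j q ξ‖ ≤ B := fun j =>
      (hqc.continuous_iteratedFDeriv (m := j)
        (by exact_mod_cast le_top)).bounded_above_of_compact_support (hqs.iteratedFDeriv j)
    choose B hB using hB
    set g : Space d → ℝ := (tsupport q).indicator fun _ => 1 with hg
    have hgint : Integrable g :=
      (integrable_indicator_iff hqs.isCompact.measurableSet).2
        (integrableOn_const hqs.isCompact.measure_lt_top.ne)
    have hB0 : ∀ j, 0 ≤ B j := fun j => (norm_nonneg _).trans (hB j 0)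
    have h2 := h₁ d q g (B 0 + B 1) hqc hgint (add_nonneg (hB0 0) (hB0 1)) (by
      intro j hj ξ
      by_cases hξ : ξ ∈ tsupport q
      · rw [hg, indicator_of_mem hξ, mul_one]
        have hj' : j = 0 ∨ j = 1 := by omega
        rcases hj' with rfl | rfl
        · exact (hB 0 ξ).trans (by linarith [hB0 1])
        · exact (hB 1 ξ).trans (by linarith [hB0 0])
      · rw [hg, indicator_of_notMem hξ, mul_zero,
          image_eq_zero_of_notMem_tsupport fun h => hξ (tsupport_iteratedFDeriv_subset j h),
          norm_zero])
    have hg0 : 0 ≤ ∫ ξ, g ξ := integral_nonneg fun ξ => indicator_nonneg (fun _ _ => zero_le_one) ξ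
    set C₂ := C₁ * ((B 0 + B 1) * ∫ ξ, g ξ)
    have hC₂ : 0 ≤ C₂ := mul_nonneg hC₁ (mul_nonneg (add_nonneg (hB0 0) (hB0 1)) hg0)
    set C₃ := Real.pi / 4 * ∫ x, b x
    have hC₃ : 0 ≤ C₃ := mul_nonneg (by positivity) (integral_nonneg fun x => b.nonneg)
    have hb1 : ∀ ξ, ‖𝓕 q ξ‖ ≤ C₃ * ‖ξ‖ := by
      intro ξ
      rw [hform]
      have : C₃ * ‖ξ‖ = ∫ x, Real.pi / 4 * ‖ξ‖ * b x := by
        rw [integral_const_mul]; ring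
      rw [this]
      refine norm_integral_le_of_norm_le
        ((b.continuous.integrable_of_hasCompactSupport b.hasCompactSupport).const_mul _)
        (Eventually.of_forall fun x => ?_)
      rw [norm_mul]
      rcases le_or_gt ‖x‖ (1 / 8) with h | h
      · have e1 : Complex.exp (Complex.I * (-ang ξ x : ℝ)) -
            Complex.exp (Complex.I * (-(2 * ang ξ x) : ℝ)) =
            -(Complex.exp (Complex.I * (-ang ξ x : ℝ)) *
              (Complex.exp (Complex.I * (-ang ξ x : ℝ)) - 1)) := by
          rw [mul_sub, ← Complex.exp_add, mul_one, neg_sub]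
          congr 2
          push_cast; ring
        have e2 : ‖η x‖ = b x := by
          rw [hη, Complex.norm_real, Real.norm_of_nonneg b.nonneg]
        rw [e1, norm_neg, norm_mul, Complex.norm_exp_I_mul_ofReal, one_mul, e2]
        refine mul_le_mul_of_nonneg_right ?_ b.nonneg
        refine (Real.norm_exp_I_mul_ofReal_sub_one_le).trans ?_
        rw [norm_neg]
        exact hanglt ξ x h
      · have : b x = 0 := b.zero_of_le_dist (by rw [dist_zero_right, hout]; exact h.le)
        rw [hη]; simp [this]
    have hb2 : ∀ ξ, ‖𝓕 q ξ‖ ≤ C₂ * (1 + ‖ξ‖)⁻¹ := by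
      intro ξ
      have := h2 (-ξ)
      rwa [Real.fourierInv_eq_fourier_neg, neg_neg, norm_neg, pow_one] at this
    refine ⟨C₂ + C₃, by positivity, fun ξ => ?_⟩
    rcases eq_or_ne ξ 0 with rfl | hξ
    · have := hb1 0
      simpa using this
    have hξ : 0 < ‖ξ‖ := norm_pos_iff.2 hξ
    rw [mul_min_of_nonneg _ _ (by positivity), le_min_iff]
    constructor
    · refine (hb1 ξ).trans ?_
      gcongr; linarith
    · refine (hb2 ξ).trans ?_
      gcongr
      · linarith
      · linarith

/-- The dyadic sum is comparable to a geometric series centred at the scale of `|ξ|`. -/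
theorem IsWavelet.exists_tsum_fourier_sq_le {d : ℕ} {q : Space d → ℂ} (hq : IsWavelet q) :
    ∃ C : ℝ≥0, ∀ ξ, ∑' l : ℤ, ‖𝓕 q ((2 : ℝ) ^ l • ξ)‖ₑ ^ 2 ≤ C := by
  obtain ⟨C, hC, h⟩ := hq.fourier_le
  refine ⟨(4 * C ^ 2).toNNReal * 4, fun ξ => ?_⟩
  rcases eq_or_ne ξ 0 with rfl | hξ
  · have h0 := h 0
    simp only [norm_zero, inv_zero, min_self, mul_zero] at h0
    have : 𝓕 q 0 = 0 := norm_le_zero_iff.1 h0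
    simp [this]
  have hξ : 0 < ‖ξ‖ := norm_pos_iff.2 hξ
  obtain ⟨k, hk1, hk2⟩ := exists_mem_Ico_zpow hξ one_lt_two
  have hterm : ∀ l : ℤ, ‖𝓕 q ((2 : ℝ) ^ l • ξ)‖ₑ ^ 2 ≤
      ENNReal.ofReal (4 * C ^ 2) * geom (l - -k) := by
    intro l
    have h2l : (0 : ℝ) < 2 ^ l := by positivity
    have h2k : (0 : ℝ) < 2 ^ k := by positivity
    have e0 : (2 : ℝ) ^ (l - -k) = 2 ^ l * 2 ^ k := by
      rw [sub_neg_eq_add, zpow_add₀ two_ne_zero]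
    have h1 : ‖𝓕 q ((2 : ℝ) ^ l • ξ)‖ ≤ C * (2 * 2⁻¹ ^ (l - -k).natAbs) := by
      refine (h _).trans ?_
      gcongr
      refine le_trans ?_ (mul_le_mul_of_nonneg_left (min_zpow_le_geom (l - -k)) zero_le_two)
      rw [norm_smul, Real.norm_of_nonneg h2l.le, mul_min_of_nonneg _ _ zero_le_two, e0]
      refine min_le_min ?_ ?_
      · rw [zpow_add_one₀ two_ne_zero] at hk2
        have := mul_le_mul_of_nonneg_left hk2.le h2l.le
        linarith
      · have : (2 ^ l * ‖ξ‖)⁻¹ ≤ ((2 : ℝ) ^ l * 2 ^ k)⁻¹ := by gcongr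
        have h3 : (0 : ℝ) ≤ (2 ^ l * 2 ^ k)⁻¹ := by positivity
        linarith
    have h3 : (2⁻¹ : ℝ) ^ (l - -k).natAbs ≤ 1 := pow_le_one₀ (by norm_num) (by norm_num)
    have h4 : (0 : ℝ) ≤ 2⁻¹ ^ (l - -k).natAbs := by positivity
    rw [geom_eq_ofReal, ← ENNReal.ofReal_mul (by positivity), ← ofReal_norm,
      ← ENNReal.ofReal_pow (norm_nonneg _)]
    refine ENNReal.ofReal_le_ofReal ?_
    calc _ ≤ (C * (2 * 2⁻¹ ^ (l - -k).natAbs)) ^ 2 := by gcongr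
      _ = 4 * C ^ 2 * (2⁻¹ ^ (l - -k).natAbs * 2⁻¹ ^ (l - -k).natAbs) := by ring
      _ ≤ 4 * C ^ 2 * (1 * 2⁻¹ ^ (l - -k).natAbs) := by gcongr
      _ = _ := by ring
  calc _ ≤ ∑' l : ℤ, ENNReal.ofReal (4 * C ^ 2) * geom (l - -k) := ENNReal.tsum_le_tsum hterm
    _ ≤ ENNReal.ofReal (4 * C ^ 2) * 4 := by
        rw [ENNReal.tsum_mul_left]
        exact mul_le_mul_right (tsum_geom_sub_le _) _
    _ = _ := by push_cast; rfl

/-- The square function of the dilates of a wavelet is bounded on `L²`, by Plancherel's theorem. -/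
theorem IsWavelet.exists_tsum_lintegral_sq_le {d : ℕ} {q : Space d → ℂ} (hq : IsWavelet q) :
    ∃ C : ℝ≥0, ∀ (H : Type u) [NormedAddCommGroup H] [InnerProductSpace ℂ H] [CompleteSpace H]
      (G : Space d → H), Integrable G → HasCompactSupport G →
      ∑' l : ℤ, ∫⁻ x, ‖(dilate l q ⋆[ContinuousLinearMap.lsmul ℝ ℂ, volume] G) x‖ₑ ^ 2 ≤
        C * ∫⁻ x, ‖G x‖ₑ ^ 2 := by
  obtain ⟨C, hC⟩ := hq.exists_tsum_fourier_sq_le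
  refine ⟨C, fun H _ _ _ G hG hGs => ?_⟩
  have hGc : Continuous (𝓕 G) :=
    VectorFourier.fourierIntegral_continuous Real.continuous_fourierChar
      (innerSL ℝ).continuous₂ hG
  calc _ = ∑' l : ℤ, ∫⁻ ξ, ‖𝓕 q ((2 : ℝ) ^ l • ξ)‖ₑ ^ 2 * ‖𝓕 G ξ‖ₑ ^ 2 := by
        refine tsum_congr fun l => ?_
        rw [← lintegral_enorm_fourier_convolution_sq (contDiff_dilate l hq.contDiff)
          (hasCompactSupport_dilate hq.hasCompactSupport l) hG hGs]
        simp_rw [fourier_dilate]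
    _ = ∫⁻ ξ, (∑' l : ℤ, ‖𝓕 q ((2 : ℝ) ^ l • ξ)‖ₑ ^ 2) * ‖𝓕 G ξ‖ₑ ^ 2 := by
        rw [← lintegral_tsum]
        · simp_rw [ENNReal.tsum_mul_right]
        · intro l
          have : Continuous fun ξ : Space d => 𝓕 q ((2 : ℝ) ^ l • ξ) :=
            hq.contDiff_fourier.continuous.comp (continuous_const_smul _)
          exact ((this.enorm.measurable.pow_const 2).mul
            (hGc.enorm.measurable.pow_const 2)).aemeasurable
    _ ≤ ∫⁻ ξ, C * ‖𝓕 G ξ‖ₑ ^ 2 := lintegral_mono fun ξ => mul_le_mul_left (hC ξ) _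
    _ ≤ _ := by
        rw [lintegral_const_mul _ (hGc.enorm.measurable.pow_const 2)]
        exact mul_le_mul_right (lintegral_enorm_fourier_sq_le hG hGs) _

/-- A weighted square function estimate. Because `q` is supported in the unit ball, the value of
`q_l ∗ g` at a point with `c < V l` depends only on the restriction of `g` to `{c < W}`; the
unweighted estimate is applied to these restrictions and integrated over the levels `c`. -/
theorem IsWavelet.exists_tsum_lintegral_weighted_sq_le {d : ℕ} {q : Space d → ℂ}
    (hq : IsWavelet q) :
    ∃ C : ℝ≥0, ∀ (H : Type u) [NormedAddCommGroup H] [InnerProductSpace ℂ H] [CompleteSpace H]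
      (g : Space d → H), Integrable g → HasCompactSupport g →
      ∀ (V : ℤ → Space d → ℝ≥0∞) (W : Space d → ℝ≥0∞), (∀ l, Measurable (V l)) → Measurable W →
      (∀ l y y', ‖y - y'‖ ≤ 2 ^ l → V l y ≤ W y') →
      ∑' l : ℤ, ∫⁻ x, V l x *
        ‖(dilate l q ⋆[ContinuousLinearMap.lsmul ℝ ℂ, volume] g) x‖ₑ ^ 2 ≤
        C * ∫⁻ x, W x * ‖g x‖ₑ ^ 2 := by
  obtain ⟨C, hC⟩ := hq.exists_tsum_lintegral_sq_le
  refine ⟨C, fun H _ _ _ g hg hgs V W hV hW hVW => ?_⟩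
  have hlayer : ∀ F : ℝ≥0∞, F = ∫⁻ c in Ioi (0 : ℝ), {c : ℝ | ENNReal.ofReal c < F}.indicator 1 c := by
    intro F
    have := rpow_eq_lintegral_indicator one_pos F
    simp only [sub_self, Real.rpow_zero, mul_one, ENNReal.ofReal_one, ENNReal.rpow_one] at this
    exact this
  have hconv : ∀ l : ℤ, Measurable fun x =>
      ‖(dilate l q ⋆[ContinuousLinearMap.lsmul ℝ ℂ, volume] g) x‖ₑ ^ 2 := fun l =>
    (((hasCompactSupport_dilate hq.hasCompactSupport l).continuous_convolution_left _
      (contDiff_dilate l hq.contDiff).continuous hg.locallyIntegrable).enorm.measurable).pow_const 2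
  have hind : ∀ {U : Space d → ℝ≥0∞}, Measurable U → Measurable fun z : Space d × ℝ =>
      {c : ℝ | ENNReal.ofReal c < U z.1}.indicator (1 : ℝ → ℝ≥0∞) z.2 := by
    intro U hU
    have : MeasurableSet {z : Space d × ℝ | ENNReal.ofReal z.2 < U z.1} :=
      measurableSet_lt (by fun_prop) (by fun_prop)
    exact measurable_one.indicator this
  have hswap : ∀ {U u : Space d → ℝ≥0∞}, Measurable U → AEMeasurable u →
      ∫⁻ x, U x * u x = ∫⁻ c in Ioi (0 : ℝ), ∫⁻ x in {x | ENNReal.ofReal c < U x}, u x := by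
    intro U u hU hu
    have h1 : ∀ x, U x * u x =
        ∫⁻ c in Ioi (0 : ℝ), {c : ℝ | ENNReal.ofReal c < U x}.indicator 1 c * u x := by
      intro x
      rw [lintegral_mul_const _ (measurable_one.indicator
        (measurableSet_lt ENNReal.measurable_ofReal measurable_const)), ← hlayer]
    simp_rw [h1]
    rw [lintegral_lintegral_swap ((hind hU).aemeasurable.mul hu.comp_fst)]
    refine lintegral_congr fun c => ?_
    rw [← lintegral_indicator (measurableSet_lt measurable_const hU)]
    refine lintegral_congr fun x => ?_
    by_cases h : ENNReal.ofReal c < U x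
    · simp [indicator, h]
    · simp [indicator, h]
  calc _ = ∑' l : ℤ, ∫⁻ c in Ioi (0 : ℝ), ∫⁻ x in {x | ENNReal.ofReal c < V l x},
          ‖(dilate l q ⋆[ContinuousLinearMap.lsmul ℝ ℂ, volume] g) x‖ₑ ^ 2 :=
        tsum_congr fun l => hswap (hV l) (hconv l).aemeasurable
    _ = ∫⁻ c in Ioi (0 : ℝ), ∑' l : ℤ, ∫⁻ x in {x | ENNReal.ofReal c < V l x},
          ‖(dilate l q ⋆[ContinuousLinearMap.lsmul ℝ ℂ, volume] g) x‖ₑ ^ 2 := by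
        rw [lintegral_tsum]
        intro l
        have hm : Measurable fun z : Space d × ℝ =>
            {c : ℝ | ENNReal.ofReal c < V l z.1}.indicator (1 : ℝ → ℝ≥0∞) z.2 *
            ‖(dilate l q ⋆[ContinuousLinearMap.lsmul ℝ ℂ, volume] g) z.1‖ₑ ^ 2 :=
          (hind (hV l)).mul ((hconv l).comp measurable_fst)
        refine ((hm.lintegral_prod_left' (μ := volume)).aemeasurable).congr (Eventually.of_forall fun c => ?_)
        simp only
        rw [← lintegral_indicator (measurableSet_lt measurable_const (hV l))]
        refine lintegral_congr fun x => ?_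
        by_cases h : ENNReal.ofReal c < V l x
        · simp [indicator, h]
        · simp [indicator, h]
    _ ≤ ∫⁻ c in Ioi (0 : ℝ), C * ∫⁻ x in {x | ENNReal.ofReal c < W x}, ‖g x‖ₑ ^ 2 := by
        refine lintegral_mono fun c => ?_
        have hS : MeasurableSet {x | ENNReal.ofReal c < W x} := measurableSet_lt measurable_const hW
        have h1 := hC H ({x | ENNReal.ofReal c < W x}.indicator g) (hg.indicator hS)
          (hgs.mono (fun x hx => by
            by_contra h
            exact hx (by simp [indicator, Function.notMem_support.1 h])))
        refine le_trans (ENNReal.tsum_le_tsum fun l => ?_) (h1.trans_eq ?_)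
        · refine le_trans (le_of_eq ?_) (setLIntegral_le_lintegral {x | ENNReal.ofReal c < V l x} _)
          refine setLIntegral_congr_fun (measurableSet_lt measurable_const (hV l)) fun x hx => ?_
          have hx : ENNReal.ofReal c < V l x := hx
          simp only [convolution_def]
          congr 2
          refine integral_congr_ae (Eventually.of_forall fun y => ?_)
          simp only
          rcases le_or_gt ‖y‖ (2 ^ l) with hy | hy
          · rw [indicator_of_mem]
            exact hx.trans_le (hVW l x (x - y) (by simpa using hy))
          · rw [dilate_eq_zero hq.eq_zero l (by simpa using hy)]
            simp
        · congr 1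
          rw [← lintegral_indicator hS]
          refine lintegral_congr fun x => ?_
          by_cases h : ENNReal.ofReal c < W x
          · simp [indicator, h]
          · simp [indicator, h]
    _ = _ := by
        rw [lintegral_const_mul' _ _ ENNReal.coe_ne_top,
          hswap hW (hg.aestronglyMeasurable.enorm.pow_const 2)]

/-! ### Dyadic decomposition of the kernel -/

section

variable {d : ℕ}

/-- Multiplication of the Fourier transform by an integrable `v` is convolution with `𝓕⁻ v`; here
`𝓕 g` need not be integrable. -/
theorem fourierInv_smul_fourier {H : Type*} [NormedAddCommGroup H] [InnerProductSpace ℂ H]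
    [CompleteSpace H] {v : Space d → ℂ} {g : Space d → H} (hv : Integrable v) (hg : Integrable g) :
    𝓕⁻ (fun ξ => v ξ • 𝓕 g ξ) = 𝓕⁻ v ⋆[ContinuousLinearMap.lsmul ℝ ℂ, volume] g := by
  funext x
  set w : Space d → ℂ := fun ξ => Real.fourierChar (inner ℝ ξ x) • v ξ with hw
  have hwi : Integrable w := by
    have := (Real.fourierIntegral_convergent_iff (f := v) (-x)).2 hv
    simpa using this
  have h1 := VectorFourier.integral_fourierIntegral_smul_eq_flip (L := innerₗ (Space d))
    (μ := volume) (ν := volume) Real.continuous_fourierChar continuous_inner hwi hg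
  rw [flip_innerₗ] at h1
  have h2 : ∀ y, VectorFourier.fourierIntegral Real.fourierChar volume (innerₗ (Space d)) w y =
      𝓕⁻ v (x - y) := by
    intro y
    rw [Real.fourierInv_eq]
    unfold VectorFourier.fourierIntegral
    congr 1 with ξ
    rw [hw]
    simp only [innerₗ_apply_apply]
    rw [smul_smul, ← AddChar.map_add_eq_mul, inner_sub_right]
    congr 2
    ring
  rw [Real.fourierInv_eq, convolution_eq_swap]
  simp only [ContinuousLinearMap.lsmul_apply]
  simp_rw [h2] at h1
  rw [h1]
  refine integral_congr_ae (Eventually.of_forall fun ξ => ?_)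
  simp only [hw]
  rw [smul_assoc]
  rfl

theorem fourierInv_comp_smul (l : ℤ) (v : Space d → ℂ) :
    𝓕⁻ (fun ξ => v ((2 : ℝ) ^ l • ξ)) = dilate l (𝓕⁻ v) := by
  funext x
  have h2 : (0 : ℝ) < 2 ^ l := by positivity
  have h1 := fourierInv_dilate l (fun ξ => v ((2 : ℝ) ^ l • ξ)) (((2 : ℝ) ^ l)⁻¹ • x)
  rw [smul_inv_smul₀ h2.ne'] at h1
  rw [← h1]
  have h3 : dilate l (fun ξ => v ((2 : ℝ) ^ l • ξ)) = fun ξ => (((2 : ℝ) ^ l)⁻¹ ^ d : ℝ) • v ξ := by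
    funext ξ
    simp only [dilate, smul_inv_smul₀ h2.ne']
  rw [h3, dilate, Real.fourierInv_eq, Real.fourierInv_eq, ← integral_smul]
  refine integral_congr_ae (Eventually.of_forall fun ξ => ?_)
  simp only
  rw [smul_comm]

/-- A smooth cutoff equal to `1` on the unit ball and to `0` off the ball of radius `2`. -/
noncomputable def cutoff (d : ℕ) : ContDiffBump (0 : Space d) := ⟨1, 2, one_pos, one_lt_two⟩

/-- The difference of two cutoffs, supported in the annulus `1/2 ≤ |ξ| ≤ 2`; its dyadic dilates
sum to `1` away from the origin. -/
noncomputable def annulus (ξ : Space d) : ℝ := cutoff d ξ - cutoff d ((2 : ℝ) • ξ)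

theorem contDiff_annulus : ContDiff ℝ ∞ (annulus : Space d → ℝ) :=
  (cutoff d).contDiff.sub ((cutoff d).contDiff.comp (contDiff_const_smul _))

theorem annulus_eq_zero_of_lt {ξ : Space d} (h : ‖ξ‖ ≤ 1 / 2) : annulus ξ = 0 := by
  have h1 : cutoff d ξ = 1 := (cutoff d).one_of_mem_closedBall
    (by rw [mem_closedBall_zero_iff]; exact h.trans (by norm_num [cutoff]))
  have h2 : cutoff d ((2 : ℝ) • ξ) = 1 := (cutoff d).one_of_mem_closedBall
    (by
      rw [mem_closedBall_zero_iff, norm_smul, Real.norm_of_nonneg zero_le_two]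
      have : (cutoff d).rIn = 1 := rfl
      linarith)
  rw [annulus, h1, h2, sub_self]

theorem annulus_eq_zero_of_gt {ξ : Space d} (h : 2 ≤ ‖ξ‖) : annulus ξ = 0 := by
  have hr : (cutoff d).rOut = 2 := rfl
  have h1 : cutoff d ξ = 0 := (cutoff d).zero_of_le_dist (by rw [dist_zero_right, hr]; exact h)
  have h2 : cutoff d ((2 : ℝ) • ξ) = 0 := (cutoff d).zero_of_le_dist
    (by
      rw [dist_zero_right, hr, norm_smul, Real.norm_of_nonneg zero_le_two]
      linarith)
  rw [annulus, h1, h2, sub_self]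

/-- The dyadic sum telescopes. -/
theorem sum_annulus (L : ℕ) (ξ : Space d) :
    ∑ l ∈ Finset.Ico (-(L : ℤ)) L, annulus ((2 : ℝ) ^ l • ξ) =
      cutoff d ((2 : ℝ) ^ (-(L : ℤ)) • ξ) - cutoff d ((2 : ℝ) ^ (L : ℤ) • ξ) := by
  induction L with
  | zero => simp
  | succ L ih =>
    have hI : Finset.Ico (-((L + 1 : ℕ) : ℤ)) ((L + 1 : ℕ) : ℤ) =
        insert (-((L + 1 : ℕ) : ℤ)) (insert (L : ℤ) (Finset.Ico (-(L : ℤ)) L)) := by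
      ext j
      simp only [Finset.mem_Ico, Finset.mem_insert]
      push_cast
      omega
    have ha : ∀ l : ℤ, annulus ((2 : ℝ) ^ l • ξ) =
        cutoff d ((2 : ℝ) ^ l • ξ) - cutoff d ((2 : ℝ) ^ (l + 1) • ξ) := fun l => by
      rw [annulus, smul_smul, zpow_add₀ two_ne_zero, zpow_one, mul_comm]
    rw [hI, Finset.sum_insert, Finset.sum_insert, ih, ha, ha]
    · have : -((L + 1 : ℕ) : ℤ) + 1 = -(L : ℤ) := by push_cast; ring
      rw [this]
      push_cast
      ring
    · simp
    · simp only [Finset.mem_insert, Finset.mem_Ico]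
      push_cast
      omega

theorem abs_sum_annulus_le (L : ℕ) (ξ : Space d) :
    |∑ l ∈ Finset.Ico (-(L : ℤ)) L, annulus ((2 : ℝ) ^ l • ξ)| ≤ 1 := by
  rw [sum_annulus, abs_le]
  constructor
  · have h1 := (cutoff d).nonneg (x := (2 : ℝ) ^ (-(L : ℤ)) • ξ)
    have h2 := (cutoff d).le_one (x := (2 : ℝ) ^ (L : ℤ) • ξ)
    linarith
  · have h1 := (cutoff d).le_one (x := (2 : ℝ) ^ (-(L : ℤ)) • ξ)
    have h2 := (cutoff d).nonneg (x := (2 : ℝ) ^ (L : ℤ) • ξ)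
    linarith

theorem tendsto_sum_annulus {ξ : Space d} (hξ : ξ ≠ 0) :
    Tendsto (fun L : ℕ => ∑ l ∈ Finset.Ico (-(L : ℤ)) L, annulus ((2 : ℝ) ^ l • ξ)) atTop
      (𝓝 1) := by
  have hξ : 0 < ‖ξ‖ := norm_pos_iff.2 hξ
  refine tendsto_const_nhds.congr' ?_
  have hp : Tendsto (fun L : ℕ => (2 : ℝ) ^ L) atTop atTop :=
    tendsto_pow_atTop_atTop_of_one_lt one_lt_two
  filter_upwards [hp.eventually_ge_atTop ‖ξ‖, hp.eventually_ge_atTop (2 / ‖ξ‖)] with L h1 h2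
  rw [sum_annulus, (cutoff d).one_of_mem_closedBall, (cutoff d).zero_of_le_dist, sub_zero]
  · have hr : (cutoff d).rOut = 2 := rfl
    rw [dist_zero_right, hr, norm_smul, Real.norm_of_nonneg (by positivity), zpow_natCast]
    rwa [div_le_iff₀ hξ] at h2
  · have hr : (cutoff d).rIn = 1 := rfl
    rw [mem_closedBall_zero_iff, hr, norm_smul, Real.norm_of_nonneg (by positivity), zpow_neg,
      zpow_natCast, ← div_eq_inv_mul, div_le_one (by positivity)]
    exact h1

/-- The multiplier `|ξ|^m χ(ξ) / 𝓕 q(ξ)` on the annulus, dual to the wavelet `q`. -/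
noncomputable def dualCutoff (m : ℕ) (q : Space d → ℂ) (ξ : Space d) : ℂ :=
  ((‖ξ‖ ^ m * annulus ξ : ℝ) : ℂ) / 𝓕 q ξ

theorem dualCutoff_eq_zero {m : ℕ} {q : Space d → ℂ} {ξ : Space d} (h : ¬(1 / 2 < ‖ξ‖ ∧ ‖ξ‖ < 2)) :
    dualCutoff m q ξ = 0 := by
  have : annulus ξ = 0 := by
    rcases le_or_gt ‖ξ‖ (1 / 2) with h1 | h1
    · exact annulus_eq_zero_of_lt h1
    · exact annulus_eq_zero_of_gt (not_lt.1 fun h2 => h ⟨h1, h2⟩)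
  rw [dualCutoff, this]
  simp

theorem tsupport_dualCutoff_subset (m : ℕ) (q : Space d → ℂ) :
    tsupport (dualCutoff m q) ⊆ {ξ | 1 / 2 ≤ ‖ξ‖ ∧ ‖ξ‖ ≤ 2} := by
  refine closure_minimal (fun ξ hξ => ?_) ?_
  · by_contra h
    exact hξ (dualCutoff_eq_zero fun h' => h ⟨h'.1.le, h'.2.le⟩)
  · exact (isClosed_le continuous_const continuous_norm).inter
      (isClosed_le continuous_norm continuous_const)

theorem hasCompactSupport_dualCutoff (m : ℕ) (q : Space d → ℂ) :
    HasCompactSupport (dualCutoff m q) :=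
  (isCompact_closedBall (0 : Space d) 2).of_isClosed_subset (isClosed_tsupport _) fun ξ hξ => by
    rw [mem_closedBall_zero_iff]
    exact (tsupport_dualCutoff_subset m q hξ).2

/-- Near the support of the cutoff, `|ξ|^m` is smooth and `𝓕 q` does not vanish. -/
theorem IsWavelet.contDiff_dualCutoff {q : Space d → ℂ} (hq : IsWavelet q) (m : ℕ) :
    ContDiff ℝ ∞ (dualCutoff m q) := by
  rw [contDiff_iff_contDiffAt]
  intro ξ
  by_cases h : ξ ∈ tsupport (dualCutoff m q)
  · obtain ⟨h1, h2⟩ := tsupport_dualCutoff_subset m q h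
    have h0 : 0 < ‖ξ‖ := by linarith
    have hnum : ContDiffAt ℝ ∞ (fun ξ : Space d => ‖ξ‖ ^ m * annulus ξ) ξ :=
      ((contDiffAt_norm ℝ (norm_pos_iff.1 h0)).pow m).mul contDiff_annulus.contDiffAt
    have hnum' : ContDiffAt ℝ ∞ (fun ξ : Space d => ((‖ξ‖ ^ m * annulus ξ : ℝ) : ℂ)) ξ :=
      Complex.ofRealCLM.contDiff.contDiffAt.comp ξ hnum
    unfold dualCutoff
    simp_rw [div_eq_mul_inv]
    exact hnum'.mul (hq.contDiff_fourier.contDiffAt.inv (hq.fourier_ne_zero ξ h0 h2))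
  · have : dualCutoff m q =ᶠ[𝓝 ξ] fun _ => 0 := notMem_tsupport_iff_eventuallyEq.1 h
    exact contDiffAt_const.congr_of_eventuallyEq this

theorem IsWavelet.dualCutoff_mul_fourier {q : Space d → ℂ} (hq : IsWavelet q) (m : ℕ) (ξ : Space d) :
    dualCutoff m q ξ * 𝓕 q ξ = ((‖ξ‖ ^ m * annulus ξ : ℝ) : ℂ) := by
  by_cases h : 1 / 2 < ‖ξ‖ ∧ ‖ξ‖ < 2
  · rw [dualCutoff, div_mul_cancel₀]
    exact hq.fourier_ne_zero ξ (by linarith [h.1]) h.2.le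
  · have : annulus ξ = 0 := by
      rcases le_or_gt ‖ξ‖ (1 / 2) with h1 | h1
      · exact annulus_eq_zero_of_lt h1
      · exact annulus_eq_zero_of_gt (not_lt.1 fun h2 => h ⟨h1, h2⟩)
    rw [dualCutoff_eq_zero h, this]
    simp

/-- The kernel with symbol `|ξ|^m exp (-P(ξ))`, `P = polyForm m c`, in the normalisation
`𝓕 f(ξ) = ∫ exp (-2πi x·ξ) f(x) dx`. -/
noncomputable def opKernel (m : ℕ) (c : (Fin d → ℕ) → (Fin d → ℕ) → ℂ) : Space d → ℂ :=
  𝓕⁻ fun ξ : Space d => ((‖ξ‖ ^ m : ℝ) : ℂ) * Complex.exp (-polyForm m c ξ)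

/-- The part of the symbol at frequencies `|ξ| ∼ 2^{-l}`, divided by `𝓕 (dilate l q)`. -/
noncomputable def pieceSymbol (m : ℕ) (q : Space d → ℂ) (c : (Fin d → ℕ) → (Fin d → ℕ) → ℂ) (l : ℤ)
    (ξ : Space d) : ℂ :=
  ((((2 : ℝ) ^ l)⁻¹ ^ m : ℝ) : ℂ) *
    (dualCutoff m q ((2 : ℝ) ^ l • ξ) * Complex.exp (-polyForm m c ξ))

theorem IsWavelet.pieceSymbol_mul_fourier {q : Space d → ℂ} (hq : IsWavelet q) (m : ℕ)
    (c : (Fin d → ℕ) → (Fin d → ℕ) → ℂ) (l : ℤ) (ξ : Space d) :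
    pieceSymbol m q c l ξ * 𝓕 (dilate l q) ξ =
      ((annulus ((2 : ℝ) ^ l • ξ) : ℝ) : ℂ) *
        (((‖ξ‖ ^ m : ℝ) : ℂ) * Complex.exp (-polyForm m c ξ)) := by
  have h2 : (0 : ℝ) < 2 ^ l := by positivity
  have h1 := hq.dualCutoff_mul_fourier m ((2 : ℝ) ^ l • ξ)
  rw [norm_smul, Real.norm_of_nonneg h2.le] at h1
  have h3 : ((((2 : ℝ) ^ l)⁻¹ ^ m : ℝ) : ℂ) * (((2 ^ l * ‖ξ‖) ^ m : ℝ) : ℂ) = ((‖ξ‖ ^ m : ℝ) : ℂ) := by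
    rw [← Complex.ofReal_mul, ← mul_pow, inv_mul_cancel_left₀ h2.ne']
  rw [fourier_dilate, pieceSymbol, ← h3]
  push_cast at h1 ⊢
  linear_combination (((2 : ℂ) ^ l)⁻¹ ^ m * Complex.exp (-polyForm m c ξ)) * h1

theorem IsWavelet.continuous_pieceSymbol {q : Space d → ℂ} (hq : IsWavelet q) (m : ℕ)
    (c : (Fin d → ℕ) → (Fin d → ℕ) → ℂ) (l : ℤ) : Continuous (pieceSymbol m q c l) := by
  unfold pieceSymbol
  exact continuous_const.mul (((hq.contDiff_dualCutoff m).continuous.comp (continuous_const_smul _)).mul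
    (Complex.continuous_exp.comp (contDiff_polyForm m c).continuous.neg))

theorem IsWavelet.integrable_pieceSymbol {q : Space d → ℂ} (hq : IsWavelet q) (m : ℕ)
    (c : (Fin d → ℕ) → (Fin d → ℕ) → ℂ) (l : ℤ) : Integrable (pieceSymbol m q c l) := by
  refine (hq.continuous_pieceSymbol m c l).integrable_of_hasCompactSupport ?_
  unfold pieceSymbol
  refine HasCompactSupport.mul_left (HasCompactSupport.mul_right ?_)
  exact (hasCompactSupport_dualCutoff m q).comp_smul (by positivity)

/-- Size of the inverse Fourier transform of a dyadic piece, for a form of size `ρ`. -/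
theorem IsWavelet.exists_norm_fourierInv_pieceSymbol_le {q : Space d → ℂ} (hq : IsWavelet q) (m : ℕ)
    {ν K : ℝ} (hν : 0 < ν) (hK : 0 ≤ K) :
    ∃ C : ℝ, 0 ≤ C ∧ ∀ (ρ : ℝ) (c : (Fin d → ℕ) → (Fin d → ℕ) → ℂ), 0 ≤ ρ →
      IsEllipticForm m ν K ρ c → ∀ (l : ℤ) z,
      ‖𝓕⁻ (pieceSymbol m q c l) z‖ ≤
        C * ((((2 : ℝ) ^ l)⁻¹ ^ m) * (1 + ((2 : ℝ) ^ l)⁻¹ ^ (2 * m) * ρ)⁻¹) * bump l z := by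
  obtain ⟨C, hC, h⟩ := exists_norm_fourierInv_cutoff_le m hν hK (hq.contDiff_dualCutoff m)
    (hasCompactSupport_dualCutoff m q) (ε := 1 / 2) (by norm_num)
    (fun ξ hξ => (tsupport_dualCutoff_subset m q hξ).1)
  refine ⟨C, hC, fun ρ c hρ hc l z => ?_⟩
  have h2 : (0 : ℝ) < 2 ^ l := by positivity
  set c' : (Fin d → ℕ) → (Fin d → ℕ) → ℂ :=
    fun α β => ((((2 : ℝ) ^ l)⁻¹ ^ (2 * m) : ℝ) : ℂ) * c α β with hc'
  have hce := hc.smul (s := ((2 : ℝ) ^ l)⁻¹ ^ (2 * m)) (by positivity)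
  have h3 := h _ c' (by positivity) hce (((2 : ℝ) ^ l)⁻¹ • z)
  have h4 : pieceSymbol m q c l = fun ξ => ((((2 : ℝ) ^ l)⁻¹ ^ m : ℝ) : ℂ) •
      (fun ξ => dualCutoff m q ξ * Complex.exp (-polyForm m c' ξ)) ((2 : ℝ) ^ l • ξ) := by
    funext ξ
    rw [pieceSymbol, hc', smul_eq_mul]
    simp only
    rw [← polyForm_smul, inv_smul_smul₀ h2.ne']
  have h5 : 𝓕⁻ (pieceSymbol m q c l) z = ((((2 : ℝ) ^ l)⁻¹ ^ m : ℝ) : ℂ) •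
      dilate l (𝓕⁻ fun ξ => dualCutoff m q ξ * Complex.exp (-polyForm m c' ξ)) z := by
    rw [← fourierInv_comp_smul, h4, Real.fourierInv_eq, Real.fourierInv_eq, ← integral_smul]
    refine integral_congr_ae (Eventually.of_forall fun ξ => ?_)
    simp only
    rw [smul_comm]
  rw [h5, dilate, norm_smul, norm_smul, Complex.norm_real, Real.norm_of_nonneg (by positivity),
    Real.norm_of_nonneg (by positivity), bump]
  simp only [finrank_euclideanSpace, Fintype.card_fin]
  rw [norm_smul, norm_inv, Real.norm_of_nonneg h2.le, ← div_eq_inv_mul] at h3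
  calc _ ≤ ((2 : ℝ) ^ l)⁻¹ ^ m * (((2 : ℝ) ^ l)⁻¹ ^ d * (C * (1 + ((2 : ℝ) ^ l)⁻¹ ^ (2 * m) * ρ)⁻¹ *
        ((1 + ‖z‖ / 2 ^ l)⁻¹) ^ (d + 1))) := by gcongr
    _ = _ := by ring

/-- The kernel applied to `g` is dominated by the sum of its dyadic pieces applied to the wavelet
components of `g`. -/
theorem IsWavelet.enorm_opKernel_convolution_le {q : Space d → ℂ} (hq : IsWavelet q) {m : ℕ}
    (hm : 1 ≤ m) {ν K ρ : ℝ} (hν : 0 < ν) (hρ : 0 < ρ)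
    {c : (Fin d → ℕ) → (Fin d → ℕ) → ℂ} (hc : IsEllipticForm m ν K ρ c)
    {H : Type*} [NormedAddCommGroup H] [InnerProductSpace ℂ H] [CompleteSpace H] {g : Space d → H}
    (hg : Integrable g) (x : Space d) :
    ‖(opKernel m c ⋆[ContinuousLinearMap.lsmul ℝ ℂ, volume] g) x‖ₑ ≤
      ∑' l : ℤ, ‖(𝓕⁻ (pieceSymbol m q c l) ⋆[ContinuousLinearMap.lsmul ℝ ℂ, volume]
        (dilate l q ⋆[ContinuousLinearMap.lsmul ℝ ℂ, volume] g)) x‖ₑ := by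
  set M : Space d → ℂ := fun ξ => ((‖ξ‖ ^ m : ℝ) : ℂ) * Complex.exp (-polyForm m c ξ) with hM
  have hMi : Integrable M := hc.integrable_pow_mul_cexp hm hν hρ m
  have hgc : Continuous (𝓕 g) := VectorFourier.fourierIntegral_continuous
    Real.continuous_fourierChar (innerSL ℝ).continuous₂ hg
  have hgb : ∀ ξ, ‖𝓕 g ξ‖ ≤ ∫ x, ‖g x‖ := fun ξ =>
    VectorFourier.norm_fourierIntegral_le_integral_norm _ _ _ _ _
  have hMg : Integrable fun ξ => M ξ • 𝓕 g ξ := by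
    refine (hMi.norm.mul_const (∫ x, ‖g x‖)).mono'
      (hMi.aestronglyMeasurable.smul hgc.aestronglyMeasurable) (Eventually.of_forall fun ξ => ?_)
    rw [norm_smul]
    exact mul_le_mul_of_nonneg_left (hgb ξ) (norm_nonneg _)
  have hdi : ∀ l, Integrable (dilate l q) := fun l =>
    (contDiff_dilate l hq.contDiff).continuous.integrable_of_hasCompactSupport
      (hasCompactSupport_dilate hq.hasCompactSupport l)
  have hpiece : ∀ l : ℤ, (𝓕⁻ (pieceSymbol m q c l) ⋆[ContinuousLinearMap.lsmul ℝ ℂ, volume]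
      (dilate l q ⋆[ContinuousLinearMap.lsmul ℝ ℂ, volume] g)) x =
      𝓕⁻ (fun ξ => (annulus ((2 : ℝ) ^ l • ξ) : ℝ) • (M ξ • 𝓕 g ξ)) x := by
    intro l
    rw [← fourierInv_smul_fourier (hq.integrable_pieceSymbol m c l)
      ((hdi l).integrable_convolution _ hg)]
    refine congrFun (congrArg _ (funext fun ξ => ?_)) x
    rw [fourier_lsmul_convolution (hdi l) hg, smul_smul, hq.pieceSymbol_mul_fourier, ← smul_smul,
      Complex.coe_smul]
  have hint : ∀ l : ℤ, Integrable fun ξ =>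
      Real.fourierChar (inner ℝ ξ x) • ((annulus ((2 : ℝ) ^ l • ξ) : ℝ) • (M ξ • 𝓕 g ξ)) := by
    intro l
    have hc1 : Continuous fun ξ : Space d => annulus ((2 : ℝ) ^ l • ξ) :=
      contDiff_annulus.continuous.comp (continuous_const_smul _)
    have h1 : Integrable fun ξ => (annulus ((2 : ℝ) ^ l • ξ) : ℝ) • (M ξ • 𝓕 g ξ) := by
      refine hMg.norm.mono' (hc1.aestronglyMeasurable.smul hMg.aestronglyMeasurable)
        (Eventually.of_forall fun ξ => ?_)
      rw [norm_smul]
      refine mul_le_of_le_one_left (norm_nonneg _) ?_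
      rw [Real.norm_eq_abs, annulus, abs_le]
      have a1 := (cutoff d).nonneg (x := (2 : ℝ) ^ l • ξ)
      have a2 := (cutoff d).le_one (x := (2 : ℝ) ^ l • ξ)
      have a3 := (cutoff d).nonneg (x := (2 : ℝ) • (2 : ℝ) ^ l • ξ)
      have a4 := (cutoff d).le_one (x := (2 : ℝ) • (2 : ℝ) ^ l • ξ)
      constructor <;> linarith
    have := (Real.fourierIntegral_convergent_iff (-x)).2 h1
    simpa using this
  have hlim : Tendsto (fun L : ℕ => ∑ l ∈ Finset.Ico (-(L : ℤ)) L,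
      𝓕⁻ (fun ξ => (annulus ((2 : ℝ) ^ l • ξ) : ℝ) • (M ξ • 𝓕 g ξ)) x) atTop
      (𝓝 (𝓕⁻ (fun ξ => M ξ • 𝓕 g ξ) x)) := by
    have h1 : ∀ L : ℕ, ∑ l ∈ Finset.Ico (-(L : ℤ)) L,
        𝓕⁻ (fun ξ => (annulus ((2 : ℝ) ^ l • ξ) : ℝ) • (M ξ • 𝓕 g ξ)) x =
        ∫ ξ, (∑ l ∈ Finset.Ico (-(L : ℤ)) L, annulus ((2 : ℝ) ^ l • ξ)) •
          (Real.fourierChar (inner ℝ ξ x) • (M ξ • 𝓕 g ξ)) := by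
      intro L
      simp_rw [Real.fourierInv_eq]
      rw [← integral_finsetSum _ fun l _ => hint l]
      refine integral_congr_ae (Eventually.of_forall fun ξ => ?_)
      simp only
      rw [Finset.sum_smul]
      refine Finset.sum_congr rfl fun l _ => ?_
      rw [smul_comm]
    simp_rw [h1]
    rw [Real.fourierInv_eq]
    refine tendsto_integral_of_dominated_convergence (fun ξ => ‖M ξ • 𝓕 g ξ‖) (fun L => ?_)
      hMg.norm (fun L => Eventually.of_forall fun ξ => ?_) ?_
    · have h2 : Continuous fun ξ : Space d => ∑ l ∈ Finset.Ico (-(L : ℤ)) L, annulus ((2 : ℝ) ^ l • ξ) :=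
        continuous_finsetSum _ fun l _ => contDiff_annulus.continuous.comp (continuous_const_smul _)
      have h3 : Integrable fun ξ => Real.fourierChar (inner ℝ ξ x) • (M ξ • 𝓕 g ξ) := by
        have := (Real.fourierIntegral_convergent_iff (-x)).2 hMg
        simpa using this
      exact h2.aestronglyMeasurable.smul h3.aestronglyMeasurable
    · rw [norm_smul, Circle.norm_smul]
      exact mul_le_of_le_one_left (norm_nonneg _) (abs_sum_annulus_le L ξ)
    · rcases Nat.eq_zero_or_pos d with rfl | hd
      · -- in dimension `0` the symbol vanishes, since `m ≥ 1`
        refine Eventually.of_forall fun ξ => ?_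
        have : ξ = 0 := Subsingleton.elim _ _
        have hM0 : M ξ = 0 := by rw [hM, this]; simp [show m ≠ 0 by omega]
        simp [hM0]
      · have : NeZero d := ⟨by omega⟩
        filter_upwards [compl_mem_ae_iff.2 (measure_singleton (μ := volume) (0 : Space d))] with ξ hξ
        have := (tendsto_sum_annulus (d := d) hξ).smul_const
          (Real.fourierChar (inner ℝ ξ x) • (M ξ • 𝓕 g ξ))
        simpa using this
  have hconv : (opKernel m c ⋆[ContinuousLinearMap.lsmul ℝ ℂ, volume] g) x =
      𝓕⁻ (fun ξ => M ξ • 𝓕 g ξ) x := by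
    rw [fourierInv_smul_fourier hMi hg]
    rfl
  rw [hconv]
  refine le_of_tendsto hlim.enorm (Eventually.of_forall fun L => ?_)
  refine (enorm_sum_le _ _).trans ?_
  simp_rw [← hpiece]
  exact ENNReal.sum_le_tsum _

end

/-! ### The weighted inequality for a fixed source time -/

theorem geom_neg (j : ℤ) : geom (-j) = geom j := by
  rw [geom, geom, Int.natAbs_neg]

theorem tsum_geom_sub_le' (l : ℤ) : ∑' i, geom (l - i) ≤ 4 := by
  have : ∀ i, geom (l - i) = geom (i - l) := fun i => by rw [← geom_neg, neg_sub]
  simp_rw [this]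
  exact tsum_geom_sub_le l

/-- At time scale `τ ≥ 2^{2mi}` the pieces of the kernel decay geometrically away from the
frequency `2^{-i}`. -/
theorem piece_size_le {m : ℕ} (hm : 1 ≤ m) (l i : ℤ) {τ : ℝ} (hτ : ((2 : ℝ) ^ i) ^ (2 * m) ≤ τ) :
    (((2 : ℝ) ^ l)⁻¹ ^ m) * (1 + ((2 : ℝ) ^ l)⁻¹ ^ (2 * m) * τ)⁻¹ ≤
      ((2 : ℝ) ^ i)⁻¹ ^ m * 2⁻¹ ^ (l - i).natAbs := by
  set a : ℝ := ((2 : ℝ) ^ l)⁻¹ ^ m with ha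
  set b : ℝ := ((2 : ℝ) ^ i) ^ m with hb
  have ha0 : 0 < a := by positivity
  have hb0 : 0 < b := by positivity
  have hab : a * b = (2 : ℝ) ^ ((i - l) * m) := by
    rw [ha, hb, ← mul_pow, ← zpow_natCast, ← zpow_neg, ← zpow_add₀ two_ne_zero, ← zpow_mul]
    congr 1; ring
  -- the extra power `m ≥ 1` of `2 ^ (-|l - i|)` is dropped
  have h1 : min (a * b) (a * b)⁻¹ ≤ 2⁻¹ ^ (l - i).natAbs := by
    rw [hab]
    refine (min_zpow_le_geom _).trans ?_
    refine pow_le_pow_of_le_one (by norm_num) (by norm_num) ?_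
    rw [Int.natAbs_mul, Int.natAbs_natCast, ← Int.natAbs_neg, neg_sub]
    exact Nat.le_mul_of_pos_right _ hm
  have ha2 : ((2 : ℝ) ^ l)⁻¹ ^ (2 * m) = a ^ 2 := by rw [ha, ← pow_mul, mul_comm]
  have hb2 : ((2 : ℝ) ^ i) ^ (2 * m) = b ^ 2 := by rw [hb, ← pow_mul, mul_comm]
  have hb3 : ((2 : ℝ) ^ i)⁻¹ ^ m = b⁻¹ := by rw [hb, inv_pow]
  rw [ha2, hb3]
  rw [hb2] at hτ
  calc a * (1 + a ^ 2 * τ)⁻¹ ≤ a * (1 + a ^ 2 * b ^ 2)⁻¹ := by gcongr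
    _ ≤ b⁻¹ * min (a * b) (a * b)⁻¹ := by
        rw [mul_min_of_nonneg _ _ (by positivity), le_min_iff]
        constructor
        · rw [mul_comm a b, inv_mul_cancel_left₀ hb0.ne']
          refine mul_le_of_le_one_right ha0.le (inv_le_one_of_one_le₀ ?_)
          nlinarith [sq_nonneg (a * b)]
        · calc a * (1 + a ^ 2 * b ^ 2)⁻¹ ≤ a * (a ^ 2 * b ^ 2)⁻¹ := by
                gcongr
                linarith
            _ = _ := by field_simp
    _ ≤ _ := by gcongr

section

variable {d : ℕ}

theorem bump_sub_comm (l : ℤ) (x y : Space d) : bump l (x - y) = bump l (y - x) := by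
  rw [bump, bump, norm_sub_rev]

/-- Pointwise bound of the kernel applied to `g` by the wavelet components of `g`. -/
theorem IsWavelet.exists_enorm_opKernel_convolution_sq_le {q : Space d → ℂ} (hq : IsWavelet q) {m : ℕ}
    (hm : 1 ≤ m) {ν K : ℝ} (hν : 0 < ν) (hK : 0 ≤ K) :
    ∃ C : ℝ≥0, ∀ (H : Type u) [NormedAddCommGroup H] [InnerProductSpace ℂ H] [CompleteSpace H]
      (g : Space d → H), Integrable g → ∀ (i : ℤ) (τ : ℝ) (c : (Fin d → ℕ) → (Fin d → ℕ) → ℂ),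
      ((2 : ℝ) ^ i) ^ (2 * m) ≤ τ → IsEllipticForm m ν K τ c → ∀ x,
      ‖(opKernel m c ⋆[ContinuousLinearMap.lsmul ℝ ℂ, volume] g) x‖ₑ ^ 2 ≤
        C * ENNReal.ofReal (((2 : ℝ) ^ i) ^ (2 * m))⁻¹ * ∑' l : ℤ, geom (l - i) *
          ∫⁻ y, ENNReal.ofReal (bump l (x - y)) *
            ‖(dilate l q ⋆[ContinuousLinearMap.lsmul ℝ ℂ, volume] g) y‖ₑ ^ 2 := by
  obtain ⟨C, hC, hbd⟩ := hq.exists_norm_fourierInv_pieceSymbol_le m hν hK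
  set B : ℝ≥0∞ := ENNReal.ofReal (2 ^ (finrank ℝ (Space d) + 2)) *
    volume (closedBall (0 : Space d) 1) with hB
  have hBt : B ≠ ⊤ := ENNReal.mul_ne_top ENNReal.ofReal_ne_top
    (isCompact_closedBall (0 : Space d) 1).measure_lt_top.ne
  refine ⟨(ENNReal.ofReal (C ^ 2) * (4 * B)).toNNReal, ?_⟩
  intro H _ _ _ g hg i τ c hτ hc x
  rw [ENNReal.coe_toNNReal (by finiteness)]
  have hτ0 : 0 < τ := lt_of_lt_of_le (by positivity) hτ
  set w : ℤ → Space d → H := fun l => dilate l q ⋆[ContinuousLinearMap.lsmul ℝ ℂ, volume] g with hw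
  have hwm : ∀ l, Continuous (w l) := fun l =>
    (hasCompactSupport_dilate hq.hasCompactSupport l).continuous_convolution_left _
      (contDiff_dilate l hq.contDiff).continuous hg.locallyIntegrable
  set b : ℤ → Space d → ℝ≥0∞ := fun l y => ENNReal.ofReal (bump l (x - y)) with hb
  have hbm : ∀ l, Measurable (b l) := fun l =>
    ((continuous_bump l).measurable.comp (measurable_const.sub measurable_id)).ennreal_ofReal
  set A : ℝ := C * ((2 : ℝ) ^ i)⁻¹ ^ m with hA
  have hA0 : 0 ≤ A := by positivity
  have h1 : ∀ l, ‖(𝓕⁻ (pieceSymbol m q c l) ⋆[ContinuousLinearMap.lsmul ℝ ℂ, volume] w l) x‖ₑ ≤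
      ENNReal.ofReal A * (geom (l - i) * ∫⁻ y, b l y * ‖w l y‖ₑ) := by
    intro l
    rw [convolution_eq_swap]
    refine (enorm_integral_le_lintegral_enorm _).trans ?_
    have e1 := lintegral_const_mul (μ := volume) (ENNReal.ofReal A * geom (l - i))
      (f := fun y => b l y * ‖w l y‖ₑ) ((hbm l).mul (hwm l).enorm.measurable)
    rw [← mul_assoc, ← e1]
    refine lintegral_mono fun y => ?_
    simp only [ContinuousLinearMap.lsmul_apply]
    rw [enorm_smul, ← mul_assoc]
    refine mul_le_mul_left ?_ _
    rw [geom_eq_ofReal, ← ENNReal.ofReal_mul hA0, ← ENNReal.ofReal_mul (by positivity),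
      ← ofReal_norm]
    refine ENNReal.ofReal_le_ofReal ((hbd τ c hτ0.le hc l (x - y)).trans ?_)
    refine mul_le_mul_of_nonneg_right ?_ (bump_nonneg l _)
    rw [hA, mul_assoc]
    exact mul_le_mul_of_nonneg_left (piece_size_le hm l i hτ) hC
  have h2 : ∀ l, (∫⁻ y, b l y * ‖w l y‖ₑ) ^ 2 ≤ B * ∫⁻ y, b l y * ‖w l y‖ₑ ^ 2 := by
    intro l
    refine (sq_lintegral_mul_le (hbm l).aemeasurable (hwm l).enorm.measurable.aemeasurable).trans ?_
    refine mul_le_mul_left ?_ _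
    simp only [hb]
    simp_rw [bump_sub_comm l x]
    exact lintegral_bump_le l x
  calc _ ≤ (∑' l, ENNReal.ofReal A * (geom (l - i) * ∫⁻ y, b l y * ‖w l y‖ₑ)) ^ 2 := by
        gcongr
        exact (hq.enorm_opKernel_convolution_le hm hν hτ0 hc hg x).trans (ENNReal.tsum_le_tsum h1)
    _ = ENNReal.ofReal A ^ 2 * (∑' l, geom (l - i) * ∫⁻ y, b l y * ‖w l y‖ₑ) ^ 2 := by
        rw [ENNReal.tsum_mul_left, mul_pow]
    _ ≤ ENNReal.ofReal A ^ 2 * ((∑' l, geom (l - i)) *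
          ∑' l, geom (l - i) * (∫⁻ y, b l y * ‖w l y‖ₑ) ^ 2) := by
        gcongr
        exact sq_tsum_mul_le _ _
    _ ≤ ENNReal.ofReal A ^ 2 * (4 *
          ∑' l, geom (l - i) * (B * ∫⁻ y, b l y * ‖w l y‖ₑ ^ 2)) := by
        refine mul_le_mul_right (mul_le_mul' (tsum_geom_sub_le i)
          (ENNReal.tsum_le_tsum fun l => mul_le_mul_right (h2 l) _)) _
    _ = _ := by
        simp_rw [← mul_assoc _ B, mul_comm _ B, mul_assoc B]
        rw [ENNReal.tsum_mul_left, ← ENNReal.ofReal_pow hA0]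
        have : A ^ 2 = C ^ 2 * (((2 : ℝ) ^ i) ^ (2 * m))⁻¹ := by
          rw [hA, mul_pow, ← pow_mul, mul_comm m 2, inv_pow]
        rw [this, ENNReal.ofReal_mul (by positivity)]
        ring

/-- The maximal function in the space variable of a weight on `ℝ × ℝ^d`. -/
noncomputable def spatialMaximal (h : ℝ × Space d → ℝ≥0∞) (z : ℝ × Space d) : ℝ≥0∞ :=
  maximalFunction (fun x => h (z.1, x)) z.2

/-- The maximal function in time of the maximal function in space. -/
noncomputable def iteratedMaximal (h : ℝ × Space d → ℝ≥0∞) (z : ℝ × Space d) : ℝ≥0∞ :=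
  maximalFunction (fun t => spatialMaximal h (t, z.2)) z.1

theorem measurable_spatialMaximal {h : ℝ × Space d → ℝ≥0∞} (hh : Measurable h) :
    Measurable (spatialMaximal h) :=
  measurable_maximalFunction (h := fun t x => h (t, x)) hh

theorem measurable_iteratedMaximal {h : ℝ × Space d → ℝ≥0∞} (hh : Measurable h) :
    Measurable (iteratedMaximal h) := by
  have h0 : Measurable (Function.uncurry fun (y : Space d) (t : ℝ) => spatialMaximal h (t, y)) :=
    (measurable_spatialMaximal hh).comp measurable_swap
  have h1 : Measurable fun z : Space d × ℝ =>
      maximalFunction (fun t => spatialMaximal h (t, z.1)) z.2 := measurable_maximalFunction h0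
  have h2 : Measurable fun z : ℝ × Space d => (z.2, z.1) := measurable_snd.prodMk measurable_fst
  have h3 := h1.comp h2
  unfold iteratedMaximal
  exact h3

/-- The average of a weight over the times `s + τ`, `2^{2mi} < τ ≤ 2^{2m(i+1)}`, and over a bump of
width `2^l` in space is controlled by the iterated maximal function. -/
theorem lintegral_lintegral_bump_mul_le {h : ℝ × Space d → ℝ≥0∞} (hh : Measurable h) (s : ℝ) (m : ℕ)
    (i l : ℤ) {y y' : Space d} (hy : ‖y - y'‖ ≤ 2 ^ l) :
    ∫⁻ τ in Ioc (((2 : ℝ) ^ i) ^ (2 * m)) (((2 : ℝ) ^ (i + 1)) ^ (2 * m)),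
        ∫⁻ x, ENNReal.ofReal (bump l (x - y)) * h (s + τ, x) ≤
      ENNReal.ofReal (2 ^ (finrank ℝ (Space d) + 1)) * (ENNReal.ofReal (2 ^ (finrank ℝ (Space d) + 2)) *
        volume (closedBall (0 : Space d) 1)) *
        ENNReal.ofReal (2 * ((2 : ℝ) ^ (i + 1)) ^ (2 * m)) * iteratedMaximal h (s, y') := by
  set B : ℝ≥0∞ := ENNReal.ofReal (2 ^ (finrank ℝ (Space d) + 2)) *
    volume (closedBall (0 : Space d) 1) with hB
  set D : ℝ≥0∞ := ENNReal.ofReal (2 ^ (finrank ℝ (Space d) + 1)) with hD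
  set M : ℝ → ℝ≥0∞ := fun t => spatialMaximal h (t, y') with hM
  have hMm : Measurable M := (measurable_spatialMaximal hh).comp measurable_prodMk_right
  have h1 : ∀ τ, ∫⁻ x, ENNReal.ofReal (bump l (x - y)) * h (s + τ, x) ≤ D * (B * M (s + τ)) := by
    intro τ
    have hm : Measurable fun x => h (s + τ, x) := hh.comp measurable_prodMk_left
    refine le_trans ?_ (mul_le_mul_right (lintegral_bump_mul_le hm l y') D)
    rw [← lintegral_const_mul' _ _ ENNReal.ofReal_ne_top]
    refine lintegral_mono fun x => ?_
    simp only
    rw [← mul_assoc, ← ENNReal.ofReal_mul (by positivity)]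
    refine mul_le_mul_left (ENNReal.ofReal_le_ofReal ?_) _
    have := bump_sub_le (x := x) l zero_le_one (by rw [one_mul]; exact hy)
    rwa [one_add_one_eq_two] at this
  set n : ℤ := (i + 1) * (2 * m) with hn
  have hr : ((2 : ℝ) ^ (i + 1)) ^ (2 * m) = 2 ^ n := by
    rw [hn, zpow_mul, ← zpow_natCast]; push_cast; rfl
  rw [hr]
  calc _ ≤ ∫⁻ τ in Ioc (((2 : ℝ) ^ i) ^ (2 * m)) (2 ^ n), D * (B * M (s + τ)) := lintegral_mono h1
    _ ≤ ∫⁻ τ in closedBall 0 (2 ^ n), D * (B * M (s + τ)) := by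
        refine lintegral_mono_set fun τ hτ => ?_
        have : (0 : ℝ) < ((2 : ℝ) ^ i) ^ (2 * m) := by positivity
        rw [mem_closedBall_zero_iff, Real.norm_eq_abs, abs_le]
        exact ⟨by linarith [hτ.1, hτ.2], hτ.2⟩
    _ = D * (B * ∫⁻ t in closedBall s (2 ^ n), M t) := by
        have hms : Measurable fun τ => M (s + τ) := hMm.comp (measurable_const_add s)
        rw [lintegral_const_mul _ (hms.const_mul B), lintegral_const_mul _ hms]
        congr 2
        rw [← lintegral_indicator measurableSet_closedBall,
          ← lintegral_indicator measurableSet_closedBall,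
          ← lintegral_add_left_eq_self ((closedBall s ((2 : ℝ) ^ n)).indicator M) s]
        congr 1 with τ
        have : s + τ ∈ closedBall s ((2 : ℝ) ^ n) ↔ τ ∈ closedBall 0 ((2 : ℝ) ^ n) := by simp
        by_cases h : τ ∈ closedBall 0 ((2 : ℝ) ^ n)
        · rw [indicator_of_mem h, indicator_of_mem (this.2 h)]
        · rw [indicator_of_notMem h, indicator_of_notMem (mt this.1 h)]
    _ ≤ D * (B * (volume (closedBall s ((2 : ℝ) ^ n)) * iteratedMaximal h (s, y'))) := by
        gcongr
        exact lintegral_closedBall_le_maximalFunction M s n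
    _ = _ := by rw [Real.volume_closedBall]; ring

/-- Tonelli's theorem, moving the weight `h` from the outer variables to the inner ones. -/
theorem lintegral_lintegral_mul_lintegral_swap {X : Type*} [MeasureSpace X]
    [SFinite (volume : Measure X)] {b : X × X → ℝ≥0∞} {h : ℝ × X → ℝ≥0∞} {w : X → ℝ≥0∞}
    (μ : Measure ℝ) [SFinite μ] (hb : Measurable b) (hh : Measurable h) (hw : Measurable w)
    (k : ℝ≥0∞) :
    ∫⁻ τ, (∫⁻ x, k * (h (τ, x) * ∫⁻ y, b (x, y) * w y)) ∂μ =
      ∫⁻ y, k * (∫⁻ τ, (∫⁻ x, b (x, y) * h (τ, x)) ∂μ) * w y := by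
  have hb1 : ∀ x, Measurable fun y => b (x, y) := fun x => hb.comp measurable_prodMk_left
  have hb2 : ∀ y, Measurable fun x => b (x, y) := fun y => hb.comp measurable_prodMk_right
  have hh1 : ∀ τ, Measurable fun x => h (τ, x) := fun τ => hh.comp measurable_prodMk_left
  have hq : Measurable fun z : (X × ℝ) × X => b (z.2, z.1.1) * h (z.1.2, z.2) :=
    (hb.comp (measurable_snd.prodMk (measurable_fst.comp measurable_fst))).mul
      (hh.comp ((measurable_snd.comp measurable_fst).prodMk measurable_snd))
  have hq2 : Measurable fun z : X × ℝ => ∫⁻ x, b (x, z.1) * h (z.2, x) :=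
    hq.lintegral_prod_right' (ν := volume)
  have e1 : ∀ τ, ∫⁻ x, k * (h (τ, x) * ∫⁻ y, b (x, y) * w y) =
      ∫⁻ y, k * w y * ∫⁻ x, b (x, y) * h (τ, x) := by
    intro τ
    have e2 : ∀ x, k * (h (τ, x) * ∫⁻ y, b (x, y) * w y) =
        ∫⁻ y, k * (h (τ, x) * (b (x, y) * w y)) := fun x => by
      rw [← lintegral_const_mul (f := fun y => b (x, y) * w y) _ ((hb1 x).mul hw),
        ← lintegral_const_mul (f := fun y => h (τ, x) * (b (x, y) * w y)) _
          (((hb1 x).mul hw).const_mul _)]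
    have e3 : ∀ y, k * w y * ∫⁻ x, b (x, y) * h (τ, x) =
        ∫⁻ x, k * (h (τ, x) * (b (x, y) * w y)) := fun y => by
      rw [← lintegral_const_mul (f := fun x => b (x, y) * h (τ, x)) _ ((hb2 y).mul (hh1 τ))]
      congr 1 with x
      ring
    simp_rw [e2, e3]
    exact lintegral_lintegral_swap ((((hh1 τ).comp measurable_fst).mul
      (hb.mul (hw.comp measurable_snd))).const_mul _).aemeasurable
  simp_rw [e1]
  rw [lintegral_lintegral_swap]
  · refine lintegral_congr fun y => ?_
    have e4 := lintegral_const_mul (μ := μ) (k * w y) (f := fun τ => ∫⁻ x, b (x, y) * h (τ, x))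
      (hq2.comp measurable_prodMk_left)
    rw [e4]
    ring
  · exact (((hw.comp measurable_snd).const_mul k).mul (hq2.comp
      (measurable_swap : Measurable (Prod.swap : ℝ × X → X × ℝ)))).aemeasurable

/-- The weighted inequality for the evolution of a single source `g` issued at time `s`. -/
theorem exists_lintegral_opKernel_weighted_le (d : ℕ) {m : ℕ} (hm : 1 ≤ m) {ν K : ℝ} (hν : 0 < ν)
    (hK : 0 ≤ K) :
    ∃ C : ℝ≥0, ∀ (H : Type u) [NormedAddCommGroup H] [InnerProductSpace ℂ H] [CompleteSpace H]
      (g : Space d → H), Integrable g → HasCompactSupport g →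
      ∀ (c : ℝ → (Fin d → ℕ) → (Fin d → ℕ) → ℂ), (∀ τ, 0 < τ → IsEllipticForm m ν K τ (c τ)) →
      ∀ (h : ℝ × Space d → ℝ≥0∞), Measurable h → ∀ s : ℝ,
      ∫⁻ τ in Ioi 0, ∫⁻ x, h (s + τ, x) *
          ‖(opKernel m (c τ) ⋆[ContinuousLinearMap.lsmul ℝ ℂ, volume] g) x‖ₑ ^ 2 ≤
        C * ∫⁻ y, iteratedMaximal h (s, y) * ‖g y‖ₑ ^ 2 := by
  obtain ⟨q, hq⟩ := exists_isWavelet d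
  obtain ⟨C₁, hC₁⟩ := hq.exists_enorm_opKernel_convolution_sq_le.{u} hm hν hK
  obtain ⟨C₂, hC₂⟩ := hq.exists_tsum_lintegral_weighted_sq_le.{u}
  set B : ℝ≥0∞ := ENNReal.ofReal (2 ^ (finrank ℝ (Space d) + 1)) *
    (ENNReal.ofReal (2 ^ (finrank ℝ (Space d) + 2)) * volume (closedBall (0 : Space d) 1)) with hB
  have hBt : B ≠ ⊤ := ENNReal.mul_ne_top ENNReal.ofReal_ne_top (ENNReal.mul_ne_top
    ENNReal.ofReal_ne_top (isCompact_closedBall (0 : Space d) 1).measure_lt_top.ne)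
  set E : ℝ≥0∞ := C₁ * B * ENNReal.ofReal (2 * 2 ^ (2 * m)) * 4 with hE
  have hEt : E ≠ ⊤ := by finiteness
  refine ⟨(C₂ * E).toNNReal, ?_⟩
  intro H _ _ _ g hg hgs c hc h hh s
  rw [ENNReal.coe_toNNReal (by finiteness)]
  set r : ℤ → ℝ := fun i => ((2 : ℝ) ^ i) ^ (2 * m) with hr
  have hr0 : ∀ i, 0 < r i := fun i => by positivity
  have hr1 : ∀ i, r (i + 1) = 2 ^ (2 * m) * r i := fun i => by
    simp only [hr]
    rw [zpow_add₀ two_ne_zero, zpow_one, mul_pow, mul_comm]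
  set w : ℤ → Space d → H := fun l => dilate l q ⋆[ContinuousLinearMap.lsmul ℝ ℂ, volume] g with hw
  have hwm : ∀ l, Measurable fun y => ‖w l y‖ₑ ^ 2 := fun l =>
    ((hasCompactSupport_dilate hq.hasCompactSupport l).continuous_convolution_left _
      (contDiff_dilate l hq.contDiff).continuous hg.locallyIntegrable).enorm.measurable.pow_const 2
  set a : ℤ → ℝ≥0∞ := fun i => C₁ * ENNReal.ofReal (r i)⁻¹ with ha
  have hb : ∀ l, Measurable fun z : Space d × Space d => ENNReal.ofReal (bump l (z.1 - z.2)) :=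
    fun l => ((continuous_bump l).measurable.comp (measurable_fst.sub measurable_snd)).ennreal_ofReal
  -- the mass of the weight seen from `y` at time scale `2^{2mi}` and space scale `2^l`
  set T : ℤ → ℤ → Space d → ℝ≥0∞ := fun i l y => ∫⁻ τ in Ioc (r i) (r (i + 1)),
    ∫⁻ x, ENNReal.ofReal (bump l (x - y)) * h (s + τ, x) with hT
  have hTm : ∀ i l, Measurable (T i l) := by
    intro i l
    have h1 : Measurable fun z : (Space d × ℝ) × Space d =>
        ENNReal.ofReal (bump l (z.2 - z.1.1)) * h (s + z.1.2, z.2) :=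
      ((hb l).comp (measurable_snd.prodMk (measurable_fst.comp measurable_fst))).mul
        (hh.comp (((measurable_snd.comp measurable_fst).const_add s).prodMk measurable_snd))
    exact (h1.lintegral_prod_right' (ν := volume)).lintegral_prod_right'
      (ν := volume.restrict (Ioc (r i) (r (i + 1))))
  set V : ℤ → Space d → ℝ≥0∞ := fun l y => ∑' i, a i * geom (l - i) * T i l y with hV
  have hVm : ∀ l, Measurable (V l) := fun l =>
    Measurable.tsum fun i => (hTm i l).const_mul _
  have hVW : ∀ (l : ℤ) (y y' : Space d), ‖y - y'‖ ≤ 2 ^ l → V l y ≤ E * iteratedMaximal h (s, y') := by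
    intro l y y' hy
    calc V l y ≤ ∑' i, C₁ * B * ENNReal.ofReal (2 * 2 ^ (2 * m)) * iteratedMaximal h (s, y') *
          geom (l - i) := by
          refine ENNReal.tsum_le_tsum fun i => ?_
          refine (mul_le_mul_right (lintegral_lintegral_bump_mul_le hh s m i l hy) _).trans_eq ?_
          have h1 : ENNReal.ofReal (r i)⁻¹ * ENNReal.ofReal (2 * ((2 : ℝ) ^ (i + 1)) ^ (2 * m)) =
              ENNReal.ofReal (2 * 2 ^ (2 * m)) := by
            rw [← ENNReal.ofReal_mul (by have := hr0 i; positivity)]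
            congr 1
            have h2 := hr1 i
            simp only [hr] at h2 ⊢
            rw [h2]
            field_simp
          rw [← h1, ← hB, ha]
          ring
      _ = C₁ * B * ENNReal.ofReal (2 * 2 ^ (2 * m)) * iteratedMaximal h (s, y') * ∑' i, geom (l - i) :=
          ENNReal.tsum_mul_left
      _ ≤ C₁ * B * ENNReal.ofReal (2 * 2 ^ (2 * m)) * iteratedMaximal h (s, y') * 4 :=
          mul_le_mul_right (tsum_geom_sub_le' l) _
      _ = _ := by rw [hE]; ring
  -- times are split dyadically with ratio `2 ^ (2 * m)`, the scaling of the operator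
  have hcover : Ioi (0 : ℝ) ⊆ ⋃ i, Ioc (r i) (r (i + 1)) := by
    intro τ hτ
    obtain ⟨n, hn⟩ := exists_mem_Ioc_zpow (y := (2 : ℝ) ^ (2 * m)) hτ
      (one_lt_pow₀ one_lt_two (by omega))
    have h1 : ∀ j : ℤ, ((2 : ℝ) ^ (2 * m)) ^ j = r j := fun j => by
      simp only [hr]
      rw [← zpow_natCast, ← zpow_natCast, ← zpow_mul, ← zpow_mul, mul_comm]
    rw [h1, h1] at hn
    exact mem_iUnion.2 ⟨n, hn⟩
  have hstep : ∀ i, ∫⁻ τ in Ioc (r i) (r (i + 1)), ∫⁻ x, h (s + τ, x) *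
      ‖(opKernel m (c τ) ⋆[ContinuousLinearMap.lsmul ℝ ℂ, volume] g) x‖ₑ ^ 2 ≤
      ∑' l, ∫⁻ y, a i * geom (l - i) * T i l y * ‖w l y‖ₑ ^ 2 := by
    intro i
    have hm1 : ∀ l, Measurable fun z : (ℝ × Space d) × Space d =>
        ENNReal.ofReal (bump l (z.1.2 - z.2)) * ‖w l z.2‖ₑ ^ 2 := fun l =>
      ((hb l).comp ((measurable_snd.comp measurable_fst).prodMk measurable_snd)).mul
        ((hwm l).comp measurable_snd)
    have hm2 : ∀ l, Measurable fun z : ℝ × Space d =>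
        ∫⁻ y, ENNReal.ofReal (bump l (z.2 - y)) * ‖w l y‖ₑ ^ 2 := fun l =>
      (hm1 l).lintegral_prod_right' (ν := volume)
    have hm3 : Measurable fun z : ℝ × Space d => h (s + z.1, z.2) :=
      hh.comp ((measurable_fst.const_add s).prodMk measurable_snd)
    have hm4 : ∀ l, Measurable fun z : ℝ × Space d => a i * geom (l - i) * (h (s + z.1, z.2) *
        ∫⁻ y, ENNReal.ofReal (bump l (z.2 - y)) * ‖w l y‖ₑ ^ 2) := fun l =>
      (hm3.mul (hm2 l)).const_mul _
    calc _ ≤ ∫⁻ τ in Ioc (r i) (r (i + 1)), ∫⁻ x, ∑' l, a i * geom (l - i) * (h (s + τ, x) *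
          ∫⁻ y, ENNReal.ofReal (bump l (x - y)) * ‖w l y‖ₑ ^ 2) := by
          refine setLIntegral_mono' measurableSet_Ioc fun τ hτ => lintegral_mono fun x => ?_
          refine (mul_le_mul_right (hC₁ H g hg i τ (c τ) hτ.1.le (hc τ ((hr0 i).trans hτ.1)) x)
            _).trans_eq ?_
          rw [← ENNReal.tsum_mul_left, ← ENNReal.tsum_mul_left]
          refine tsum_congr fun l => ?_
          simp only [ha, hr, hw]
          ring
      _ = ∑' l, ∫⁻ τ in Ioc (r i) (r (i + 1)), ∫⁻ x, a i * geom (l - i) * (h (s + τ, x) *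
          ∫⁻ y, ENNReal.ofReal (bump l (x - y)) * ‖w l y‖ₑ ^ 2) := by
          rw [← lintegral_tsum fun l => ((hm4 l).lintegral_prod_right' (ν := volume)).aemeasurable]
          congr 1 with τ
          exact lintegral_tsum fun l => ((hm4 l).comp measurable_prodMk_left).aemeasurable
      _ = _ := by
          refine tsum_congr fun l => ?_
          have e1 := lintegral_lintegral_mul_lintegral_swap (h := fun z => h (s + z.1, z.2))
            (volume.restrict (Ioc (r i) (r (i + 1)))) (hb l) hm3 (hwm l) (a i * geom (l - i))
          exact e1
  have hWm : Measurable fun y => E * iteratedMaximal h (s, y) :=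
    ((measurable_iteratedMaximal hh).comp measurable_prodMk_left).const_mul _
  calc _ ≤ ∫⁻ τ in ⋃ i, Ioc (r i) (r (i + 1)), ∫⁻ x, h (s + τ, x) *
        ‖(opKernel m (c τ) ⋆[ContinuousLinearMap.lsmul ℝ ℂ, volume] g) x‖ₑ ^ 2 :=
        lintegral_mono_set hcover
    _ ≤ ∑' i, ∑' l, ∫⁻ y, a i * geom (l - i) * T i l y * ‖w l y‖ₑ ^ 2 :=
        (lintegral_iUnion_le _ _).trans (ENNReal.tsum_le_tsum hstep)
    _ = ∑' l, ∫⁻ y, V l y * ‖w l y‖ₑ ^ 2 := by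
        rw [ENNReal.tsum_comm]
        refine tsum_congr fun l => ?_
        have e1 := lintegral_tsum (μ := volume)
          (f := fun i y => a i * geom (l - i) * T i l y * ‖w l y‖ₑ ^ 2)
          fun i => (((hTm i l).const_mul _).mul (hwm l)).aemeasurable
        rw [← e1]
        simp_rw [hV, ENNReal.tsum_mul_right]
    _ ≤ C₂ * ∫⁻ y, E * iteratedMaximal h (s, y) * ‖g y‖ₑ ^ 2 := hC₂ H g hg hgs V _ hVm hWm hVW
    _ = _ := by
        simp_rw [mul_assoc]
        rw [lintegral_const_mul' _ _ hEt]

end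

/-! ### The kernel of the operator -/

section

variable {d : ℕ}

/-- Comparison of the two normalisations of the Fourier transform. -/
theorem fourierT_eq (f : Space d → ℂ) (ξ : Space d) :
    fourierT f ξ = 𝓕 f ((2 * Real.pi)⁻¹ • ξ) := by
  rw [fourierT, Real.fourier_eq]
  refine integral_congr_ae (Eventually.of_forall fun x => ?_)
  simp only
  rw [Circle.smul_def, Real.fourierChar_apply, smul_eq_mul, inner_smul_right]
  congr 2
  have : (Real.pi : ℂ) ≠ 0 := by exact_mod_cast Real.pi_ne_zero
  push_cast
  field_simp

theorem fourierTInv_eq (f : Space d → ℂ) (x : Space d) :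
    fourierTInv f x = 𝓕⁻ (fun ξ => f ((2 * Real.pi) • ξ)) x := by
  have h2 : (0 : ℝ) < 2 * Real.pi := by positivity
  have h1 := Measure.integral_comp_smul (volume : Measure (Space d))
    (fun ξ => Complex.exp (Complex.I * (inner ℝ ξ x : ℝ)) * f ξ) (2 * Real.pi)
  rw [finrank_euclideanSpace, Fintype.card_fin, abs_of_pos (by positivity), Complex.real_smul] at h1
  rw [fourierTInv, Real.fourierInv_eq, ← inv_pow, Complex.ofReal_pow, Complex.ofReal_inv] at *
  rw [← h1]
  refine integral_congr_ae (Eventually.of_forall fun ξ => ?_)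
  simp only
  rw [Circle.smul_def, Real.fourierChar_apply, smul_eq_mul, real_inner_smul_left]
  congr 2
  push_cast
  ring

theorem fracLaplacian_eq (m : ℕ) (u : Space d → ℂ) :
    fracLaplacian ((m : ℝ) / 2) u =
      (((2 * Real.pi) ^ m : ℝ) : ℂ) • 𝓕⁻ fun ξ => ((‖ξ‖ ^ m : ℝ) : ℂ) * 𝓕 u ξ := by
  have h2 : (0 : ℝ) < 2 * Real.pi := by positivity
  funext x
  rw [fracLaplacian, fourierTInv_eq, Pi.smul_apply, Real.fourierInv_eq, Real.fourierInv_eq,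
    ← integral_smul]
  refine integral_congr_ae (Eventually.of_forall fun ξ => ?_)
  simp only
  rw [fourierT_eq, inv_smul_smul₀ h2.ne', smul_comm, mul_div_cancel₀ _ two_ne_zero,
    Real.rpow_natCast, norm_smul, Real.norm_of_nonneg h2.le, mul_pow, smul_eq_mul]
  push_cast
  ring_nf

section

variable {m : ℕ} {ν K : ℝ} {a : (Fin d → ℕ) → (Fin d → ℕ) → ℝ → ℂ}

theorem IsEllipticCoeff.intervalIntegrable (ha : IsEllipticCoeff m ν K a) {s t : ℝ} (hs : 0 ≤ s)
    (hst : s ≤ t) {α β : Fin d → ℕ} (hα : α ∈ multiIndices d m) (hβ : β ∈ multiIndices d m) :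
    IntervalIntegrable (a α β) volume s t := by
  rw [intervalIntegrable_iff_integrableOn_Ioc_of_le hst]
  refine Measure.integrableOn_of_bounded (M := K) measure_Ioc_lt_top.ne
    (ha.measurable α hα β hβ).aestronglyMeasurable ?_
  filter_upwards [ae_restrict_of_ae ha.bounded, ae_restrict_mem measurableSet_Ioc] with r h1 h2
  exact h1 (hs.trans_lt h2.1) α hα β hβ

theorem IsEllipticCoeff.integral_polyForm (ha : IsEllipticCoeff m ν K a) {s t : ℝ} (hs : 0 ≤ s)
    (hst : s ≤ t) (ξ : Space d) :
    IntervalIntegrable (fun r => polyForm m (fun α β => a α β r) ξ) volume s t ∧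
    ∫ r in s..t, polyForm m (fun α β => a α β r) ξ =
      polyForm m (fun α β => ∫ r in s..t, a α β r) ξ := by
  have h1 : ∀ α ∈ multiIndices d m, ∀ β ∈ multiIndices d m, IntervalIntegrable
      (fun r => a α β r * ((monomial α ξ * monomial β ξ : ℝ) : ℂ)) volume s t :=
    fun α hα β hβ => (ha.intervalIntegrable hs hst hα hβ).mul_const _
  have h2 : ∀ α ∈ multiIndices d m, IntervalIntegrable (fun r => ∑ β ∈ multiIndices d m,
      a α β r * ((monomial α ξ * monomial β ξ : ℝ) : ℂ)) volume s t := by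
    intro α hα
    have := IntervalIntegrable.sum (multiIndices d m) (h1 α hα)
    exact this.congr fun r _ => by simp
  refine ⟨?_, ?_⟩
  · have := IntervalIntegrable.sum (multiIndices d m) h2
    exact this.congr fun r _ => by simp [polyForm]
  · unfold polyForm
    rw [intervalIntegral.integral_finsetSum h2]
    refine Finset.sum_congr rfl fun α hα => ?_
    rw [intervalIntegral.integral_finsetSum (h1 α hα)]
    refine Finset.sum_congr rfl fun β hβ => ?_
    rw [intervalIntegral.integral_mul_const]

/-- The constant is `|K|` because nothing forces `K` to be non-negative when it is a free real
parameter. -/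
theorem IsEllipticCoeff.isEllipticForm_integral (ha : IsEllipticCoeff m ν K a) {s τ : ℝ} (hs : 0 ≤ s)
    (hτ : 0 < τ) : IsEllipticForm m ν |K| τ fun α β => ∫ r in s..s + τ, a α β r where
  bounded α hα β hβ := by
    have h1 := intervalIntegral.norm_integral_le_of_norm_le_const_ae (a := s) (b := s + τ) (C := |K|)
      (f := a α β) (by
        filter_upwards [ha.bounded] with r h1 h2
        rw [uIoc_of_le (by linarith)] at h2
        exact (h1 (hs.trans_lt h2.1) α hα β hβ).trans (le_abs_self K))
    rwa [add_sub_cancel_left, abs_of_pos hτ] at h1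
  elliptic ξ := by
    obtain ⟨h1, h2⟩ := ha.integral_polyForm hs (le_add_of_nonneg_right hτ.le) ξ
    have h3 := Complex.reCLM.intervalIntegral_comp_comm h1
    rw [h2] at h3
    simp only [Complex.reCLM_apply] at h3
    rw [← h3]
    have h4 : ν * τ * ‖ξ‖ ^ (2 * m) = ∫ r in s..s + τ, ν * ‖ξ‖ ^ (2 * m) := by
      rw [intervalIntegral.integral_const, smul_eq_mul, add_sub_cancel_left]
      ring
    rw [h4]
    refine intervalIntegral.integral_mono_ae_restrict (by linarith) intervalIntegrable_const ?_ ?_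
    · exact ⟨Complex.reCLM.integrable_comp h1.1, Complex.reCLM.integrable_comp h1.2⟩
    · have h0 : ∀ᵐ r ∂(volume : Measure ℝ).restrict (Icc s (s + τ)), r ≠ s :=
        ae_restrict_of_ae (Measure.ae_ne volume s)
      filter_upwards [ae_restrict_of_ae ha.elliptic_lower, h0,
        ae_restrict_mem measurableSet_Icc] with r h5 h6 h7
      refine (h5 (hs.trans_lt (lt_of_le_of_ne h7.1 h6.symm)) ξ).trans_eq ?_
      simp only [polyForm, Complex.re_sum, Complex.re_mul_ofReal]
      exact Finset.sum_congr rfl fun α _ => Finset.sum_congr rfl fun β _ => mul_comm _ _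

/-- The coefficients of the operator integrated over `(s, t)`, rescaled to the normalisation
`exp (2πi x·ξ)` of the Fourier transform. -/
noncomputable def timeCoeff (m : ℕ) (a : (Fin d → ℕ) → (Fin d → ℕ) → ℝ → ℂ) (s t : ℝ)
    (α β : Fin d → ℕ) : ℂ :=
  (((2 * Real.pi) ^ (2 * m) : ℝ) : ℂ) * ∫ r in s..t, a α β r

theorem IsEllipticCoeff.isEllipticForm_timeCoeff (ha : IsEllipticCoeff m ν K a) {s τ : ℝ} (hs : 0 ≤ s)
    (hτ : 0 < τ) : IsEllipticForm m ((2 * Real.pi) ^ (2 * m) * ν) ((2 * Real.pi) ^ (2 * m) * |K|) τ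
      (timeCoeff m a s (s + τ)) := by
  have h := (ha.isEllipticForm_integral hs hτ).smul (s := (2 * Real.pi) ^ (2 * m)) (by positivity)
  refine ⟨fun α hα β hβ => (h.bounded α hα β hβ).trans_eq (by ring), fun ξ => ?_⟩
  refine le_trans (le_of_eq (by ring)) (h.elliptic ξ)

/-- The kernel of the square function, in the normalisation `exp (2πi x·ξ)`. -/
theorem IsEllipticCoeff.fracLaplacian_kernelP1 (hm : 1 ≤ m) (hν : 0 < ν) (ha : IsEllipticCoeff m ν K a)
    {s t : ℝ} (hs : 0 ≤ s) (hst : s < t) :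
    fracLaplacian ((m : ℝ) / 2) (kernelP1 m a t s) =
      (((2 * Real.pi) ^ m : ℝ) : ℂ) • opKernel m (timeCoeff m a s t) := by
  have hk : kernelP1 m a t s = 𝓕⁻ fun ξ => Complex.exp (-polyForm m (timeCoeff m a s t) ξ) := by
    funext x
    rw [kernelP1, if_pos ⟨hs, hst⟩, fourierTInv_eq]
    refine congrFun (congrArg _ (funext fun ξ => congrArg _ ?_)) x
    have h1 : ∀ r, symbolA1 m a r ((2 * Real.pi) • ξ) =
        -polyForm m (fun α β => a α β r) ((2 * Real.pi) • ξ) := fun r => rfl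
    simp_rw [h1]
    rw [intervalIntegral.integral_neg, (ha.integral_polyForm hs hst.le _).2, polyForm_smul]
    rfl
  have hc := ha.isEllipticForm_timeCoeff hs (sub_pos.2 hst)
  rw [add_sub_cancel] at hc
  rw [fracLaplacian_eq, hk, hc.fourier_fourierInv hm (by positivity) (by positivity) (sub_pos.2 hst)]
  rfl

end

section Measurability

/-- No integrability is needed: the integral over `Ioc` is the integral of an indicator, jointly
measurable in the endpoints. -/
theorem measurable_intervalIntegral {a : ℝ → ℂ} (ha : Measurable a) :
    Measurable fun z : ℝ × ℝ => ∫ r in z.1..z.2, a r := by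
  have h1 : ∀ b c : ℝ × ℝ → ℝ, Measurable b → Measurable c →
      Measurable fun z : ℝ × ℝ => ∫ r in Ioc (b z) (c z), a r := by
    intro b c hb hc
    have hs : MeasurableSet {w : (ℝ × ℝ) × ℝ | b w.1 < w.2 ∧ w.2 ≤ c w.1} :=
      (measurableSet_lt (hb.comp measurable_fst) measurable_snd).inter
        (measurableSet_le measurable_snd (hc.comp measurable_fst))
    have h2 : StronglyMeasurable fun w : (ℝ × ℝ) × ℝ =>
        {w : (ℝ × ℝ) × ℝ | b w.1 < w.2 ∧ w.2 ≤ c w.1}.indicator (fun w => a w.2) w :=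
      ((ha.comp measurable_snd).indicator hs).stronglyMeasurable
    have h3 := (h2.integral_prod_right' (ν := volume)).measurable
    convert h3 using 2 with z
    rw [← integral_indicator measurableSet_Ioc]
    rfl
  unfold intervalIntegral
  exact (h1 _ _ measurable_fst measurable_snd).sub (h1 _ _ measurable_snd measurable_fst)

variable {m : ℕ} {ν K : ℝ} {a : (Fin d → ℕ) → (Fin d → ℕ) → ℝ → ℂ}

theorem measurable_polyForm {X : Type*} [MeasurableSpace X]
    {c : X → (Fin d → ℕ) → (Fin d → ℕ) → ℂ} {g : X → Space d}
    (hc : ∀ α ∈ multiIndices d m, ∀ β ∈ multiIndices d m, Measurable fun x => c x α β)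
    (hg : Measurable g) : Measurable fun x => polyForm m (c x) (g x) := by
  unfold polyForm
  refine Finset.measurable_fun_sum _ fun α hα => Finset.measurable_fun_sum _ fun β hβ => ?_
  refine (hc α hα β hβ).mul ?_
  have : Continuous fun ξ : Space d => ((monomial α ξ * monomial β ξ : ℝ) : ℂ) := by
    unfold monomial
    fun_prop
  exact this.measurable.comp hg

theorem IsEllipticCoeff.stronglyMeasurable_opKernel (ha : IsEllipticCoeff m ν K a) :
    StronglyMeasurable fun z : (ℝ × ℝ) × Space d => opKernel m (timeCoeff m a z.1.1 z.1.2) z.2 := by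
  have h1 : Measurable fun w : ((ℝ × ℝ) × Space d) × Space d =>
      polyForm m (timeCoeff m a w.1.1.1 w.1.1.2) w.2 := by
    refine measurable_polyForm (fun α hα β hβ => ?_) measurable_snd
    exact ((measurable_intervalIntegral (ha.measurable α hα β hβ)).comp
      (measurable_fst.comp measurable_fst)).const_mul _
  have h2 : Continuous fun w : Space d × Space d =>
      (Real.fourierChar (inner ℝ w.2 w.1) : ℂ) * ((‖w.2‖ ^ m : ℝ) : ℂ) := by
    have h0 : Continuous fun w : Space d × Space d => Real.fourierChar (inner ℝ w.2 w.1) :=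
      Real.continuous_fourierChar.comp (by fun_prop)
    have h00 : Continuous fun w : Space d × Space d =>
      (Real.fourierChar (inner ℝ w.2 w.1) : ℂ) := continuous_subtype_val.comp h0
    exact h00.mul (by fun_prop)
  have h3 : StronglyMeasurable fun w : ((ℝ × ℝ) × Space d) × Space d =>
      (Real.fourierChar (inner ℝ w.2 w.1.2) : ℂ) * ((‖w.2‖ ^ m : ℝ) : ℂ) *
        Complex.exp (-polyForm m (timeCoeff m a w.1.1.1 w.1.1.2) w.2) := by
    have e1 : Measurable fun w : ((ℝ × ℝ) × Space d) × Space d => (w.1.2, w.2) :=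
      (measurable_snd.comp measurable_fst).prodMk measurable_snd
    have e2 := h2.measurable.comp e1
    have e3 := Complex.measurable_exp.comp h1.neg
    exact (e2.mul e3).stronglyMeasurable
  have h4 := h3.integral_prod_right' (ν := (volume : Measure (Space d)))
  convert h4 using 2 with z
  rw [opKernel, Real.fourierInv_eq]
  refine integral_congr_ae (Eventually.of_forall fun ξ => ?_)
  simp only
  rw [Circle.smul_def, smul_eq_mul, mul_assoc]

theorem IsEllipticCoeff.measurable_enorm_opKernel_convolution (ha : IsEllipticCoeff m ν K a)
    {H : Type*} [NormedAddCommGroup H] [InnerProductSpace ℂ H] {f : ℝ × Space d → H}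
    (hf : Continuous f) :
    Measurable fun z : ℝ × (ℝ × Space d) => ‖(opKernel m (timeCoeff m a z.1 z.2.1)
      ⋆[ContinuousLinearMap.lsmul ℝ ℂ, volume] fun y => f (z.1, y)) z.2.2‖ₑ := by
  have h1 : StronglyMeasurable fun w : (ℝ × (ℝ × Space d)) × Space d =>
      opKernel m (timeCoeff m a w.1.1 w.1.2.1) w.2 :=
    ha.stronglyMeasurable_opKernel.comp_measurable
      (g := fun w : (ℝ × (ℝ × Space d)) × Space d => ((w.1.1, w.1.2.1), w.2)) (by fun_prop)
  have h2 : StronglyMeasurable fun w : (ℝ × (ℝ × Space d)) × Space d =>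
      f (w.1.1, w.1.2.2 - w.2) :=
    (hf.comp (by fun_prop : Continuous fun w : (ℝ × (ℝ × Space d)) × Space d =>
      (w.1.1, w.1.2.2 - w.2))).stronglyMeasurable
  exact ((h1.smul h2).integral_prod_right' (ν := (volume : Measure (Space d)))).enorm

end Measurability

end

/-! ### The weighted inequality in space-time -/

section

variable {d : ℕ}

/-- The square of the square function, for the kernel `opKernel`. -/
noncomputable def evolutionSq {H : Type*} [NormedAddCommGroup H] [InnerProductSpace ℂ H] (m : ℕ)
    (a : (Fin d → ℕ) → (Fin d → ℕ) → ℝ → ℂ) (f : ℝ × Space d → H) (z : ℝ × Space d) : ℝ≥0∞ :=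
  ∫⁻ s in Ioo 0 z.1, ‖(opKernel m (timeCoeff m a s z.1)
    ⋆[ContinuousLinearMap.lsmul ℝ ℂ, volume] fun y => f (s, y)) z.2‖ₑ ^ 2

section

variable {m : ℕ} {ν K : ℝ} {a : (Fin d → ℕ) → (Fin d → ℕ) → ℝ → ℂ} {H : Type u}
  [NormedAddCommGroup H] [InnerProductSpace ℂ H] {f : ℝ × Space d → H}

theorem IsEllipticCoeff.squareFunction_eq (hm : 1 ≤ m) (hν : 0 < ν) (ha : IsEllipticCoeff m ν K a)
    (z : ℝ × Space d) :
    squareFunction (fun t s => fracLaplacian ((m : ℝ) / 2) (kernelP1 m a t s)) f z =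
      (ENNReal.ofReal ((2 * Real.pi) ^ (2 * m)) * evolutionSq m a f z) ^ (1 / 2 : ℝ) := by
  rw [squareFunction, evolutionSq, ← lintegral_const_mul' _ _ ENNReal.ofReal_ne_top]
  congr 1
  refine setLIntegral_congr_fun measurableSet_Ioo fun s hs => ?_
  have hsm : ((((2 * Real.pi) ^ m : ℝ) : ℂ) • opKernel m (timeCoeff m a s z.1)) =
      ((2 * Real.pi) ^ m : ℝ) • opKernel m (timeCoeff m a s z.1) := by
    funext x
    simp
  rw [ha.fracLaplacian_kernelP1 hm hν hs.1.le hs.2, hsm, smul_convolution, Pi.smul_apply, enorm_smul,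
    mul_pow, Real.enorm_of_nonneg (by positivity), ← ENNReal.ofReal_pow (by positivity), ← pow_mul,
    mul_comm m 2]

theorem IsEllipticCoeff.measurable_indicator_opKernel (ha : IsEllipticCoeff m ν K a)
    (hf : Continuous f) :
    Measurable ({w : ℝ × (ℝ × Space d) | 0 < w.1 ∧ w.1 < w.2.1}.indicator fun w =>
      ‖(opKernel m (timeCoeff m a w.1 w.2.1)
        ⋆[ContinuousLinearMap.lsmul ℝ ℂ, volume] fun y => f (w.1, y)) w.2.2‖ₑ ^ 2) := by
  refine ((ha.measurable_enorm_opKernel_convolution hf).pow_const 2).indicator ?_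
  exact (measurableSet_lt measurable_const measurable_fst).inter
    (measurableSet_lt measurable_fst (measurable_fst.comp measurable_snd))

theorem evolutionSq_eq_lintegral (z : ℝ × Space d) :
    evolutionSq m a f z = ∫⁻ s, {w : ℝ × (ℝ × Space d) | 0 < w.1 ∧ w.1 < w.2.1}.indicator (fun w =>
      ‖(opKernel m (timeCoeff m a w.1 w.2.1)
        ⋆[ContinuousLinearMap.lsmul ℝ ℂ, volume] fun y => f (w.1, y)) w.2.2‖ₑ ^ 2) (s, z) := by
  rw [evolutionSq, ← lintegral_indicator measurableSet_Ioo]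
  rfl

theorem IsEllipticCoeff.measurable_evolutionSq (ha : IsEllipticCoeff m ν K a) (hf : Continuous f) :
    Measurable (evolutionSq m a f) := by
  have h1 := (ha.measurable_indicator_opKernel hf).lintegral_prod_left' (μ := volume)
  have h2 : evolutionSq m a f = _ := funext fun z => evolutionSq_eq_lintegral z
  rw [h2]
  exact h1

end

/-- The square function is bounded on `L²` with weight `h` on the left and the maximal function of
`h` on the right. -/
theorem exists_lintegral_evolutionSq_mul_le (d : ℕ) {m : ℕ} (hm : 1 ≤ m) {ν : ℝ} (K : ℝ)
    (hν : 0 < ν) :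
    ∃ C : ℝ≥0, ∀ a : (Fin d → ℕ) → (Fin d → ℕ) → ℝ → ℂ, IsEllipticCoeff m ν K a →
      ∀ (H : Type u) [NormedAddCommGroup H] [InnerProductSpace ℂ H] [CompleteSpace H]
      (f : ℝ × Space d → H), Continuous f → HasCompactSupport f →
      ∀ h : ℝ × Space d → ℝ≥0∞, Measurable h →
      ∫⁻ z, evolutionSq m a f z * h z ≤ C * ∫⁻ z, iteratedMaximal h z * ‖f z‖ₑ ^ 2 := by
  obtain ⟨C, hC⟩ := exists_lintegral_opKernel_weighted_le.{u} d hm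
    (ν := (2 * Real.pi) ^ (2 * m) * ν) (K := (2 * Real.pi) ^ (2 * m) * |K|) (by positivity)
    (by positivity)
  refine ⟨C, fun a ha H _ _ _ f hf hfc h hh => ?_⟩
  set Ψ : ℝ × (ℝ × Space d) → ℝ≥0∞ := {w | 0 < w.1 ∧ w.1 < w.2.1}.indicator fun w =>
      ‖(opKernel m (timeCoeff m a w.1 w.2.1)
        ⋆[ContinuousLinearMap.lsmul ℝ ℂ, volume] fun y => f (w.1, y)) w.2.2‖ₑ ^ 2 with hΨ
  have hΨm : Measurable Ψ := ha.measurable_indicator_opKernel hf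
  have hW : Measurable fun z => iteratedMaximal h z * ‖f z‖ₑ ^ 2 :=
    (measurable_iteratedMaximal hh).mul (hf.enorm.measurable.pow_const 2)
  have hslice : ∀ s, ∫⁻ z, Ψ (s, z) * h z ≤ C * ∫⁻ y, iteratedMaximal h (s, y) * ‖f (s, y)‖ₑ ^ 2 := by
    intro s
    rcases le_or_gt s 0 with hs | hs
    · have : ∀ z, Ψ (s, z) = 0 := fun z => indicator_of_notMem (fun h => not_lt.2 hs h.1) _
      simp [this]
    have hgc : Continuous fun y => f (s, y) := hf.comp (by fun_prop)
    have hgs : HasCompactSupport fun y => f (s, y) :=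
      hfc.comp_isClosedEmbedding (Function.LeftInverse.isClosedEmbedding
        (f := Prod.snd) (fun _ => rfl) continuous_snd (by fun_prop))
    refine le_trans ?_ (hC H (fun y => f (s, y)) (hgc.integrable_of_hasCompactSupport hgs) hgs
      (fun τ => timeCoeff m a s (s + τ)) (fun τ hτ => ha.isEllipticForm_timeCoeff hs.le hτ) h hh s)
    have hm1 : Measurable fun z => Ψ (s, z) * h z := (hΨm.comp measurable_prodMk_left).mul hh
    -- the elapsed time `τ = t - s` becomes the variable of integration
    rw [Measure.volume_eq_prod, lintegral_prod _ hm1.aemeasurable,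
      ← lintegral_add_left_eq_self _ s, ← lintegral_indicator measurableSet_Ioi]
    refine lintegral_mono fun τ => ?_
    by_cases hτ : 0 < τ
    · rw [indicator_of_mem (mem_Ioi.2 hτ)]
      refine lintegral_mono fun x => ?_
      rw [mul_comm]
      refine mul_le_mul_right (indicator_le_self _ _ _) _
    · have : ∀ x, Ψ (s, (s + τ, x)) = 0 := fun x =>
        indicator_of_notMem (fun h => hτ (by have := h.2; simp only at this; linarith)) _
      simp [this]
  calc ∫⁻ z, evolutionSq m a f z * h z = ∫⁻ z, ∫⁻ s, Ψ (s, z) * h z := by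
        refine lintegral_congr fun z => ?_
        have h1 := lintegral_mul_const (μ := volume) (h z) (f := fun s => Ψ (s, z))
          (hΨm.comp measurable_prodMk_right)
        rw [evolutionSq_eq_lintegral, h1]
    _ = ∫⁻ s, ∫⁻ z, Ψ (s, z) * h z := by
        refine lintegral_lintegral_swap (Measurable.aemeasurable ?_)
        exact (hΨm.comp measurable_swap).mul (hh.comp measurable_fst)
    _ ≤ ∫⁻ s, C * ∫⁻ y, iteratedMaximal h (s, y) * ‖f (s, y)‖ₑ ^ 2 := lintegral_mono hslice
    _ = _ := by
        rw [lintegral_const_mul' _ _ ENNReal.coe_ne_top, Measure.volume_eq_prod,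
          lintegral_prod _ hW.aemeasurable]

/-- The maximal theorem in each variable; `d ≥ 1` makes the space nontrivial. -/
theorem exists_lintegral_iteratedMaximal_rpow_le (hd : 1 ≤ d) {q : ℝ} (hq : 1 < q) :
    ∃ C : ℝ≥0, ∀ h : ℝ × Space d → ℝ≥0∞, Measurable h →
      ∫⁻ z, iteratedMaximal h z ^ q ≤ C * ∫⁻ z, h z ^ q := by
  have : Nonempty (Fin d) := ⟨⟨0, hd⟩⟩
  obtain ⟨C₁, h₁⟩ := exists_lintegral_maximalFunction_rpow_le ℝ hq
  obtain ⟨C₂, h₂⟩ := exists_lintegral_maximalFunction_rpow_le (Space d) hq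
  refine ⟨C₁ * C₂, fun h hh => ?_⟩
  have hS := measurable_spatialMaximal hh
  have hI := measurable_iteratedMaximal hh
  rw [Measure.volume_eq_prod, lintegral_prod_symm _ (hI.pow_const q).aemeasurable]
  calc _ ≤ ∫⁻ y, C₁ * ∫⁻ t, spatialMaximal h (t, y) ^ q :=
        lintegral_mono fun y => h₁ (fun t => spatialMaximal h (t, y)) (hS.comp measurable_prodMk_right)
    _ = C₁ * ∫⁻ t, ∫⁻ y, spatialMaximal h (t, y) ^ q := by
        rw [lintegral_const_mul' _ _ ENNReal.coe_ne_top]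
        congr 1
        exact lintegral_lintegral_swap ((hS.pow_const q).comp measurable_swap).aemeasurable
    _ ≤ C₁ * ∫⁻ t, C₂ * ∫⁻ x, h (t, x) ^ q :=
        mul_le_mul_right (lintegral_mono fun t => h₂ (fun x => h (t, x))
          (hh.comp measurable_prodMk_left)) _
    _ = _ := by
        rw [lintegral_const_mul' _ _ ENNReal.coe_ne_top, ← mul_assoc,
          lintegral_prod _ (hh.pow_const q).aemeasurable]
        push_cast
        rfl

theorem iteratedMaximal_one_le (z : ℝ × Space d) : iteratedMaximal (fun _ => 1) z ≤ 1 := by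
  refine le_trans (iSup_mono fun n => ?_) (maximalFunction_const_le 1 z.1)
  rw [setLAverage_eq, setLAverage_eq]
  exact ENNReal.div_le_div_right (lintegral_mono fun t => maximalFunction_const_le 1 z.2) _

end

/-! ### Duality -/

/-- A weighted inequality `∫ A h ≤ C ∫ (M h) F` with an operator `M` bounded on the conjugate
Lebesgue space bounds the norm of `A` by that of `F`: test it with `h = A ^ (r - 1)`, truncated so
that its norm is finite. -/
theorem lintegral_rpow_le_of_weighted {X : Type*} [MeasurableSpace X] {μ : Measure X} [SigmaFinite μ]
    {r q : ℝ} (hrq : r.HolderConjugate q) {A F : X → ℝ≥0∞} (hA : Measurable A) (hF : Measurable F)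
    {M : (X → ℝ≥0∞) → X → ℝ≥0∞} {C D : ℝ≥0} (hM : ∀ h, Measurable h → Measurable (M h))
    (hMq : ∀ h, Measurable h → ∫⁻ x, M h x ^ q ∂μ ≤ D * ∫⁻ x, h x ^ q ∂μ)
    (hw : ∀ h, Measurable h → ∫⁻ x, A x * h x ∂μ ≤ C * ∫⁻ x, M h x * F x ∂μ) :
    ∫⁻ x, A x ^ r ∂μ ≤ (C * (D : ℝ≥0∞) ^ (1 / q)) ^ r * ∫⁻ x, F x ^ r ∂μ := by
  have hr0 : 0 < r := hrq.pos
  have hq0 : 0 < q := hrq.symm.pos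
  set S := spanningSets μ with hS
  set B : ℕ → X → ℝ≥0∞ := fun n => (S n).indicator fun x => min (A x) n with hB
  have hBm : ∀ n, Measurable (B n) := fun n =>
    (hA.min measurable_const).indicator (measurableSet_spanningSets μ n)
  have hBA : ∀ n x, B n x ≤ A x := fun n x =>
    (indicator_le_self _ _ _).trans (min_le_left _ _)
  have hfin : ∀ n, ∫⁻ x, B n x ^ r ∂μ ≠ ⊤ := by
    intro n
    refine ne_top_of_le_ne_top (b := (n : ℝ≥0∞) ^ r * μ (S n)) ?_ ?_
    · exact ENNReal.mul_ne_top (ENNReal.rpow_ne_top_of_nonneg hr0.le (ENNReal.natCast_ne_top n))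
        (measure_spanningSets_lt_top μ n).ne
    · rw [← setLIntegral_const, ← lintegral_indicator (measurableSet_spanningSets μ n)]
      refine lintegral_mono fun x => ?_
      by_cases hx : x ∈ S n
      · rw [indicator_of_mem hx]
        simp only [hB]
        rw [indicator_of_mem hx]
        exact ENNReal.rpow_le_rpow (min_le_right _ _) hr0.le
      · rw [indicator_of_notMem hx]
        simp only [hB]
        rw [indicator_of_notMem hx, ENNReal.zero_rpow_of_pos hr0]
  have hn : ∀ n, ∫⁻ x, B n x ^ r ∂μ ≤ (C * (D : ℝ≥0∞) ^ (1 / q)) ^ r * ∫⁻ x, F x ^ r ∂μ := by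
    intro n
    set I := ∫⁻ x, B n x ^ r ∂μ with hI
    set h : X → ℝ≥0∞ := fun x => B n x ^ (r - 1) with hh
    have hhm : Measurable h := (hBm n).pow_const _
    have hpow : ∀ x, h x ^ q = B n x ^ r := fun x => by
      simp only [hh]
      rw [← ENNReal.rpow_mul, hrq.sub_one_mul_conj]
    have h1 : I ≤ C * (D : ℝ≥0∞) ^ (1 / q) * (∫⁻ x, F x ^ r ∂μ) ^ (1 / r) * I ^ (1 / q) := by
      calc I ≤ ∫⁻ x, A x * h x ∂μ := by
            refine lintegral_mono fun x => ?_
            simp only [hh]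
            calc B n x ^ r = B n x * B n x ^ (r - 1) := by
                  nth_rw 1 [show r = 1 + (r - 1) by ring]
                  rw [ENNReal.rpow_add_of_nonneg _ _ zero_le_one (by linarith [hrq.lt]),
                    ENNReal.rpow_one]
              _ ≤ _ := mul_le_mul_left (hBA n x) _
        _ ≤ C * ∫⁻ x, M h x * F x ∂μ := hw h hhm
        _ ≤ C * ((∫⁻ x, M h x ^ q ∂μ) ^ (1 / q) * (∫⁻ x, F x ^ r ∂μ) ^ (1 / r)) :=
            mul_le_mul_right (ENNReal.lintegral_mul_le_Lp_mul_Lq μ hrq.symm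
              (hM h hhm).aemeasurable hF.aemeasurable) _
        _ ≤ C * ((D * I) ^ (1 / q) * (∫⁻ x, F x ^ r ∂μ) ^ (1 / r)) := by
            have := hMq h hhm
            simp_rw [hpow] at this
            gcongr
        _ = _ := by
            rw [ENNReal.mul_rpow_of_nonneg _ _ (by positivity)]
            ring
    -- divide by `I ^ (1 / q)`, which is finite thanks to the truncation
    rcases eq_or_ne I 0 with h0 | h0
    · rw [h0]; exact zero_le
    have hIt : I ≠ ⊤ := hfin n
    have h2 : I ^ (1 / r) ≤ C * (D : ℝ≥0∞) ^ (1 / q) * (∫⁻ x, F x ^ r ∂μ) ^ (1 / r) := by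
      have hsplit : I = I ^ (1 / r) * I ^ (1 / q) := by
        rw [← ENNReal.rpow_add _ _ h0 hIt]
        have := hrq.inv_add_inv_eq_one
        rw [one_div, one_div, this, ENNReal.rpow_one]
      refine (ENNReal.mul_le_mul_iff_left (c := I ^ (1 / q)) ?_ ?_).1 (hsplit ▸ h1)
      · exact (ENNReal.rpow_pos (pos_iff_ne_zero.2 h0) hIt).ne'
      · exact ENNReal.rpow_ne_top_of_nonneg (by positivity) hIt
    have h3 := ENNReal.rpow_le_rpow h2 hr0.le
    rw [ENNReal.mul_rpow_of_nonneg _ _ hr0.le, ← ENNReal.rpow_mul, ← ENNReal.rpow_mul,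
      one_div_mul_cancel hr0.ne', ENNReal.rpow_one, ENNReal.rpow_one] at h3
    exact h3
  have hlim : ∀ x, Tendsto (fun n => B n x ^ r) atTop (𝓝 (A x ^ r)) := by
    intro x
    refine (ENNReal.continuous_rpow_const.tendsto _).comp ?_
    have h1 : Tendsto (fun n : ℕ => min (A x) (n : ℝ≥0∞)) atTop (𝓝 (A x)) := by
      have := (tendsto_const_nhds (x := A x)).min ENNReal.tendsto_nat_nhds_top
      rwa [min_top_right] at this
    refine h1.congr' ?_
    have hx : x ∈ ⋃ n, S n := by rw [hS, iUnion_spanningSets]; trivial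
    obtain ⟨N, hN⟩ := mem_iUnion.1 hx
    filter_upwards [eventually_ge_atTop N] with n hn
    simp only [hB]
    rw [indicator_of_mem (monotone_spanningSets μ hn hN)]
  calc ∫⁻ x, A x ^ r ∂μ = ∫⁻ x, liminf (fun n => B n x ^ r) atTop ∂μ :=
        lintegral_congr fun x => (hlim x).liminf_eq.symm
    _ ≤ liminf (fun n => ∫⁻ x, B n x ^ r ∂μ) atTop :=
        lintegral_liminf_le fun n => (hBm n).pow_const r
    _ ≤ _ := liminf_le_of_le (by isBoundedDefault) fun b hb => by
        obtain ⟨n, hbn⟩ := hb.exists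
        exact hbn.trans (hn n)

/-- The square function is bounded on `L^p`, `p ≥ 2`, in the form of integrals of `p`-th powers. -/
theorem exists_lintegral_evolutionSq_rpow_le {d m : ℕ} (hd : 1 ≤ d) (hm : 1 ≤ m) {p ν : ℝ} (K : ℝ)
    (hp : 2 ≤ p) (hν : 0 < ν) :
    ∃ C : ℝ≥0, ∀ a : (Fin d → ℕ) → (Fin d → ℕ) → ℝ → ℂ, IsEllipticCoeff m ν K a →
      ∀ (H : Type u) [NormedAddCommGroup H] [InnerProductSpace ℂ H] [CompleteSpace H]
      (f : ℝ × Space d → H), Continuous f → HasCompactSupport f →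
      ∫⁻ z, evolutionSq m a f z ^ (p / 2) ≤ C * ∫⁻ z, ‖f z‖ₑ ^ p := by
  obtain ⟨C, hC⟩ := exists_lintegral_evolutionSq_mul_le.{u} d hm K hν
  rcases hp.eq_or_lt with rfl | hp
  · -- for `p = 2` the weight `1` suffices
    refine ⟨C, fun a ha H _ _ _ f hf hfc => ?_⟩
    have h1 := hC a ha H f hf hfc (fun _ => 1) measurable_const
    simp only [mul_one] at h1
    rw [div_self two_ne_zero]
    simp only [ENNReal.rpow_one, ENNReal.rpow_two]
    refine h1.trans (mul_le_mul_right (lintegral_mono fun z => ?_) _)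
    exact mul_le_of_le_one_left zero_le (iteratedMaximal_one_le z)
  · have hr : 1 < p / 2 := by linarith
    have hrq := Real.HolderConjugate.conjExponent hr
    obtain ⟨D, hD⟩ := exists_lintegral_iteratedMaximal_rpow_le hd hrq.symm.lt
    refine ⟨(C * D ^ (1 / Real.conjExponent (p / 2))) ^ (p / 2), fun a ha H _ _ _ f hf hfc => ?_⟩
    have h1 := lintegral_rpow_le_of_weighted hrq (ha.measurable_evolutionSq hf)
      (hf.enorm.measurable.pow_const 2) (fun h hh => measurable_iteratedMaximal hh) hD
      (hC a ha H f hf hfc)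
    refine h1.trans_eq ?_
    have h2 : ∀ z, (‖f z‖ₑ ^ 2) ^ (p / 2) = ‖f z‖ₑ ^ p := fun z => by
      rw [← ENNReal.rpow_two, ← ENNReal.rpow_mul, mul_div_cancel₀ _ two_ne_zero]
    simp_rw [h2]
    rw [ENNReal.coe_rpow_of_nonneg _ (by linarith), ENNReal.coe_mul,
      ENNReal.coe_rpow_of_nonneg _ (one_div_nonneg.2 hrq.symm.nonneg)]

end HigherOrderLP

theorem mainTheorem3 (d m : ℕ) (hd : 1 ≤ d) (hm : 1 ≤ m) (p ν K : ℝ) (hp : 2 ≤ p) (hν : 0 < ν) :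
    ∃ N : ℝ≥0,
      ∀ a : (Fin d → ℕ) → (Fin d → ℕ) → ℝ → ℂ, HigherOrderLP.IsEllipticCoeff m ν K a →
      ∀ (H : Type u) [NormedAddCommGroup H] [InnerProductSpace ℂ H] [CompleteSpace H]
        (f : ℝ × HigherOrderLP.Space d → H), ContDiff ℝ ∞ f → HasCompactSupport f →
        eLpNorm (HigherOrderLP.squareFunction
            (fun t s => HigherOrderLP.fracLaplacian ((m : ℝ) / 2) (HigherOrderLP.kernelP1 m a t s))
            f) (ENNReal.ofReal p) volume
          ≤ N * eLpNorm f (ENNReal.ofReal p) volume := by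
  obtain ⟨C, hC⟩ := HigherOrderLP.exists_lintegral_evolutionSq_rpow_le.{u} hd hm K hp hν
  have hp0 : 0 < p := by linarith
  set k : ℝ≥0 := ((2 * Real.pi) ^ (2 * m)).toNNReal with hk
  refine ⟨(k ^ (p / 2) * C) ^ (1 / p), fun a ha H _ _ _ f hf hfc => ?_⟩
  rw [eLpNorm_eq_lintegral_rpow_enorm_toReal (by simpa using hp0) ENNReal.ofReal_ne_top,
    eLpNorm_eq_lintegral_rpow_enorm_toReal (by simpa using hp0) ENNReal.ofReal_ne_top,
    ENNReal.toReal_ofReal hp0.le, ENNReal.coe_rpow_of_nonneg _ (by positivity),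
    ← ENNReal.mul_rpow_of_nonneg _ _ (by positivity)]
  refine ENNReal.rpow_le_rpow ?_ (by positivity)
  have h1 : ∀ z, ‖HigherOrderLP.squareFunction (fun t s =>
      HigherOrderLP.fracLaplacian ((m : ℝ) / 2) (HigherOrderLP.kernelP1 m a t s)) f z‖ₑ ^ p =
      (k : ℝ≥0∞) ^ (p / 2) * HigherOrderLP.evolutionSq m a f z ^ (p / 2) := by
    intro z
    rw [enorm_eq_self, ha.squareFunction_eq hm hν, ← ENNReal.rpow_mul, one_div_mul_eq_div,
      ENNReal.mul_rpow_of_nonneg _ _ (by positivity)]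
    rfl
  simp_rw [h1]
  rw [lintegral_const_mul' _ _ (by finiteness), ENNReal.coe_mul,
    ENNReal.coe_rpow_of_nonneg _ (by positivity), mul_assoc]
  exact mul_le_mul_right (hC a ha H f hf.continuous hfc) _
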